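/- Let $X$ be a complex surface (a Hausdorff, second countable complex manifold of dimension $2$) and let $\Omega\subset X$ be a relatively compact domain with $C^\infty$-smooth boundary $M=\partial\Omega$. Put $T^{1,0}_M=(\mathbb C\otimes TM)\cap T^{1,0}X$ and $T^{0,1}_M=\overline{T^{1,0}_M}$. **CR notions.** A *trivialization* is a smooth, nowhere vanishing, purely imaginary $1$-form $\eta$ on $M$ annihilating $T^{1,0}_M\oplus T^{0,1}_M$; its Levi form is $\lambda_\eta(L,L')=\eta([L,\overline{L'}])$ for $L,L'\in T^{1,0}_M$, and $\eta$ is *positive* if $\lambda_\eta(L,L)\ge 0$ for all $L$. Let $\mathcal N\subset T^{1,0}_M$ be the kernel of the Levi form; $M$ is *Levi-flat* if $\mathcal N=T^{1,0}_M$. Given a purely imaginary vector field $T$ on $M$ with $\eta(T)=1$, the *D'Angelo $(1,0)$-form* $\omega_\eta$ is the $\mathbb C$-linear form on $\mathbb C\otimes TM$ with $\omega_\eta(L)=\eta([T,L])$ for $L\in T^{1,0}_M$ that vanishes on $T^{0,1}_M\oplus\mathbb C T$. Let $\overline\partial_b\omega_\eta$ be the $(1,1)$-part of $d\omega_\eta$,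 i.e. $\overline\partial_b\omega_\eta(L,\overline{L'})=-\overline{L'}(\omega_\eta(L))-\omega_\eta([L,\overline{L'}])$, and $(\omega_\eta\wedge\overline{\omega}_\eta)(L,\overline L)=|\omega_\eta(L)|^2$. On $\mathcal N$ these quadratic forms do not depend on $T$. **Indices.** A *defining function* of $\Omega$ is a smooth $\rho:X\to\mathbb R$ with $\Omega=\{\rho<0\}$ and $d\rho\neq 0$ on $M$. Define $$DF_s(\Omega)=\sup\{0<\gamma<1:\ -(-\rho)^\gamma\text{ is strictly plurisubharmonic on }\Omega\cap W\text{ for some defining function }\rho\text{ and some open }W\supset M\},$$ $$DF_s(M)=\sup\Big\{0<\gamma<1:\ \overline\partial_b\omega_\eta-\tfrac{\gamma}{1-\gamma}\,\omega_\eta\wedge\overline{\omega}_\eta>0\text{ on }\mathcal N\text{ for some positive trivialization }\eta\Big\},$$ and define $DF_w(\Omega)$, $DF_w(M)$ in the same way with "strictly plurisubharmonic" replaced by "plurisubharmonic" and "$>0$" by "$\ge 0$"; the supremum of the empty set is taken to be $0$. **Leafwise curvature.** Let $M$ be Levi-flat. Then $M$ is foliated by complex curves tangent to $\operatorname{Re}T^{1,0}_M$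 (the Levi foliation), and its normal bundle $N^{1,0}_M=\mathbb C\otimes TM/(T^{1,0}_M\oplus T^{0,1}_M)$ restricts to a holomorphic line bundle on each leaf, with $\overline\partial_{\overline L}[V]=[\,[\overline L,V]\,]$. For a smooth hermitian metric $h$ of $N^{1,0}_M$, the leafwise curvature is the curvature $\Theta$ of the Chern connection of $(N^{1,0}_M,h)$ along the leaves; it is *positive* if $\Theta(L,\overline L)>0$ for all $0\ne L\in T^{1,0}_M$. (In a foliated chart $(z,t)$, $\Theta=\overline\partial\partial\log h(\partial_t,\partial_t)$ along the leaves $t=\text{const}$.) **Statement.** Suppose that $M=\partial\Omega$ is Levi-flat and that $N^{1,0}_M$ admits a smooth hermitian metric with positive leafwise curvature. Then $$0<DF_s(M)=DF_s(\Omega)=DF_w(\Omega)=DF_w(M).$$ -/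

import Mathlib

open Set Topology
open scoped Manifold ContDiff

noncomputable section

namespace CRGeometry

/-- A complex manifold is, by restriction of scalars, a smooth real manifold. -/
instance realManifold {E : Type*} [NormedAddCommGroup E] [NormedSpace ℂ E]
    {X : Type*} [TopologicalSpace X] [ChartedSpace E X] [h : IsManifold 𝓘(ℂ, E) ω X] :
    IsManifold 𝓘(ℝ, E) ∞ X := by
  refine isManifold_of_contDiffOn 𝓘(ℝ, E) ∞ X fun e e' he he' => ?_
  have h1 := (contDiffGroupoid ω 𝓘(ℂ, E)).compatible he he'
  rw [contDiffGroupoid, mem_groupoid_of_pregroupoid] at h1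
  exact (h1.1.restrict_scalars ℝ).of_le le_top

variable {E : Type*} [NormedAddCommGroup E] [NormedSpace ℂ E]
  {X : Type*} [TopologicalSpace X] [ChartedSpace E X]

/-! ### Real and complexified tangent vectors, vector fields and 1-forms -/

/-- The complex structure of `T_q X`. (In the identification of `T_q X` with the model space given
by the preferred chart at `q`, which is holomorphic, it is multiplication by `i`.) -/
def J (q : X) (v : TangentSpace 𝓘(ℝ, E) q) : TangentSpace 𝓘(ℝ, E) q :=
  let w : E := v
  (Complex.I • w : E)

/-- The complexified tangent space `ℂ ⊗ T_q X`; the pair `(a, b)` stands for `a + i b`. -/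
abbrev CTangent (E : Type*) [NormedAddCommGroup E] [NormedSpace ℂ E]
    {X : Type*} [TopologicalSpace X] [ChartedSpace E X] (q : X) : Type _ :=
  TangentSpace 𝓘(ℝ, E) q × TangentSpace 𝓘(ℝ, E) q

/-- Complex vector fields `A + i B`, as pairs of real ones. -/
abbrev CField (E : Type*) [NormedAddCommGroup E] [NormedSpace ℂ E]
    (X : Type*) [TopologicalSpace X] [ChartedSpace E X] : Type _ :=
  (q : X) → CTangent E q

/-- Complex-valued real-linear 1-forms on `X`; they act on complexified vectors by complex-linear
extension, see `pair`. -/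
abbrev CForm (E : Type*) [NormedAddCommGroup E] [NormedSpace ℂ E]
    (X : Type*) [TopologicalSpace X] [ChartedSpace E X] : Type _ :=
  (q : X) → (TangentSpace 𝓘(ℝ, E) q →L[ℝ] ℂ)

/-- Fields of real bilinear forms on the tangent spaces of `X`. -/
abbrev BilinField (E : Type*) [NormedAddCommGroup E] [NormedSpace ℂ E]
    (X : Type*) [TopologicalSpace X] [ChartedSpace E X] : Type _ :=
  (q : X) → (TangentSpace 𝓘(ℝ, E) q →L[ℝ] TangentSpace 𝓘(ℝ, E) q →L[ℝ] ℝ)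

/-- Complex conjugation of complexified vectors. -/
def CTangent.conj {q : X} (Z : CTangent E q) : CTangent E q := (Z.1, -Z.2)

/-- Complex conjugate of a complex vector field. -/
def CField.conj (Z : CField E X) : CField E X := fun q => CTangent.conj (Z q)

/-- The value `β(Z) = β(a) + i β(b)` of a 1-form on a complexified vector `Z = a + i b`. -/
def pair (β : CForm E X) {q : X} (Z : CTangent E q) : ℂ :=
  β q Z.1 + Complex.I * β q Z.2

/-- The function `β(Z)`. -/
def pairField (β : CForm E X) (Z : CField E X) : X → ℂ := fun q => pair β (Z q)

/-- The complex-bilinear extension of the Lie bracket of vector fields. -/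
def bracket (Z W : CField E X) : CField E X := fun q =>
  (VectorField.mlieBracket 𝓘(ℝ, E) (fun x => (Z x).1) (fun x => (W x).1) q
      - VectorField.mlieBracket 𝓘(ℝ, E) (fun x => (Z x).2) (fun x => (W x).2) q,
    VectorField.mlieBracket 𝓘(ℝ, E) (fun x => (Z x).1) (fun x => (W x).2) q
      + VectorField.mlieBracket 𝓘(ℝ, E) (fun x => (Z x).2) (fun x => (W x).1) q)

/-- The derivative `Z g` at `q` of a complex function along a complexified vector. -/
def dirDeriv (g : X → ℂ) {q : X} (Z : CTangent E q) : ℂ :=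
  let d : TangentSpace 𝓘(ℝ, E) q →L[ℝ] ℂ := mfderiv 𝓘(ℝ, E) 𝓘(ℝ, ℂ) g q
  d Z.1 + Complex.I * d Z.2

/-- The exterior derivative `dβ(Z, W) = Z β(W) - W β(Z) - β([Z, W])` at `q`. -/
def extD (β : CForm E X) (Z W : CField E X) (q : X) : ℂ :=
  dirDeriv (pairField β W) (Z q) - dirDeriv (pairField β Z) (W q) - pair β (bracket Z W q)

section
variable [IsManifold 𝓘(ℝ, E) ∞ X]

/-- Smooth real vector fields on `U`. -/
def SmoothField (U : Set X) (V : (q : X) → TangentSpace 𝓘(ℝ, E) q) : Prop :=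
  ContMDiffOn 𝓘(ℝ, E) 𝓘(ℝ, E).tangent ∞ (fun q => (⟨q, V q⟩ : TangentBundle 𝓘(ℝ, E) X)) U

/-- Smooth complex vector fields on `U`. -/
def SmoothCField (U : Set X) (Z : CField E X) : Prop :=
  SmoothField U (fun q => (Z q).1) ∧ SmoothField U (fun q => (Z q).2)

/-- Smooth 1-forms on the open set `U`: they take smooth vector fields to smooth functions. -/
def SmoothForm (U : Set X) (β : CForm E X) : Prop :=
  ∀ U' ⊆ U, IsOpen U' → ∀ V : (q : X) → TangentSpace 𝓘(ℝ, E) q, SmoothField U' V →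
    ContMDiffOn 𝓘(ℝ, E) 𝓘(ℝ, ℂ) ∞ (fun q => β q (V q)) U'

end

/-! ### The CR structure of a smooth real hypersurface `M` of `X`

Smooth functions, forms and vector fields on `M` are the restrictions to `M` of smooth functions,
forms, and vector fields tangent to `M` along `M`, on open sets of `X`.  For vector fields tangent
to `M` the Lie bracket at a point of `M`, and for forms all quantities below, only depend on these
restrictions. -/

/-- The tangent space `T_p M`: the vectors that kill the smooth functions vanishing on `M`. -/
def tangentOf (M : Set X) (p : X) : Set (TangentSpace 𝓘(ℝ, E) p) :=
  {v | ∀ (U : Set X) (f : X → ℝ), IsOpen U → p ∈ U → ContMDiffOn 𝓘(ℝ, E) 𝓘(ℝ, ℝ) ∞ f U →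
    (∀ q ∈ M ∩ U, f q = 0) → (mfderiv 𝓘(ℝ, E) 𝓘(ℝ, ℝ) f p v : ℝ) = 0}

/-- The complex tangent space `T_p M ∩ J T_p M`, i.e. `Re T^{1,0}`. -/
def complexTangentOf (M : Set X) (p : X) : Set (TangentSpace 𝓘(ℝ, E) p) :=
  {v | v ∈ tangentOf M p ∧ J p v ∈ tangentOf M p}

/-- `ℂ ⊗ T_p M`. -/
def CTangentOf (M : Set X) (p : X) : Set (CTangent E p) :=
  {Z | Z.1 ∈ tangentOf M p ∧ Z.2 ∈ tangentOf M p}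

/-- `T^{1,0}_{M,p}`: the vectors of `ℂ ⊗ T_p M` of type `(1,0)`, i.e. of the form `a - i J a`. -/
def T10 (M : Set X) (p : X) : Set (CTangent E p) :=
  {Z | Z ∈ CTangentOf M p ∧ Z.2 = -J p Z.1}

/-- `T^{1,0}_{M,p} ⊕ T^{0,1}_{M,p}`. -/
def T10plusT01 (M : Set X) (p : X) : Set (CTangent E p) :=
  {Z | Z.1 ∈ complexTangentOf M p ∧ Z.2 ∈ complexTangentOf M p}

section
variable [IsManifold 𝓘(ℝ, E) ∞ X]

/-- Smooth sections of `T^{1,0}_M` over `M ∩ U`. -/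
structure IsT10Section (M U : Set X) (L : CField E X) : Prop where
  isOpen : IsOpen U
  smooth : SmoothCField U L
  mem : ∀ q ∈ M ∩ U, L q ∈ T10 M q

/-- A trivialization of `ℂ ⊗ TM / (T^{1,0}_M ⊕ T^{0,1}_M)`: a purely imaginary non-vanishing smooth
1-form on `M` annihilating `T^{1,0}_M ⊕ T^{0,1}_M`. -/
structure IsTrivialization (M : Set X) (η : CForm E X) : Prop where
  smooth : ∃ W : Set X, IsOpen W ∧ M ⊆ W ∧ SmoothForm W η
  imaginary : ∀ p ∈ M, ∀ v ∈ tangentOf M p, (η p v).re = 0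
  annihilates : ∀ p ∈ M, ∀ v ∈ complexTangentOf M p, η p v = 0
  nonvanishing : ∀ p ∈ M, ∃ v ∈ tangentOf M p, η p v ≠ 0

/-- The Levi form `λ_η(L, L') = η([L, conj L'])` at `p`. -/
def leviForm (η : CForm E X) (L L' : CField E X) (p : X) : ℂ :=
  pair η (bracket L L'.conj p)

/-- The kernel of the Levi form at `p`. -/
def nullSpace (M : Set X) (η : CForm E X) (p : X) : Set (CTangent E p) :=
  {Z | Z ∈ T10 M p ∧ ∀ (U : Set X) (L L' : CField E X), p ∈ U → IsT10Section M U L →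
    IsT10Section M U L' → L p = Z → leviForm η L L' p = 0}

/-- `M` is Levi-flat: the kernel of the Levi form is all of `T^{1,0}_M`. -/
def IsLeviFlat (E : Type*) [NormedAddCommGroup E] [NormedSpace ℂ E]
    {X : Type*} [TopologicalSpace X] [ChartedSpace E X] [IsManifold 𝓘(ℝ, E) ∞ X]
    (M : Set X) : Prop :=
  ∀ η : CForm E X, IsTrivialization M η → ∀ p ∈ M, nullSpace M η p = T10 M p

/-- Positive trivializations: the Levi form `λ_η` is non-negative. -/
structure IsPositiveTrivialization (M : Set X) (η : CForm E X) : Prop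
    extends IsTrivialization M η where
  levi_nonneg : ∀ p ∈ M, ∀ (U : Set X) (L : CField E X), p ∈ U → IsT10Section M U L →
    0 ≤ (leviForm η L L p).re

/-- Transversal vector fields on `M ∩ U` normalized by `η(T) = 1`; they are purely imaginary. -/
structure IsTransversal (M U : Set X) (η : CForm E X) (T : CField E X) : Prop where
  smooth : SmoothCField U T
  tangent : ∀ q ∈ M ∩ U, T q ∈ CTangentOf M q
  imaginary : ∀ q ∈ M ∩ U, (T q).1 = 0
  normalized : ∀ q ∈ M ∩ U, pair η (T q) = 1

/-- `σ` is the D'Angelo `(1,0)`-form of `η` on `M ∩ U` for the transversal field `T`: it agrees with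
`α_η(L) = η([T, L])` on `T^{1,0}_M` and annihilates `T^{0,1}_M ⊕ ℂ T`. -/
structure IsDAngeloForm (M U : Set X) (η : CForm E X) (T : CField E X) (σ : CForm E X) : Prop where
  smooth : SmoothForm U σ
  on_T10 : ∀ (U' : Set X) (L : CField E X), U' ⊆ U → IsT10Section M U' L → ∀ q ∈ M ∩ U',
    pair σ (L q) = pair η (bracket T L q)
  on_T01 : ∀ q ∈ M ∩ U, ∀ Z ∈ T10 M q, pair σ (CTangent.conj Z) = 0
  on_T : ∀ q ∈ M ∩ U, pair σ (T q) = 0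

/-- The quantity `(∂bar_b σ - γ / (1 - γ) σ ∧ conj σ)(L, conj L)` at `p` for a `(1,0)`-form `σ`.  As
`σ` vanishes on `T^{0,1}_M`, the `(1,1)`-form `∂bar_b σ` is
`∂bar_b σ (L, conj L) = dσ (L, conj L) = - conj L (σ(L)) - σ([L, conj L])`. -/
def dfForm (γ : ℝ) (σ : CForm E X) (L : CField E X) (p : X) : ℝ :=
  (extD σ L L.conj p).re - γ / (1 - γ) * ‖pair σ (L p)‖ ^ 2

/-- `∂bar_b ω_η - γ / (1 - γ) ω_η ∧ conj ω_η > 0` on the kernel of the Levi form, where `ω_η` is the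
D'Angelo `(1,0)`-form of `η` (on the kernel nothing depends on the choice of `T` or `L`). -/
def StrongDF (M : Set X) (γ : ℝ) (η : CForm E X) : Prop :=
  ∀ p ∈ M, ∀ (U : Set X) (T : CField E X) (σ : CForm E X) (L : CField E X), p ∈ U →
    IsTransversal M U η T → IsDAngeloForm M U η T σ → IsT10Section M U L →
    L p ∈ nullSpace M η p → L p ≠ 0 → 0 < dfForm γ σ L p

/-- `∂bar_b ω_η - γ / (1 - γ) ω_η ∧ conj ω_η ≥ 0` on the kernel of the Levi form. -/
def WeakDF (M : Set X) (γ : ℝ) (η : CForm E X) : Prop :=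
  ∀ p ∈ M, ∀ (U : Set X) (T : CField E X) (σ : CForm E X) (L : CField E X), p ∈ U →
    IsTransversal M U η T → IsDAngeloForm M U η T σ → IsT10Section M U L →
    L p ∈ nullSpace M η p → 0 ≤ dfForm γ σ L p

/-- The strong Diederich-Fornaess index of the CR manifold `M` (`0` if there is no admissible
exponent: `sSup ∅ = 0`). -/
def DFsBoundary (E : Type*) [NormedAddCommGroup E] [NormedSpace ℂ E]
    {X : Type*} [TopologicalSpace X] [ChartedSpace E X] [IsManifold 𝓘(ℝ, E) ∞ X]
    (M : Set X) : ℝ :=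
  sSup {γ : ℝ | 0 < γ ∧ γ < 1 ∧ ∃ η : CForm E X, IsPositiveTrivialization M η ∧ StrongDF M γ η}

/-- The weak Diederich-Fornaess index of the CR manifold `M`. -/
def DFwBoundary (E : Type*) [NormedAddCommGroup E] [NormedSpace ℂ E]
    {X : Type*} [TopologicalSpace X] [ChartedSpace E X] [IsManifold 𝓘(ℝ, E) ∞ X]
    (M : Set X) : ℝ :=
  sSup {γ : ℝ | 0 < γ ∧ γ < 1 ∧ ∃ η : CForm E X, IsPositiveTrivialization M η ∧ WeakDF M γ η}

end

/-! ### Domains with smooth boundary and their indices -/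

/-- The boundary of the open set `Ω` is smooth: near each boundary point, `Ω` is a sublevel set of a
smooth function without critical point there. -/
def HasSmoothBoundary (E : Type*) [NormedAddCommGroup E] [NormedSpace ℂ E]
    {X : Type*} [TopologicalSpace X] [ChartedSpace E X] (Ω : Set X) : Prop :=
  ∀ p ∈ frontier Ω, ∃ (U : Set X) (r : X → ℝ), IsOpen U ∧ p ∈ U ∧
    ContMDiffOn 𝓘(ℝ, E) 𝓘(ℝ, ℝ) ∞ r U ∧ mfderiv 𝓘(ℝ, E) 𝓘(ℝ, ℝ) r p ≠ 0 ∧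
    ∀ q ∈ U, q ∈ Ω ↔ r q < 0

/-- Global smooth defining functions of `Ω`. -/
structure IsDefiningFunction (E : Type*) [NormedAddCommGroup E] [NormedSpace ℂ E]
    {X : Type*} [TopologicalSpace X] [ChartedSpace E X] (Ω : Set X) (ρ : X → ℝ) : Prop where
  smooth : ContMDiff 𝓘(ℝ, E) 𝓘(ℝ, ℝ) ∞ ρ
  eq_sublevel : Ω = {q | ρ q < 0}
  regular : ∀ p ∈ frontier Ω, mfderiv 𝓘(ℝ, E) 𝓘(ℝ, ℝ) ρ p ≠ 0

/-- The complex Hessian `(∂ ∂bar f)(v, conj v) = ∑ f_{j kbar} v_j conj(v_k)` at `q`, computed in the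
preferred holomorphic chart at `q` as `(D²f(v, v) + D²f(iv, iv)) / 4`. -/
def complexHessian (f : X → ℝ) (q : X) (v : E) : ℝ :=
  (iteratedFDeriv ℝ 2 (f ∘ (chartAt E q).symm) (chartAt E q q) ![v, v]
    + iteratedFDeriv ℝ 2 (f ∘ (chartAt E q).symm) (chartAt E q q)
        ![Complex.I • v, Complex.I • v]) / 4

/-- A smooth function is strictly plurisubharmonic on the open set `S`. -/
def IsStrictlyPSHOn (E : Type*) [NormedAddCommGroup E] [NormedSpace ℂ E]
    {X : Type*} [TopologicalSpace X] [ChartedSpace E X] (f : X → ℝ) (S : Set X) : Prop :=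
  ∀ q ∈ S, ∀ v : E, v ≠ 0 → 0 < complexHessian f q v

/-- A smooth function is plurisubharmonic on the open set `S`. -/
def IsPSHOn (E : Type*) [NormedAddCommGroup E] [NormedSpace ℂ E]
    {X : Type*} [TopologicalSpace X] [ChartedSpace E X] (f : X → ℝ) (S : Set X) : Prop :=
  ∀ q ∈ S, ∀ v : E, 0 ≤ complexHessian f q v

/-- The strong Diederich-Fornaess index of the domain `Ω`. -/
def DFsDomain (E : Type*) [NormedAddCommGroup E] [NormedSpace ℂ E]
    {X : Type*} [TopologicalSpace X] [ChartedSpace E X] (Ω : Set X) : ℝ :=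
  sSup {γ : ℝ | 0 < γ ∧ γ < 1 ∧ ∃ (ρ : X → ℝ) (W : Set X), IsDefiningFunction E Ω ρ ∧
    IsOpen W ∧ frontier Ω ⊆ W ∧ IsStrictlyPSHOn E (fun q => -(-ρ q) ^ γ) (Ω ∩ W)}

/-- The weak Diederich-Fornaess index of the domain `Ω`. -/
def DFwDomain (E : Type*) [NormedAddCommGroup E] [NormedSpace ℂ E]
    {X : Type*} [TopologicalSpace X] [ChartedSpace E X] (Ω : Set X) : ℝ :=
  sSup {γ : ℝ | 0 < γ ∧ γ < 1 ∧ ∃ (ρ : X → ℝ) (W : Set X), IsDefiningFunction E Ω ρ ∧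
    IsOpen W ∧ frontier Ω ⊆ W ∧ IsPSHOn E (fun q => -(-ρ q) ^ γ) (Ω ∩ W)}

/-! ### Hermitian metrics of the normal bundle of the Levi foliation -/

section
variable [IsManifold 𝓘(ℝ, E) ∞ X]

/-- A smooth hermitian metric of the complex line bundle
`N^{1,0}_M = ℂ ⊗ TM / (T^{1,0}_M ⊕ T^{0,1}_M) = ℂ ⊗ (TM / Re T^{1,0}_M)`.  The complexification of a
real line carries exactly the sesquilinear extensions of the inner products of that line, so the
metric is given by a symmetric bilinear form on `T_p M` which descends to an inner product on the
quotient by the complex tangent space. -/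
structure IsNormalMetric (M : Set X)
    (h : BilinField E X) : Prop where
  smooth : ∃ W : Set X, IsOpen W ∧ M ⊆ W ∧ ∀ U' ⊆ W, IsOpen U' →
    ∀ V V' : (q : X) → TangentSpace 𝓘(ℝ, E) q, SmoothField U' V → SmoothField U' V' →
      ContMDiffOn 𝓘(ℝ, E) 𝓘(ℝ, ℝ) ∞ (fun q => h q (V q) (V' q)) U'
  symm : ∀ p ∈ M, ∀ v ∈ tangentOf M p, ∀ w ∈ tangentOf M p, h p v w = h p w v
  descends : ∀ p ∈ M, ∀ v ∈ complexTangentOf M p, ∀ w ∈ tangentOf M p, h p v w = 0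
  pos : ∀ p ∈ M, ∀ v ∈ tangentOf M p, v ∉ complexTangentOf M p → 0 < h p v v

/-- `θ` is the connection form of the leafwise Chern connection `∇` of `(N^{1,0}_M, h)` over `M ∩ U`
in the frame `[V]` given by a real vector field `V` tangent to `M` and transversal to the leaves,
`∇_Z [V] = θ(Z) [V]` for `Z` tangent to the leaves.

The leafwise holomorphic structure of `N^{1,0}_M` is the one of the canonical flat connection of
the normal bundle of a foliation, `∂bar_{conj L} [V] = [[conj L, V]]` modulo
`T^{1,0}_M ⊕ T^{0,1}_M`; its flat frames are the `[∂/∂t]` of the foliated charts `(z, t)`.  The Chern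
connection is the connection whose `(0,1)`-part is this operator and which is compatible with `h`:
`L h(V, V) = h(∇_L V, V) + h(V, ∇_{conj L} V)`. -/
structure IsLeafwiseChernForm (M U : Set X)
    (h : BilinField E X)
    (V : (q : X) → TangentSpace 𝓘(ℝ, E) q) (θ : CForm E X) : Prop where
  frame_smooth : SmoothField U V
  frame_tangent : ∀ q ∈ M ∩ U, V q ∈ tangentOf M q
  frame_transversal : ∀ q ∈ M ∩ U, V q ∉ complexTangentOf M q
  smooth : SmoothForm U θ
  holomorphic : ∀ (U' : Set X) (L : CField E X), U' ⊆ U → IsT10Section M U' L → ∀ q ∈ M ∩ U',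
    bracket L.conj (fun x => (V x, 0)) q
      - ((pair θ (L.conj q)).re • V q, (pair θ (L.conj q)).im • V q) ∈ T10plusT01 M q
  metric : ∀ (U' : Set X) (L : CField E X), U' ⊆ U → IsT10Section M U' L → ∀ q ∈ M ∩ U',
    dirDeriv (fun x => ((h x (V x) (V x) : ℝ) : ℂ)) (L q)
      = pair θ (L q) * ((h q (V q) (V q) : ℝ) : ℂ)
        + ((h q (V q) (V q) : ℝ) : ℂ) * (starRingEnd ℂ) (pair θ (L.conj q))

/-- The leafwise curvature `Θ = dθ` of `(N^{1,0}_M, h)` is positive: `Θ(L, conj L) > 0` for all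
non-zero `(1,0)`-vectors `L` tangent to the leaves. -/
def HasPositiveLeafwiseCurvature (M : Set X)
    (h : BilinField E X) : Prop :=
  ∀ p ∈ M, ∀ (U : Set X) (V : (q : X) → TangentSpace 𝓘(ℝ, E) q) (θ : CForm E X) (L : CField E X),
    p ∈ U → IsLeafwiseChernForm M U h V θ → IsT10Section M U L → L p ≠ 0 →
    0 < (extD θ L L.conj p).re

end

end CRGeometry

end

set_option linter.unusedSectionVars false
set_option maxSynthPendingDepth 3

noncomputable section

namespace CRGeometry

/-! ### Calculus in the model space -/

section Flat

variable {E : Type*} [NormedAddCommGroup E] [NormedSpace ℂ E]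

/-! All four indices are governed by one pointwise inequality in a holomorphic chart. Let `r` be a
local equation of the Levi-flat hypersurface, `a` a complex tangent vector and `n` a vector with
`2∂r(n) = 1`. Put `k = leviK r x a n`, a mixed entry of `4∂∂bar r`, and `A = normalLevi r x a n`,
minus the normal derivative of the Levi form on complex tangent vectors. With `a = Re L` and `n = J
(Im T)`, expanding brackets shows that the D'Angelo form is `k` (`IsEquation.pair_bracket`). Since
the Levi form vanishes along the hypersurface, the `(1,1)`-differential of that form is `A - |k|^2`
(`IsFlatPoint.curvature`, `IsEquation.dangelo`). The CR condition therefore reads `|k|^2 < (1 - γ)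
A`, or `≤` in the weak case.

On the side of the domain, up to a positive factor the Levi form of `-(-r)^γ` is `(-r) 4∂∂bar r + (1
- γ) |2∂r|^2`. Put `δ = -r`. On `s a + t n` it is approximately `δ (|s|^2 δ A + 2 Re (s conj t k)) +
(1 - γ) |t|^2`, because the Levi form vanishes at `r = 0` and grows like `δ A`. Rescaling `s` by `δ`
shows that the discriminant condition is again `|k|^2 < (1 - γ) A`. Hence the strict CR condition
gives strict plurisubharmonicity near the boundary (`IsFlatPoint.eventually_pos_of_strictAt`), and
plurisubharmonicity gives the weak CR condition (`IsFlatPoint.weakAt_of_eventually_nonneg`).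
Globally, a trivialization is, up to a local sign, the form `-i dρ ∘ J` of an equation `exp f * ρ`
(`IsEquation.exists_of_trivialization`). The sets of exponents are thus nested: strict CR, strict
domain, weak domain, weak CR.

The circle is closed by interpolation. Replacing `r` by `exp (ε g) r` changes both `k` and `A -
|k|^2` affinely in `ε` (`IsFlatPoint.exp_mul_curvature`). If one equation satisfies the weak
condition with exponent `γ` and another the strict condition with some positive exponent, then a
small step from the first to the second gives the strict condition for any prescribed `γ' < γ`
(`IsFlatPoint.strictAt_interpolation`).

The curvature hypothesis supplies the second equation. Normalize the equation so that the
transversal frame has unit length for `h`. Then `σ - conj σ`, with `σ` the D'Angelo form, is the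
leafwise Chern connection form (`IsEquation.isLeafwiseChernForm`), and its curvature is twice the
real part of `dσ`. Positivity of the curvature is the strict condition for exponent `0`
(`IsEquation.strictAt_zero`), and compactness of the boundary makes the exponent positive
(`IsEquation.exists_isStrict`). -/

/-- The Hessian of `r`. -/
def hess (r : E → ℝ) (x : E) : E →L[ℝ] E →L[ℝ] ℝ := fderiv ℝ (fderiv ℝ r) x

/-- The third derivative of `r`. -/
def third (r : E → ℝ) (x : E) : E →L[ℝ] E →L[ℝ] E →L[ℝ] ℝ :=
  fderiv ℝ (fderiv ℝ (fderiv ℝ r)) x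

/-- The complex linear form `2 ∂r`. -/
def holoD (r : E → ℝ) (x v : E) : ℂ :=
  ⟨fderiv ℝ r x v, -fderiv ℝ r x (Complex.I • v)⟩

/-- The sesquilinear form `4 ∂∂bar r`. -/
def leviK (r : E → ℝ) (x v w : E) : ℂ :=
  ⟨hess r x v w + hess r x (Complex.I • v) (Complex.I • w),
    hess r x v (Complex.I • w) - hess r x (Complex.I • v) w⟩

/-- Minus the derivative in the direction `n` of the Levi form of `r` at a complex tangent vector
`a` extended tangentially to the level sets of `r`. -/
def normalLevi (r : E → ℝ) (x a n : E) : ℝ :=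
  -(third r x n a a + third r x n (Complex.I • a) (Complex.I • a))
    + 2 * (hess r x n a * (leviK r x n a).re + hess r x n (Complex.I • a) * (leviK r x n a).im)

/-- The level set `r = 0` is Levi-flat near `x`. -/
def FlatNear (r : E → ℝ) (x : E) : Prop :=
  ∀ᶠ y in 𝓝 x, r y = 0 → ∀ v, holoD r y v = 0 → leviK r y v v = 0

lemma I_smul_I_smul (v : E) : Complex.I • Complex.I • v = -v := by
  rw [smul_smul, Complex.I_mul_I, neg_one_smul]

lemma holoD_eq_zero_iff {r : E → ℝ} {x v : E} :
    holoD r x v = 0 ↔ fderiv ℝ r x v = 0 ∧ fderiv ℝ r x (Complex.I • v) = 0 := by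
  simp [holoD, Complex.ext_iff]

lemma holoD_eq_one_iff {r : E → ℝ} {x v : E} :
    holoD r x v = 1 ↔ fderiv ℝ r x v = 1 ∧ fderiv ℝ r x (Complex.I • v) = 0 := by
  simp [holoD, Complex.ext_iff]

lemma holoD_add (r : E → ℝ) (x v w : E) : holoD r x (v + w) = holoD r x v + holoD r x w := by
  apply Complex.ext
  · simp [holoD]
  · simp [holoD]; ring

lemma real_smul_I (c : ℝ) (v : E) : Complex.I • c • v = c • Complex.I • v := smul_comm _ _ _

lemma complex_smul_eq (c : ℂ) (v : E) : c • v = c.re • v + c.im • Complex.I • v := by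
  rw [← real_smul_I]
  nth_rewrite 1 [← Complex.re_add_im c]
  rw [add_smul, mul_comm, mul_smul]
  rfl

lemma holoD_smul (r : E → ℝ) (x : E) (c : ℂ) (v : E) :
    holoD r x (c • v) = c * holoD r x v := by
  rw [complex_smul_eq]
  apply Complex.ext <;>
    simp [holoD, real_smul_I, I_smul_I_smul] <;> ring

lemma holoD_sub (r : E → ℝ) (x v w : E) : holoD r x (v - w) = holoD r x v - holoD r x w := by
  apply Complex.ext <;> simp [holoD, smul_sub]; ring

lemma leviK_add_left (r : E → ℝ) (x u v w : E) :
    leviK r x (u + v) w = leviK r x u w + leviK r x v w := by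
  apply Complex.ext <;> simp [leviK] <;> ring

lemma leviK_add_right (r : E → ℝ) (x u v w : E) :
    leviK r x u (v + w) = leviK r x u v + leviK r x u w := by
  apply Complex.ext <;> simp [leviK] <;> ring

lemma leviK_smul_left (r : E → ℝ) (x : E) (c : ℂ) (v w : E) :
    leviK r x (c • v) w = c * leviK r x v w := by
  rw [complex_smul_eq]
  apply Complex.ext <;>
    simp [leviK, real_smul_I, I_smul_I_smul] <;> ring

lemma leviK_smul_right (r : E → ℝ) (x : E) (c : ℂ) (v w : E) :
    leviK r x v (c • w) = (starRingEnd ℂ) c * leviK r x v w := by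
  rw [complex_smul_eq]
  apply Complex.ext <;>
    simp [leviK, real_smul_I, I_smul_I_smul] <;> ring

lemma leviK_sub_left (r : E → ℝ) (x u v w : E) :
    leviK r x (u - v) w = leviK r x u w - leviK r x v w := by
  apply Complex.ext <;> simp [leviK, smul_sub] <;> ring

lemma hess_symm {r : E → ℝ} {x : E} (hr : ContDiffAt ℝ 3 r x) (v w : E) :
    hess r x v w = hess r x w v :=
  (hr.isSymmSndFDerivAt (by simp [minSmoothness_of_isRCLikeNormedField]; norm_num)) v w

lemma leviK_conj {r : E → ℝ} {x : E} (hr : ContDiffAt ℝ 3 r x) (v w : E) :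
    leviK r x w v = (starRingEnd ℂ) (leviK r x v w) := by
  have h1 := hess_symm hr v w
  have h2 := hess_symm hr (Complex.I • v) (Complex.I • w)
  have h3 := hess_symm hr v (Complex.I • w)
  have h4 := hess_symm hr (Complex.I • v) w
  apply Complex.ext <;> simp [leviK] <;> linarith

lemma leviK_self_im {r : E → ℝ} {x : E} (hr : ContDiffAt ℝ 3 r x) (v : E) :
    (leviK r x v v).im = 0 := by
  have := congrArg Complex.im (leviK_conj hr v v)
  simp at this; linarith

lemma contDiffAt_fderiv {r : E → ℝ} {x : E} (hr : ContDiffAt ℝ 3 r x) :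
    ContDiffAt ℝ 2 (fderiv ℝ r) x := hr.fderiv_right (by norm_num)

lemma contDiffAt_hess {r : E → ℝ} {x : E} (hr : ContDiffAt ℝ 3 r x) :
    ContDiffAt ℝ 1 (hess r) x := (contDiffAt_fderiv hr).fderiv_right (by norm_num)

lemma third_symm_left {r : E → ℝ} {x : E} (hr : ContDiffAt ℝ 3 r x) (u v w : E) :
    third r x u v w = third r x v u w := by
  have := (contDiffAt_fderiv hr).isSymmSndFDerivAt
    (by simp [minSmoothness_of_isRCLikeNormedField]) u v
  exact congrArg (fun φ => φ w) this

lemma fderiv_hess_apply {r : E → ℝ} {x : E} (hr : ContDiffAt ℝ 3 r x) {a b : E → E}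
    (ha : DifferentiableAt ℝ a x) (hb : DifferentiableAt ℝ b x) (u : E) :
    fderiv ℝ (fun y => hess r y (a y) (b y)) x u
      = third r x u (a x) (b x) + hess r x (fderiv ℝ a x u) (b x)
        + hess r x (a x) (fderiv ℝ b x u) := by
  have h1 : HasFDerivAt (hess r) (third r x) x :=
    ((contDiffAt_hess hr).differentiableAt one_ne_zero).hasFDerivAt
  rw [((h1.clm_apply ha.hasFDerivAt).clm_apply hb.hasFDerivAt).fderiv]
  simp
  ring

lemma fderiv_fderiv_apply {r : E → ℝ} {x : E} (hr : ContDiffAt ℝ 3 r x) {a : E → E}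
    (ha : DifferentiableAt ℝ a x) (u : E) :
    fderiv ℝ (fun y => fderiv ℝ r y (a y)) x u
      = hess r x u (a x) + fderiv ℝ r x (fderiv ℝ a x u) := by
  have h1 : HasFDerivAt (fderiv ℝ r) (hess r x) x :=
    ((contDiffAt_fderiv hr).differentiableAt two_ne_zero).hasFDerivAt
  rw [(h1.clm_apply ha.hasFDerivAt).fderiv]
  simp
  ring

lemma third_symm_right {r : E → ℝ} {x : E} (hr : ContDiffAt ℝ 3 r x) (u v w : E) :
    third r x u v w = third r x u w v := by
  have h := fderiv_hess_apply hr (differentiableAt_const (x := x) v)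
    (differentiableAt_const (x := x) w) u
  have h' := fderiv_hess_apply hr (differentiableAt_const (x := x) w)
    (differentiableAt_const (x := x) v) u
  have he : (fun y => hess r y v w) =ᶠ[𝓝 x] fun y => hess r y w v := by
    filter_upwards [hr.eventually (by simp)] with y hy using hess_symm hy v w
  rw [he.fderiv_eq] at h
  simpa using h.symm.trans h'

lemma fderiv_I_smul {a : E → E} {x : E} (ha : DifferentiableAt ℝ a x) (u : E) :
    fderiv ℝ (fun y => Complex.I • a y) x u = Complex.I • fderiv ℝ a x u := by
  rw [fderiv_fun_const_smul ha]
  rfl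

/-! #### Functions vanishing on a regular level set -/

/-- A function vanishing on `r = 0` whose normal derivative is smaller than `κ` exceeds `κ r` on the
side `r < 0`. -/
lemma eventually_lt_of_vanish {r f : E → ℝ} {x n : E} {κ : ℝ} (hr : ContDiffAt ℝ 1 r x)
    (hx : r x = 0) (hn : fderiv ℝ r x n = 1) (hf : ContDiffAt ℝ 1 f x)
    (hv : ∀ᶠ y in 𝓝 x, r y = 0 → f y = 0) (hκ : fderiv ℝ f x n < κ) :
    ∀ᶠ y in 𝓝 x, r y < 0 → κ * r y < f y := by
  have hev : ∀ᶠ y in 𝓝 x, DifferentiableAt ℝ r y ∧ DifferentiableAt ℝ f y ∧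
      1 / 2 < fderiv ℝ r y n ∧ fderiv ℝ f y n - κ * fderiv ℝ r y n < 0 ∧
      (r y = 0 → f y = 0) := by
    have c1 : ContinuousAt (fun y => fderiv ℝ r y n) x :=
      (hr.fderiv_right (m := 0) (by norm_num)).continuousAt.clm_apply continuousAt_const
    have c2 : ContinuousAt (fun y => fderiv ℝ f y n) x :=
      (hf.fderiv_right (m := 0) (by norm_num)).continuousAt.clm_apply continuousAt_const
    have c3 : ContinuousAt (fun y => fderiv ℝ f y n - κ * fderiv ℝ r y n) x :=
      c2.sub (c1.const_mul κ)
    filter_upwards [hr.eventually (by simp), hf.eventually (by simp), hv,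
      c1.eventually (lt_mem_nhds (show (1 / 2 : ℝ) < fderiv ℝ r x n by rw [hn]; norm_num)),
      c3.eventually (gt_mem_nhds (show fderiv ℝ f x n - κ * fderiv ℝ r x n < 0 by
        rw [hn]; linarith))] with y h1 h2 h3 h4 h5
    exact ⟨h1.differentiableAt one_ne_zero, h2.differentiableAt one_ne_zero, h4, h5, h3⟩
  obtain ⟨ε, hε, hball⟩ := Metric.eventually_nhds_iff_ball.1 hev
  have hrc : ContinuousAt r x := hr.continuousAt
  -- Since `r y > -δ` and `r` grows at rate more than `1 / 2` along `n`, the ray from `y` meets `r =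
  -- 0` before time `2δ`. The bound `2δ‖n‖ ≤ ε / 2` keeps this segment in the good ball.
  set δ : ℝ := ε / (4 * (‖n‖ + 1)) with hδ
  have hδ0 : 0 < δ := by positivity
  filter_upwards [Metric.ball_mem_nhds x (half_pos hε),
    hrc.eventually (lt_mem_nhds (show -δ < r x by rw [hx]; linarith))] with y hy hyr hneg
  have hmem : ∀ t ∈ Icc (0 : ℝ) (2 * δ), y + t • n ∈ Metric.ball x ε := by
    intro t ht
    rw [Metric.mem_ball, dist_eq_norm]
    rw [Metric.mem_ball, dist_eq_norm] at hy
    have h1 : ‖t • n‖ ≤ 2 * δ * ‖n‖ := by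
      rw [norm_smul, Real.norm_of_nonneg ht.1]
      exact mul_le_mul_of_nonneg_right ht.2 (norm_nonneg _)
    have h2 : 2 * δ * ‖n‖ ≤ ε / 2 := by
      rw [hδ]
      have : 2 * (ε / (4 * (‖n‖ + 1))) * ‖n‖ = (ε / 2) * (‖n‖ / (‖n‖ + 1)) := by
        field_simp; ring
      rw [this]
      have : ‖n‖ / (‖n‖ + 1) ≤ 1 := by
        rw [div_le_one (by positivity)]; linarith
      nlinarith
    calc ‖y + t • n - x‖ = ‖(y - x) + t • n‖ := by congr 1; abel
      _ ≤ ‖y - x‖ + ‖t • n‖ := norm_add_le _ _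
      _ < ε := by linarith
  have hline : ∀ t : ℝ, HasDerivAt (fun t : ℝ => y + t • n) n t := fun t => by
    simpa using ((hasDerivAt_id t).smul_const n).const_add y
  have hdr : ∀ t ∈ Icc (0 : ℝ) (2 * δ),
      HasDerivAt (fun t : ℝ => r (y + t • n)) (fderiv ℝ r (y + t • n) n) t := fun t ht =>
    (hball _ (hmem t ht)).1.hasFDerivAt.comp_hasDerivAt t (hline t)
  have hdf : ∀ t ∈ Icc (0 : ℝ) (2 * δ),
      HasDerivAt (fun t : ℝ => f (y + t • n)) (fderiv ℝ f (y + t • n) n) t := fun t ht =>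
    (hball _ (hmem t ht)).2.1.hasFDerivAt.comp_hasDerivAt t (hline t)
  have hrcont : ContinuousOn (fun t : ℝ => r (y + t • n)) (Icc 0 (2 * δ)) := fun t ht =>
    (hdr t ht).continuousAt.continuousWithinAt
  have hend : 0 < r (y + (2 * δ) • n) := by
    have hpos : (0 : ℝ) < 2 * δ := by linarith
    obtain ⟨c, hc, hceq⟩ := exists_hasDerivAt_eq_slope (fun t : ℝ => r (y + t • n)) _ hpos hrcont
      fun t ht => hdr t ⟨ht.1.le, ht.2.le⟩
    have h4 := (hball _ (hmem c ⟨hc.1.le, hc.2.le⟩)).2.2.1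
    rw [hceq, lt_div_iff₀ (by linarith)] at h4
    simp at h4
    linarith
  obtain ⟨τ, hτ, hτ0⟩ : (0 : ℝ) ∈ (fun t : ℝ => r (y + t • n)) '' Icc 0 (2 * δ) :=
    intermediate_value_Icc (by linarith) hrcont ⟨by simpa using hneg.le, hend.le⟩
  have hτpos : 0 < τ := by
    rcases hτ.1.lt_or_eq with h | h
    · exact h
    · subst h; simp at hτ0; linarith
  have hsub : ∀ t ∈ Icc (0 : ℝ) τ, t ∈ Icc (0 : ℝ) (2 * δ) := fun t ht => ⟨ht.1, ht.2.trans hτ.2⟩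
  -- Along the ray `f - κ r` decreases strictly and it vanishes at the hitting time `τ`, so it is
  -- positive at `y`.
  have hg : ∀ t ∈ Icc (0 : ℝ) τ, HasDerivAt (fun t : ℝ => f (y + t • n) - κ * r (y + t • n))
      (fderiv ℝ f (y + t • n) n - κ * fderiv ℝ r (y + t • n) n) t := fun t ht =>
    (hdf t (hsub t ht)).sub ((hdr t (hsub t ht)).const_mul κ)
  obtain ⟨c, hc, hceq⟩ := exists_hasDerivAt_eq_slope
    (fun t : ℝ => f (y + t • n) - κ * r (y + t • n)) _ hτpos
    (fun t ht => (hg t ht).continuousAt.continuousWithinAt) fun t ht => hg t ⟨ht.1.le, ht.2.le⟩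
  have h5 := (hball _ (hmem c (hsub c ⟨hc.1.le, hc.2.le⟩))).2.2.2.1
  have hτf := (hball _ (hmem τ hτ)).2.2.2.2 hτ0
  rw [hceq, div_lt_iff₀ (by linarith)] at h5
  simp only [zero_smul, add_zero, zero_mul] at h5
  have hτ0' : r (y + τ • n) = 0 := hτ0
  rw [hτf, hτ0'] at h5
  linarith

variable [CompleteSpace E] {F : Type*} [NormedAddCommGroup F] [NormedSpace ℝ F]

/-- Lagrange multipliers: a function that is constant on the level set has an extremum there at `x`,
so `df` is a multiple of `dr`. The multiplier of `df` cannot vanish because `dr ≠ 0`. -/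
lemma fderiv_eq_zero_of_vanish_real {r f : E → ℝ} {x u : E} (hr : ContDiffAt ℝ 1 r x)
    (hx : r x = 0) (hdr : fderiv ℝ r x ≠ 0) (hf : ContDiffAt ℝ 1 f x)
    (hv : ∀ᶠ y in 𝓝 x, r y = 0 → f y = 0) (hu : fderiv ℝ r x u = 0) : fderiv ℝ f x u = 0 := by
  have hext : IsLocalExtrOn f {y | r y = r x} x := by
    left
    have : ∀ᶠ y in 𝓝[{y | r y = r x}] x, f x ≤ f y := by
      rw [eventually_nhdsWithin_iff]
      filter_upwards [hv] with y hy hy'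
      rw [hv.self_of_nhds hx, hy (hy'.trans hx)]
    exact this
  obtain ⟨α, β, hαβ, h⟩ := hext.exists_multipliers_of_hasStrictFDerivAt_1d
    (hr.hasStrictFDerivAt one_ne_zero) (hf.hasStrictFDerivAt one_ne_zero)
  have hβ : β ≠ 0 := by
    rintro rfl
    have hα : α ≠ 0 := by rintro rfl; exact hαβ rfl
    rw [zero_smul, add_zero] at h
    exact hdr ((smul_eq_zero.1 h).resolve_left hα)
  have := congrArg (fun φ => φ u) h
  simp [hu] at this
  exact this.resolve_left hβ

/-- The scalar case applied to every continuous functional, since functionals separate points. -/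
lemma fderiv_eq_zero_of_vanish {r : E → ℝ} {f : E → F} {x u : E} (hr : ContDiffAt ℝ 1 r x)
    (hx : r x = 0) (hdr : fderiv ℝ r x ≠ 0) (hf : ContDiffAt ℝ 1 f x)
    (hv : ∀ᶠ y in 𝓝 x, r y = 0 → f y = 0) (hu : fderiv ℝ r x u = 0) : fderiv ℝ f x u = 0 := by
  refine SeparatingDual.eq_zero_of_forall_dual_eq_zero (R := ℝ) fun φ => ?_
  have h := fderiv_eq_zero_of_vanish_real (f := fun y => φ (f y)) hr hx hdr
    (φ.contDiff.contDiffAt.comp x hf)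
    (hv.mono fun y hy hy' => by rw [hy hy', map_zero]) hu
  have hc : HasFDerivAt (fun y => φ (f y)) (φ.comp (fderiv ℝ f x)) x :=
    φ.hasFDerivAt.comp x (hf.differentiableAt one_ne_zero).hasFDerivAt
  rw [hc.fderiv] at h
  simpa using h

/-- Tangential derivatives see only the restriction to the level set. This is what makes the CR
quantities, defined with arbitrary extensions off the hypersurface, computable. -/
lemma fderiv_eq_of_eq {r : E → ℝ} {f g : E → F} {x u : E} (hr : ContDiffAt ℝ 1 r x)
    (hx : r x = 0) (hdr : fderiv ℝ r x ≠ 0) (hf : ContDiffAt ℝ 1 f x) (hg : ContDiffAt ℝ 1 g x)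
    (hv : ∀ᶠ y in 𝓝 x, r y = 0 → f y = g y) (hu : fderiv ℝ r x u = 0) :
    fderiv ℝ f x u = fderiv ℝ g x u := by
  have h := fderiv_eq_zero_of_vanish (f := fun y => f y - g y) hr hx hdr (hf.sub hg)
    (hv.mono fun y hy hy' => sub_eq_zero.2 (hy hy')) hu
  rw [fderiv_fun_sub (hf.differentiableAt one_ne_zero) (hg.differentiableAt one_ne_zero)] at h
  exact sub_eq_zero.1 h

end Flat

/-! ### Levi-flat points, adapted frames and the curvature of the D'Angelo form -/

section Flat

variable {E : Type*} [NormedAddCommGroup E] [NormedSpace ℂ E]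

/-- `x` is a regular point of the level set `r = 0`. -/
structure IsRegularPoint (r : E → ℝ) (x : E) : Prop where
  smooth : ContDiffAt ℝ 3 r x
  zero : r x = 0
  regular : fderiv ℝ r x ≠ 0

/-- `x` is a point of the regular Levi-flat level set `r = 0`. -/
structure IsFlatPoint (r : E → ℝ) (x : E) : Prop extends IsRegularPoint r x where
  flat : FlatNear r x

/-- Polarization: the diagonal values on `v + w` give the real part, and replacing `v` by `i v`
gives the imaginary part. -/
lemma IsFlatPoint.leviK_eq_zero {r : E → ℝ} {x v w : E} (h : IsFlatPoint r x)
    (hv : holoD r x v = 0) (hw : holoD r x w = 0) : leviK r x v w = 0 := by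
  have h0 := h.flat.self_of_nhds h.zero
  have key : ∀ v, holoD r x v = 0 → (leviK r x v w).re = 0 := by
    intro v hv
    have h1 := h0 (v + w) (by rw [holoD_add, hv, hw, add_zero])
    rw [leviK_add_left, leviK_add_right, leviK_add_right, h0 v hv, h0 w hw,
      leviK_conj h.smooth v w] at h1
    have := congrArg Complex.re h1
    simp at this
    linarith
  apply Complex.ext
  · exact key v hv
  · have := key (Complex.I • v) (by rw [holoD_smul, hv, mul_zero])
    rw [leviK_smul_left] at this
    simpa using this

/-- Subtracting the normal component `holoD r x v • n` leaves a complex tangent vector, which pairs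
to zero with `a` by flatness. -/
lemma IsFlatPoint.leviK_left {r : E → ℝ} {x a n v : E} (h : IsFlatPoint r x)
    (ha : holoD r x a = 0) (hn : holoD r x n = 1) :
    leviK r x v a = holoD r x v * leviK r x n a := by
  have h1 := h.leviK_eq_zero (v := v - holoD r x v • n) (w := a)
    (by rw [holoD_sub, holoD_smul, hn]; ring) ha
  rw [leviK_sub_left, leviK_smul_left] at h1
  exact sub_eq_zero.1 h1

lemma IsFlatPoint.leviK_right {r : E → ℝ} {x a n v : E} (h : IsFlatPoint r x)
    (ha : holoD r x a = 0) (hn : holoD r x n = 1) :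
    leviK r x a v = (starRingEnd ℂ) (holoD r x v) * leviK r x a n := by
  rw [leviK_conj h.smooth v a, h.leviK_left ha hn, map_mul, ← leviK_conj h.smooth]

/-! #### Smoothness of the Levi form and of adapted frames -/

lemma contDiffAt_holoD {r : E → ℝ} {x : E} {m : ℕ∞} (hr : ContDiffAt ℝ (m + 1 : ℕ∞) r x)
    {a : E → E} (ha : ContDiffAt ℝ m a x) : ContDiffAt ℝ m (fun y => holoD r y (a y)) x := by
  have h1 : ContDiffAt ℝ m (fderiv ℝ r) x := hr.fderiv_right (by simp)
  have h2 : ContDiffAt ℝ m (fun y => fderiv ℝ r y (a y)) x := h1.clm_apply ha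
  have h3 : ContDiffAt ℝ m (fun y => fderiv ℝ r y (Complex.I • a y)) x :=
    h1.clm_apply (contDiffAt_const.smul ha)
  have : (fun y => holoD r y (a y)) = fun y =>
      ((fderiv ℝ r y (a y) : ℝ) : ℂ) - ((fderiv ℝ r y (Complex.I • a y) : ℝ) : ℂ) * Complex.I := by
    funext y; apply Complex.ext <;> simp [holoD]
  rw [this]
  exact (Complex.ofRealCLM.contDiff.contDiffAt.comp x h2).sub
    ((Complex.ofRealCLM.contDiff.contDiffAt.comp x h3).mul contDiffAt_const)

lemma contDiffAt_leviK {r : E → ℝ} {x : E} {m : ℕ∞} (hr : ContDiffAt ℝ (m + 1 + 1 : ℕ∞) r x)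
    {a b : E → E} (ha : ContDiffAt ℝ m a x) (hb : ContDiffAt ℝ m b x) :
    ContDiffAt ℝ m (fun y => leviK r y (a y) (b y)) x := by
  have h0 : ContDiffAt ℝ (m + 1 : ℕ∞) (fderiv ℝ r) x := hr.fderiv_right (by simp)
  have h1 : ContDiffAt ℝ m (hess r) x := h0.fderiv_right (by simp)
  have ha' : ContDiffAt ℝ m (fun y => Complex.I • a y) x := contDiffAt_const.smul ha
  have hb' : ContDiffAt ℝ m (fun y => Complex.I • b y) x := contDiffAt_const.smul hb
  have e1 := (h1.clm_apply ha).clm_apply hb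
  have e2 := (h1.clm_apply ha').clm_apply hb'
  have e3 := (h1.clm_apply ha).clm_apply hb'
  have e4 := (h1.clm_apply ha').clm_apply hb
  have : (fun y => leviK r y (a y) (b y)) = fun y =>
      ((hess r y (a y) (b y) + hess r y (Complex.I • a y) (Complex.I • b y) : ℝ) : ℂ)
      + ((hess r y (a y) (Complex.I • b y) - hess r y (Complex.I • a y) (b y) : ℝ) : ℂ)
        * Complex.I := by
    funext y; apply Complex.ext <;> simp [leviK]
  rw [this]
  exact (Complex.ofRealCLM.contDiff.contDiffAt.comp x (e1.add e2)).add
    ((Complex.ofRealCLM.contDiff.contDiffAt.comp x (e3.sub e4)).mul contDiffAt_const)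

/-- The multiple of the constant vector `n` normalized by `holoD r y n = 1`. -/
def normalFrame (r : E → ℝ) (n y : E) : E := (holoD r y n)⁻¹ • n

/-- The projection of the constant vector `a` to the complex tangent space of the level sets. -/
def tangentFrame (r : E → ℝ) (a n y : E) : E := a - holoD r y a • normalFrame r n y

lemma contDiffAt_normalFrame {r : E → ℝ} {x n : E} {m : ℕ∞}
    (hr : ContDiffAt ℝ (m + 1 : ℕ∞) r x) (hn : holoD r x n ≠ 0) :
    ContDiffAt ℝ m (normalFrame r n) x :=
  ((contDiffAt_holoD hr contDiffAt_const).inv hn).smul contDiffAt_const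

lemma contDiffAt_tangentFrame {r : E → ℝ} {x a n : E} {m : ℕ∞}
    (hr : ContDiffAt ℝ (m + 1 : ℕ∞) r x) (hn : holoD r x n ≠ 0) :
    ContDiffAt ℝ m (tangentFrame r a n) x :=
  contDiffAt_const.sub ((contDiffAt_holoD hr contDiffAt_const).smul (contDiffAt_normalFrame hr hn))

lemma holoD_normalFrame {r : E → ℝ} {y n : E} (hn : holoD r y n ≠ 0) :
    holoD r y (normalFrame r n y) = 1 := by
  rw [normalFrame, holoD_smul, inv_mul_cancel₀ hn]

lemma holoD_tangentFrame {r : E → ℝ} {y a n : E} (hn : holoD r y n ≠ 0) :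
    holoD r y (tangentFrame r a n y) = 0 := by
  rw [tangentFrame, holoD_sub, holoD_smul, holoD_normalFrame hn, mul_one, sub_self]

lemma normalFrame_self {r : E → ℝ} {x n : E} (hn : holoD r x n = 1) : normalFrame r n x = n := by
  simp [normalFrame, hn]

lemma tangentFrame_self {r : E → ℝ} {x a n : E} (ha : holoD r x a = 0) :
    tangentFrame r a n x = a := by
  simp [tangentFrame, ha]

lemma eventually_holoD_ne {r : E → ℝ} {x n : E} (hr : ContDiffAt ℝ 1 r x)
    (hn : holoD r x n ≠ 0) : ∀ᶠ y in 𝓝 x, holoD r y n ≠ 0 :=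
  (contDiffAt_holoD (m := 0) (by simpa using hr) contDiffAt_const).continuousAt.eventually_ne hn

/-- When `a` is complex tangent at `x`, this extends it to a complex tangent field, so that
pointwise identities can be proved by differentiating along fields. -/
lemma eventually_tangentFrame {r : E → ℝ} {x a n : E} (hr : ContDiffAt ℝ 3 r x)
    (hn : holoD r x n = 1) :
    ContDiffAt ℝ 1 (tangentFrame r a n) x ∧
      ∀ᶠ y in 𝓝 x, r y = 0 → holoD r y (tangentFrame r a n y) = 0 := by
  have hn0 : holoD r x n ≠ 0 := by rw [hn]; exact one_ne_zero
  refine ⟨contDiffAt_tangentFrame (m := 1) (hr.of_le (by norm_cast)) hn0, ?_⟩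
  filter_upwards [eventually_holoD_ne (hr.of_le (by norm_num)) hn0] with y hy _
    using holoD_tangentFrame hy

lemma normalLevi_smul {r : E → ℝ} {x : E} (hr : ContDiffAt ℝ 3 r x) (c : ℂ) (a n : E) :
    normalLevi r x (c • a) n = ‖c‖ ^ 2 * normalLevi r x a n := by
  have s1 := third_symm_right hr n a (Complex.I • a)
  have hK : leviK r x n (c • a) = (starRingEnd ℂ) c * leviK r x n a := leviK_smul_right ..
  rw [normalLevi, hK, normalLevi, ← Complex.normSq_eq_norm_sq, Complex.normSq_apply,
    complex_smul_eq c a]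
  simp [real_smul_I, I_smul_I_smul, s1]
  ring

lemma fderiv_re {f : E → ℂ} {x : E} (hf : DifferentiableAt ℝ f x) (u : E) :
    fderiv ℝ (fun y => (f y).re) x u = (fderiv ℝ f x u).re := by
  have := (Complex.reCLM.hasFDerivAt.comp x hf.hasFDerivAt).fderiv
  exact congrArg (fun φ => φ u) this

lemma fderiv_im {f : E → ℂ} {x : E} (hf : DifferentiableAt ℝ f x) (u : E) :
    fderiv ℝ (fun y => (f y).im) x u = (fderiv ℝ f x u).im := by
  have := (Complex.imCLM.hasFDerivAt.comp x hf.hasFDerivAt).fderiv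
  exact congrArg (fun φ => φ u) this

/-! #### The curvature formula -/

variable [CompleteSpace E]

lemma fderiv_leviK {r : E → ℝ} {x : E} (hr : ContDiffAt ℝ 3 r x) {a b : E → E}
    (ha : ContDiffAt ℝ 1 a x) (hb : ContDiffAt ℝ 1 b x) (u : E) :
    fderiv ℝ (fun y => leviK r y (a y) (b y)) x u =
      ⟨third r x u (a x) (b x) + third r x u (Complex.I • a x) (Complex.I • b x),
        third r x u (a x) (Complex.I • b x) - third r x u (Complex.I • a x) (b x)⟩
      + leviK r x (fderiv ℝ a x u) (b x) + leviK r x (a x) (fderiv ℝ b x u) := by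
  have ha' := ha.differentiableAt one_ne_zero
  have hb' := hb.differentiableAt one_ne_zero
  have hIa : DifferentiableAt ℝ (fun y => Complex.I • a y) x :=
    (contDiffAt_const.smul ha).differentiableAt one_ne_zero
  have hIb : DifferentiableAt ℝ (fun y => Complex.I • b y) x :=
    (contDiffAt_const.smul hb).differentiableAt one_ne_zero
  have hh := (contDiffAt_hess hr).differentiableAt one_ne_zero
  have hd : DifferentiableAt ℝ (fun y => leviK r y (a y) (b y)) x :=
    (contDiffAt_leviK (m := 1) (by exact_mod_cast hr) ha hb).differentiableAt one_ne_zero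
  apply Complex.ext
  · rw [← fderiv_re hd]
    simp only [leviK]
    rw [fderiv_fun_add ((hh.clm_apply ha').clm_apply hb') ((hh.clm_apply hIa).clm_apply hIb)]
    simp only [add_apply]
    rw [fderiv_hess_apply hr ha' hb', fderiv_hess_apply hr hIa hIb, fderiv_I_smul ha',
      fderiv_I_smul hb']
    simp only [Complex.add_re]
    ring
  · rw [← fderiv_im hd]
    simp only [leviK]
    rw [fderiv_fun_sub ((hh.clm_apply ha').clm_apply hIb) ((hh.clm_apply hIa).clm_apply hb')]
    simp only [sub_apply]
    rw [fderiv_hess_apply hr ha' hIb, fderiv_hess_apply hr hIa hb', fderiv_I_smul ha',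
      fderiv_I_smul hb']
    simp only [Complex.add_im]
    ring

/-- Differentiate the identity `dr(a) = c` along the level set: the derivative of `a` falls out of
the tangent space exactly by the Hessian. -/
lemma IsRegularPoint.fderiv_of_fderiv_apply_const {r : E → ℝ} {x u : E} (h : IsRegularPoint r x) {a : E → E} {c : ℝ} (ha : ContDiffAt ℝ 1 a x)
    (hc : ∀ᶠ y in 𝓝 x, r y = 0 → fderiv ℝ r y (a y) = c) (hu : fderiv ℝ r x u = 0) :
    fderiv ℝ r x (fderiv ℝ a x u) = -hess r x u (a x) := by
  have h1 := fderiv_eq_of_eq (f := fun y => fderiv ℝ r y (a y)) (g := fun _ => c) (u := u)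
    (h.smooth.of_le (by norm_num)) h.zero h.regular
    (((contDiffAt_fderiv h.smooth).of_le (by norm_num)).clm_apply ha) contDiffAt_const hc hu
  rw [fderiv_fderiv_apply h.smooth (ha.differentiableAt one_ne_zero)] at h1
  simp at h1
  linarith

lemma IsRegularPoint.holoD_fderiv_of_const {r : E → ℝ} {x u : E} (h : IsRegularPoint r x) {a : E → E} {c : ℂ} (ha : ContDiffAt ℝ 1 a x)
    (hc : ∀ᶠ y in 𝓝 x, r y = 0 → holoD r y (a y) = c) (hu : fderiv ℝ r x u = 0) :
    holoD r x (fderiv ℝ a x u) = ⟨-hess r x u (a x), hess r x u (Complex.I • a x)⟩ := by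
  have h1 := h.fderiv_of_fderiv_apply_const (c := c.re) ha
    (hc.mono fun y hy hy' => by rw [← hy hy']; rfl) hu
  have h2 := h.fderiv_of_fderiv_apply_const (a := fun y => Complex.I • a y) (c := -c.im)
    (contDiffAt_const.smul ha)
    (hc.mono fun y hy hy' => by rw [← hy hy']; simp [holoD]) hu
  rw [fderiv_I_smul (ha.differentiableAt one_ne_zero)] at h2
  simp [holoD, h1, h2]

/-- Along the level set the derivative of the Levi form vanishes. -/
lemma IsFlatPoint.third_tangent {r : E → ℝ} {x u n : E} (h : IsFlatPoint r x) {a : E → E}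
    (ha : ContDiffAt ℝ 1 a x) (ha0 : ∀ᶠ y in 𝓝 x, r y = 0 → holoD r y (a y) = 0)
    (hn : holoD r x n = 1) (hu : fderiv ℝ r x u = 0) :
    third r x u (a x) (a x) + third r x u (Complex.I • a x) (Complex.I • a x)
      = 2 * (hess r x u (a x) * (leviK r x n (a x)).re
        + hess r x u (Complex.I • a x) * (leviK r x n (a x)).im) := by
  have hax := ha0.self_of_nhds h.zero
  have h1 := fderiv_eq_zero_of_vanish (f := fun y => leviK r y (a y) (a y)) (u := u)
    (h.smooth.of_le (by norm_num)) h.zero h.regular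
    (contDiffAt_leviK (m := 1) (by exact_mod_cast h.smooth) ha ha)
    (by filter_upwards [h.flat, ha0] with y h1 h2 h3 using h1 h3 _ (h2 h3)) hu
  rw [fderiv_leviK h.smooth ha ha, leviK_conj h.smooth (fderiv ℝ a x u) (a x),
    h.leviK_left hax hn, h.holoD_fderiv_of_const ha ha0 hu] at h1
  have := congrArg Complex.re h1
  simp at this
  linarith

/-- The derivative of the Levi form of the level sets in the normal direction. -/
lemma IsFlatPoint.fderiv_levi_frame {r : E → ℝ} {x a n : E} (h : IsFlatPoint r x)
    (ha : holoD r x a = 0) (hn : holoD r x n = 1) :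
    fderiv ℝ (fun y => (leviK r y (tangentFrame r a n y) (tangentFrame r a n y)).re) x n
      = -normalLevi r x a n := by
  have hn0 : holoD r x n ≠ 0 := by rw [hn]; exact one_ne_zero
  have h3 : ContDiffAt ℝ (1 + 1 + 1 : ℕ∞) r x := by exact_mod_cast h.smooth
  have hℓ : ContDiffAt ℝ 1 (tangentFrame r a n) x :=
    contDiffAt_tangentFrame (m := 1) (h3.of_le (by norm_cast)) hn0
  have hℓd := hℓ.differentiableAt one_ne_zero
  have hev := eventually_holoD_ne (h.smooth.of_le (by norm_num)) hn0
  have hd : DifferentiableAt ℝ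
      (fun y => leviK r y (tangentFrame r a n y) (tangentFrame r a n y)) x :=
    (contDiffAt_leviK (m := 1) h3 hℓ hℓ).differentiableAt one_ne_zero
  -- The adapted frame is tangent to all nearby level sets, not only to `r = 0`, so its identities
  -- may be differentiated in the transversal direction `n`.
  have e1 : fderiv ℝ r x (fderiv ℝ (tangentFrame r a n) x n) = -hess r x n a := by
    have : (fun y => fderiv ℝ r y (tangentFrame r a n y)) =ᶠ[𝓝 x] fun _ => 0 := by
      filter_upwards [hev] with y hy using (holoD_eq_zero_iff.1 (holoD_tangentFrame hy)).1
    have h2 := fderiv_fderiv_apply h.smooth hℓd n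
    rw [this.fderiv_eq, tangentFrame_self ha] at h2
    simp at h2; linarith
  have e2 : fderiv ℝ r x (Complex.I • fderiv ℝ (tangentFrame r a n) x n)
      = -hess r x n (Complex.I • a) := by
    have : (fun y => fderiv ℝ r y (Complex.I • tangentFrame r a n y)) =ᶠ[𝓝 x] fun _ => 0 := by
      filter_upwards [hev] with y hy using (holoD_eq_zero_iff.1 (holoD_tangentFrame hy)).2
    have h2 := fderiv_fderiv_apply (a := fun y => Complex.I • tangentFrame r a n y) h.smooth
      ((contDiffAt_const.smul hℓ).differentiableAt one_ne_zero) n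
    rw [this.fderiv_eq, fderiv_I_smul hℓd, tangentFrame_self ha] at h2
    simp at h2; linarith
  rw [fderiv_re hd, fderiv_leviK h.smooth hℓ hℓ, tangentFrame_self ha,
    leviK_conj h.smooth (fderiv ℝ (tangentFrame r a n) x n) a, h.leviK_left ha hn]
  simp only [holoD, e1, e2, normalLevi, Complex.add_re, Complex.mul_re, Complex.conj_re]
  ring

/-- `normalLevi` does not depend on the normal vector. -/
lemma IsFlatPoint.normalLevi_congr {r : E → ℝ} {x a n n' : E} (h : IsFlatPoint r x)
    (ha : holoD r x a = 0) (hn : holoD r x n = 1) (hn' : holoD r x n' = 1) :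
    normalLevi r x a n' = normalLevi r x a n ∧ leviK r x a n' = leviK r x a n := by
  obtain ⟨hs, h0⟩ := eventually_tangentFrame (a := a) h.smooth hn
  have hd : holoD r x (n' - n) = 0 := by rw [holoD_sub, hn, hn', sub_self]
  have h1 := h.third_tangent (u := n' - n) hs h0 hn (holoD_eq_zero_iff.1 hd).1
  have h2 : leviK r x n' a = leviK r x n a := by rw [h.leviK_left ha hn, hn', one_mul]
  rw [tangentFrame_self ha] at h1
  simp only [map_sub, sub_apply] at h1
  refine ⟨?_, ?_⟩
  · rw [normalLevi, normalLevi, h2]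
    linarith
  · rw [h.leviK_right ha hn, hn', map_one, one_mul]

/-- The Levi-flat curvature formula: `s` is the D'Angelo form on the complex tangent field `a`. -/
lemma IsFlatPoint.curvature {r : E → ℝ} {x : E} (h : IsFlatPoint r x) {a n : E → E} {s : E → ℂ}
    (ha : ContDiffAt ℝ 1 a x) (ha0 : ∀ᶠ y in 𝓝 x, r y = 0 → holoD r y (a y) = 0)
    (hn : ContDiffAt ℝ 1 n x) (hn1 : ∀ᶠ y in 𝓝 x, r y = 0 → holoD r y (n y) = 1)
    (hs : ContDiffAt ℝ 1 s x) (hsK : ∀ᶠ y in 𝓝 x, r y = 0 → s y = leviK r y (a y) (n y)) :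
    fderiv ℝ s x (a x) + Complex.I * fderiv ℝ s x (Complex.I • a x)
      + Complex.I * leviK r x
        (Complex.I • fderiv ℝ a x (a x) - fderiv ℝ a x (Complex.I • a x)) (n x)
      = ((-normalLevi r x (a x) (n x) + ‖leviK r x (a x) (n x)‖ ^ 2 : ℝ) : ℂ) := by
  have hax := ha0.self_of_nhds h.zero
  have hnx := hn1.self_of_nhds h.zero
  obtain ⟨ta, tIa⟩ := holoD_eq_zero_iff.1 hax
  obtain ⟨-, tIn⟩ := holoD_eq_one_iff.1 hnx
  -- `s` is known only on the level set, but `a` and `i a` are tangent to it, so there its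
  -- derivative is that of the Levi form.
  have hds : ∀ u, fderiv ℝ r x u = 0 → fderiv ℝ s x u = _ := fun u hu =>
    (fderiv_eq_of_eq (h.smooth.of_le (by norm_num)) h.zero h.regular hs
      (contDiffAt_leviK (m := 1) (by exact_mod_cast h.smooth) ha hn) hsK hu).trans
      (fderiv_leviK h.smooth ha hn u)
  rw [hds _ ta, hds _ tIa, leviK_sub_left, leviK_smul_left,
    h.leviK_right (v := fderiv ℝ n x (a x)) hax hnx,
    h.leviK_right (v := fderiv ℝ n x (Complex.I • a x)) hax hnx,
    h.holoD_fderiv_of_const hn hn1 ta,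
    h.holoD_fderiv_of_const hn hn1 tIa]
  -- The vector `i n` is tangent, so the derivative of the Levi form along it vanishes. This
  -- relation is exactly what kills the imaginary part; the real part is a formal identity.
  have h3 := h.third_tangent (u := Complex.I • n x) ha ha0 hnx tIn
  have hK : leviK r x (n x) (a x) = (starRingEnd ℂ) (leviK r x (a x) (n x)) :=
    leviK_conj h.smooth ..
  rw [hK] at h3
  rw [normalLevi, hK, ← Complex.normSq_eq_norm_sq, Complex.normSq_apply]
  set A := a x
  set N := n x
  -- Symmetry of the third derivative brings the normal vector to the front, the position it has in
  -- `normalLevi`.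
  have S : ∀ u v w, third r x u v w = third r x w u v := fun u v w => by
    rw [third_symm_right h.smooth u v w, third_symm_left h.smooth u w v]
  have s1 := S A A N
  have s2 := S A A (Complex.I • N)
  have s3 := S (Complex.I • A) (Complex.I • A) N
  have s4 := S (Complex.I • A) (Complex.I • A) (Complex.I • N)
  have s5 := S A (Complex.I • A) N
  have s6 := S A (Complex.I • A) (Complex.I • N)
  have s7 := S (Complex.I • A) A N
  have s8 := S (Complex.I • A) A (Complex.I • N)
  have s9 := third_symm_right h.smooth N A (Complex.I • A)
  have s10 := third_symm_right h.smooth (Complex.I • N) A (Complex.I • A)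
  have b1 := hess_symm h.smooth N A
  have b2 := hess_symm h.smooth (Complex.I • N) A
  have b3 := hess_symm h.smooth N (Complex.I • A)
  have b4 := hess_symm h.smooth (Complex.I • N) (Complex.I • A)
  simp only [leviK, Complex.conj_re, Complex.conj_im] at h3
  rw [b2, b4] at h3
  rw [b1, b3]
  apply Complex.ext
  · simp only [leviK, Complex.add_re, Complex.mul_re,
      Complex.add_im, Complex.mul_im, Complex.I_re, Complex.I_im, Complex.ofReal_re,
      Complex.conj_re, Complex.conj_im, Complex.sub_re, Complex.sub_im,
      s1, s2, s3, s4, s5, s6, s7, s8, s9, s10]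
    ring
  · simp only [leviK, Complex.add_re, Complex.mul_re,
      Complex.add_im, Complex.mul_im, Complex.I_re, Complex.I_im, Complex.ofReal_im,
      Complex.conj_re, Complex.conj_im, Complex.sub_re, Complex.sub_im,
      s1, s2, s3, s4, s5, s6, s7, s8, s9, s10]
    linear_combination h3

end Flat

/-! ### Lie brackets and products with exponentials in coordinates -/

section Flat

variable {E : Type*} [NormedAddCommGroup E] [NormedSpace ℂ E]

lemma lieBracket_apply (V W : E → E) (x : E) : VectorField.lieBracket ℝ V W x
    = fderiv ℝ W x (V x) - fderiv ℝ V x (W x) := rfl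

lemma fderiv_exp_mul {r g : E → ℝ} {y : E} (hr : DifferentiableAt ℝ r y)
    (hg : DifferentiableAt ℝ g y) :
    fderiv ℝ (fun z => Real.exp (g z) * r z) y
      = Real.exp (g y) • fderiv ℝ r y + (r y * Real.exp (g y)) • fderiv ℝ g y := by
  have h1 : fderiv ℝ (fun z => Real.exp (g z) * r z) y = _ :=
    ((hg.hasFDerivAt.exp).mul hr.hasFDerivAt).fderiv
  rw [h1, smul_smul]

lemma contDiffAt_exp_mul {r g : E → ℝ} {y : E} {m : WithTop ℕ∞} (hr : ContDiffAt ℝ m r y)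
    (hg : ContDiffAt ℝ m g y) : ContDiffAt ℝ m (fun z => Real.exp (g z) * r z) y :=
  hg.exp.mul hr

lemma holoD_exp_mul {r g : E → ℝ} {y : E} (hr : DifferentiableAt ℝ r y)
    (hg : DifferentiableAt ℝ g y) (hy : r y = 0) (v : E) :
    holoD (fun z => Real.exp (g z) * r z) y v = Real.exp (g y) * holoD r y v := by
  apply Complex.ext <;> simp [holoD, fderiv_exp_mul hr hg, hy, -Complex.ofReal_exp]

lemma holoD_const_mul {g : E → ℝ} {y : E} (hg : DifferentiableAt ℝ g y) (c : ℝ) (v : E) :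
    holoD (fun z => c * g z) y v = c * holoD g y v := by
  apply Complex.ext <;> simp [holoD, fderiv_const_mul hg]

end Flat

lemma exp_mul_eq_zero {α : Type*} {r g : α → ℝ} {y : α} : Real.exp (g y) * r y = 0 ↔ r y = 0 := by
  simp [Real.exp_ne_zero]

section Flat

variable {E : Type*} [NormedAddCommGroup E] [NormedSpace ℂ E] [CompleteSpace E]

/-! #### Lie brackets of fields tangent to a level set -/

lemma lieBracket_I_smul {a : E → E} {x : E} (ha : DifferentiableAt ℝ a x) :
    VectorField.lieBracket ℝ a (fun y => Complex.I • a y) x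
      = Complex.I • fderiv ℝ a x (a x) - fderiv ℝ a x (Complex.I • a x) := by
  rw [lieBracket_apply, fderiv_I_smul ha]

/-- Each derivative in the bracket is taken along a tangent vector, hence depends only on values on
the level set. -/
lemma IsRegularPoint.lieBracket_congr {r : E → ℝ} {x : E} (h : IsRegularPoint r x)
    {V V' W W' : E → E} (hV : ContDiffAt ℝ 1 V x) (hV' : ContDiffAt ℝ 1 V' x)
    (hW : ContDiffAt ℝ 1 W x) (hW' : ContDiffAt ℝ 1 W' x)
    (eV : ∀ᶠ y in 𝓝 x, r y = 0 → V y = V' y) (eW : ∀ᶠ y in 𝓝 x, r y = 0 → W y = W' y)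
    (tV : fderiv ℝ r x (V x) = 0) (tW : fderiv ℝ r x (W x) = 0) :
    VectorField.lieBracket ℝ V W x = VectorField.lieBracket ℝ V' W' x := by
  have hr : ContDiffAt ℝ 1 r x := h.smooth.of_le (by norm_num)
  rw [lieBracket_apply, lieBracket_apply,
    fderiv_eq_of_eq hr h.zero h.regular hW hW' eW tV,
    fderiv_eq_of_eq hr h.zero h.regular hV hV' eV tW, eV.self_of_nhds h.zero,
    eW.self_of_nhds h.zero]

lemma IsRegularPoint.fderiv_lieBracket {r : E → ℝ} {x : E} (h : IsRegularPoint r x)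
    {V W : E → E} (hV : ContDiffAt ℝ 1 V x) (hW : ContDiffAt ℝ 1 W x)
    (tV : ∀ᶠ y in 𝓝 x, r y = 0 → fderiv ℝ r y (V y) = 0)
    (tW : ∀ᶠ y in 𝓝 x, r y = 0 → fderiv ℝ r y (W y) = 0) :
    fderiv ℝ r x (VectorField.lieBracket ℝ V W x) = 0 := by
  rw [lieBracket_apply, map_sub,
    h.fderiv_of_fderiv_apply_const hW tW (tV.self_of_nhds h.zero),
    h.fderiv_of_fderiv_apply_const hV tV (tW.self_of_nhds h.zero), hess_symm h.smooth (V x)]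
  ring

/-- Differentiating `dr(a) = 0` and `dr(i a) = 0` along `i a` and `a` identifies the abstract Levi
form, defined by brackets, with the Hessian one. -/
lemma IsRegularPoint.levi_bracket {r : E → ℝ} {x : E} (h : IsRegularPoint r x) {a : E → E}
    (ha : ContDiffAt ℝ 1 a x) (ha0 : ∀ᶠ y in 𝓝 x, r y = 0 → holoD r y (a y) = 0) :
    fderiv ℝ r x (Complex.I • VectorField.lieBracket ℝ a (fun y => Complex.I • a y) x)
      = (leviK r x (a x) (a x)).re := by
  have t1 := ha0.mono fun y hy hy' => (holoD_eq_zero_iff.1 (hy hy')).1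
  have t2 := ha0.mono fun y hy hy' => (holoD_eq_zero_iff.1 (hy hy')).2
  have e1 := h.fderiv_of_fderiv_apply_const ha t1 (t1.self_of_nhds h.zero)
  have hIa : ContDiffAt ℝ 1 (fun y => Complex.I • a y) x := contDiffAt_const.smul ha
  have e2 := h.fderiv_of_fderiv_apply_const hIa t2 (t2.self_of_nhds h.zero)
  have hd := ha.differentiableAt one_ne_zero
  rw [fderiv_I_smul hd] at e2
  rw [lieBracket_I_smul hd, smul_sub, I_smul_I_smul, map_sub, map_neg, e1, e2]
  simp [leviK]

/-- The bracket of a transversal field `i b` and a complex tangent field `a - i J a`. -/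
lemma IsRegularPoint.dangelo_bracket {r : E → ℝ} {x : E} (h : IsRegularPoint r x)
    {t b a c : E → E} (ht : ContDiffAt ℝ 1 t x) (hb : ContDiffAt ℝ 1 b x)
    (ha : ContDiffAt ℝ 1 a x) (hc : ContDiffAt ℝ 1 c x)
    (ht0 : ∀ᶠ y in 𝓝 x, r y = 0 → t y = 0)
    (hb1 : ∀ᶠ y in 𝓝 x, r y = 0 → holoD r y (Complex.I • b y) = 1)
    (ha0 : ∀ᶠ y in 𝓝 x, r y = 0 → holoD r y (a y) = 0)
    (hca : ∀ᶠ y in 𝓝 x, r y = 0 → c y = -(Complex.I • a y)) :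
    fderiv ℝ r x (VectorField.lieBracket ℝ t a x - VectorField.lieBracket ℝ b c x) = 0 ∧
    fderiv ℝ r x (VectorField.lieBracket ℝ t c x + VectorField.lieBracket ℝ b a x) = 0 ∧
    fderiv ℝ r x (Complex.I •
      (VectorField.lieBracket ℝ t c x + VectorField.lieBracket ℝ b a x))
        = (leviK r x (a x) (Complex.I • b x)).re ∧
    -fderiv ℝ r x (Complex.I •
      (VectorField.lieBracket ℝ t a x - VectorField.lieBracket ℝ b c x))
        = (leviK r x (a x) (Complex.I • b x)).im := by
  have ta := ha0.mono fun y hy hy' => (holoD_eq_zero_iff.1 (hy hy')).1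
  have tIa := ha0.mono fun y hy hy' => (holoD_eq_zero_iff.1 (hy hy')).2
  have tIb := hb1.mono fun y hy hy' => (holoD_eq_one_iff.1 (hy hy')).1
  have tb : ∀ᶠ y in 𝓝 x, r y = 0 → fderiv ℝ r y (b y) = 0 := hb1.mono fun y hy hy' => by
    have := (holoD_eq_one_iff.1 (hy hy')).2
    rwa [I_smul_I_smul, map_neg, neg_eq_zero] at this
  have tc : ∀ᶠ y in 𝓝 x, r y = 0 → fderiv ℝ r y (c y) = 0 := by
    filter_upwards [hca, tIa] with y h1 h2 h3
    rw [h1 h3, map_neg, h2 h3, neg_zero]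
  have hIa : ContDiffAt ℝ 1 (fun y => Complex.I • a y) x := contDiffAt_const.smul ha
  have hIb : ContDiffAt ℝ 1 (fun y => Complex.I • b y) x := contDiffAt_const.smul hb
  have had := ha.differentiableAt one_ne_zero
  have hbd := hb.differentiableAt one_ne_zero
  have t0 : fderiv ℝ r x (t x) = 0 := by rw [ht0.self_of_nhds h.zero, map_zero]
  have z : ∀ W : E → E, VectorField.lieBracket ℝ (fun _ => (0 : E)) W x = 0 := fun W => by
    simp [lieBracket_apply]
  -- The field `t` vanishes only on the level set; since `a` is tangent, the bracket cannot
  -- distinguish it from the zero field.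
  have e1 : VectorField.lieBracket ℝ t a x = 0 := by
    rw [h.lieBracket_congr ht contDiffAt_const ha ha ht0 (.of_forall fun y _ => rfl) t0
      (ta.self_of_nhds h.zero), z]
  have e2 : VectorField.lieBracket ℝ t c x = 0 := by
    rw [h.lieBracket_congr ht contDiffAt_const hc hc ht0 (.of_forall fun y _ => rfl) t0
      (tc.self_of_nhds h.zero), z]
  have e3 : VectorField.lieBracket ℝ b c x
      = -(Complex.I • fderiv ℝ a x (b x) - fderiv ℝ b x (Complex.I • a x)) := by
    have hIan : ContDiffAt ℝ 1 (fun y => -(Complex.I • a y)) x := hIa.neg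
    rw [h.lieBracket_congr hb hb hc hIan (.of_forall fun y _ => rfl) hca
      (tb.self_of_nhds h.zero) (tc.self_of_nhds h.zero), lieBracket_apply]
    have : fderiv ℝ (fun y => -(Complex.I • a y)) x = -fderiv ℝ (fun y => Complex.I • a y) x :=
      fderiv_fun_neg
    rw [this]
    simp [fderiv_I_smul had]
    abel
  have f1 := h.fderiv_of_fderiv_apply_const ha ta (tb.self_of_nhds h.zero)
  have f2 := h.fderiv_of_fderiv_apply_const hIa tIa (tb.self_of_nhds h.zero)
  have f3 := h.fderiv_of_fderiv_apply_const hb tb (ta.self_of_nhds h.zero)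
  have f4 := h.fderiv_of_fderiv_apply_const hb tb (tIa.self_of_nhds h.zero)
  have f5 := h.fderiv_of_fderiv_apply_const hIb tIb (ta.self_of_nhds h.zero)
  have f6 := h.fderiv_of_fderiv_apply_const hIb tIb (tIa.self_of_nhds h.zero)
  rw [fderiv_I_smul had] at f2
  rw [fderiv_I_smul hbd] at f5 f6
  have s1 := hess_symm h.smooth (a x) (b x)
  have s2 := hess_symm h.smooth (Complex.I • a x) (b x)
  rw [e1, e2, e3, lieBracket_apply]
  refine ⟨?_, ?_, ?_, ?_⟩
  · simp [f2, f4]; linarith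
  · simp [f1, f3]; linarith
  · simp [smul_sub, f2, f5, leviK, I_smul_I_smul]; linarith
  · simp [smul_sub, f1, f6, leviK, I_smul_I_smul]; linarith

/-- For `L = a - i J a` one has `[L, conj L] = 2 i [a, J a]`: the real parts cancel by antisymmetry.
-/
lemma IsRegularPoint.conj_bracket {r : E → ℝ} {x : E} (h : IsRegularPoint r x)
    {a c : E → E} (ha : ContDiffAt ℝ 1 a x) (hc : ContDiffAt ℝ 1 c x)
    (ha0 : ∀ᶠ y in 𝓝 x, r y = 0 → holoD r y (a y) = 0)
    (hca : ∀ᶠ y in 𝓝 x, r y = 0 → c y = -(Complex.I • a y)) :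
    VectorField.lieBracket ℝ a a x - VectorField.lieBracket ℝ c (fun y => -c y) x = 0 ∧
    VectorField.lieBracket ℝ a (fun y => -c y) x + VectorField.lieBracket ℝ c a x
      = (2 : ℝ) • VectorField.lieBracket ℝ a (fun y => Complex.I • a y) x := by
  have hIa : ContDiffAt ℝ 1 (fun y => Complex.I • a y) x := contDiffAt_const.smul ha
  have hca' : ∀ᶠ y in 𝓝 x, r y = 0 → -c y = Complex.I • a y :=
    hca.mono fun y hy hy' => by rw [hy hy', neg_neg]
  have ta := (holoD_eq_zero_iff.1 (ha0.self_of_nhds h.zero)).1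
  have tc : fderiv ℝ r x (-c x) = 0 := by
    rw [hca'.self_of_nhds h.zero]; exact (holoD_eq_zero_iff.1 (ha0.self_of_nhds h.zero)).2
  have hn : fderiv ℝ (fun y => -c y) x = -fderiv ℝ c x := fderiv_fun_neg
  have e := h.lieBracket_congr ha ha hc.neg hIa (.of_forall fun y _ => rfl) hca' ta tc
  have e' : VectorField.lieBracket ℝ c a x = VectorField.lieBracket ℝ a (fun y => -c y) x := by
    simp [lieBracket_apply, hn]
    abel
  refine ⟨?_, ?_⟩
  · simp [lieBracket_apply, hn]
  · have e2 : VectorField.lieBracket ℝ a (fun y => -c y) x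
      = VectorField.lieBracket ℝ a (fun y => Complex.I • a y) x := e
    rw [e', e2, two_smul]

/-! #### Change of the defining function -/

lemma hess_exp_mul {r g : E → ℝ} {y : E} (hr : ContDiffAt ℝ 3 r y) (hg : ContDiffAt ℝ 3 g y)
    (hy : r y = 0) (v w : E) :
    hess (fun z => Real.exp (g z) * r z) y v w = Real.exp (g y) * (hess r y v w
      + fderiv ℝ g y v * fderiv ℝ r y w + fderiv ℝ r y v * fderiv ℝ g y w) := by
  have he : fderiv ℝ (fun z => Real.exp (g z) * r z) =ᶠ[𝓝 y] fun z =>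
      Real.exp (g z) • fderiv ℝ r z + (r z * Real.exp (g z)) • fderiv ℝ g z := by
    filter_upwards [hr.eventually (by simp), hg.eventually (by simp)] with z h1 h2
    exact fderiv_exp_mul (h1.differentiableAt (by simp)) (h2.differentiableAt (by simp))
  have d1 := (hr.differentiableAt (by simp)).hasFDerivAt
  have d2 := (hg.differentiableAt (by simp)).hasFDerivAt
  have d3 := ((contDiffAt_fderiv hr).differentiableAt two_ne_zero).hasFDerivAt
  have d4 := ((contDiffAt_fderiv hg).differentiableAt two_ne_zero).hasFDerivAt
  have e : fderiv ℝ (fun z => Real.exp (g z) • fderiv ℝ r z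
      + (r z * Real.exp (g z)) • fderiv ℝ g z) y = _ :=
    ((d2.exp.smul d3).add ((d1.mul d2.exp).smul d4)).fderiv
  rw [hess, he.fderiv_eq, e]
  simp [hy, hess]
  ring

/-- At `r = 0` the second derivatives of `g` are multiplied by `r`, and one of the two cross terms
dies because `v` is complex tangent. With `w` a normalized normal vector, the remaining one shifts
the D'Angelo form by `2∂g`. -/
lemma leviK_exp_mul {r g : E → ℝ} {y v : E} (hr : ContDiffAt ℝ 3 r y) (hg : ContDiffAt ℝ 3 g y)
    (hy : r y = 0) (hv : holoD r y v = 0) (w : E) :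
    leviK (fun z => Real.exp (g z) * r z) y v w
      = Real.exp (g y) * (leviK r y v w + holoD g y v * (starRingEnd ℂ) (holoD r y w)) := by
  obtain ⟨h1, h2⟩ := holoD_eq_zero_iff.1 hv
  apply Complex.ext
  · simp [leviK, hess_exp_mul hr hg hy, holoD, h1, h2, -Complex.ofReal_exp]; ring
  · simp [leviK, hess_exp_mul hr hg hy, holoD, h1, h2, -Complex.ofReal_exp]; ring

lemma holoD_exp_mul_eq_zero {r g : E → ℝ} {y v : E} (hr : DifferentiableAt ℝ r y)
    (hg : DifferentiableAt ℝ g y) (hy : r y = 0) :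
    holoD (fun z => Real.exp (g z) * r z) y v = 0 ↔ holoD r y v = 0 := by
  rw [holoD_exp_mul hr hg hy, mul_eq_zero, or_iff_right]
  exact_mod_cast Real.exp_ne_zero _

lemma IsRegularPoint.exp_mul {r g : E → ℝ} {x : E} (h : IsRegularPoint r x)
    (hg : ContDiffAt ℝ 3 g x) : IsRegularPoint (fun z => Real.exp (g z) * r z) x where
  smooth := contDiffAt_exp_mul h.smooth hg
  zero := by simp [h.zero]
  regular := by
    rw [fderiv_exp_mul (h.smooth.differentiableAt (by simp)) (hg.differentiableAt (by simp)),
      h.zero]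
    simp [h.regular, Real.exp_ne_zero]

lemma IsFlatPoint.exp_mul {r g : E → ℝ} {x : E} (h : IsFlatPoint r x)
    (hg : ContDiffAt ℝ 3 g x) : IsFlatPoint (fun z => Real.exp (g z) * r z) x where
  toIsRegularPoint := h.toIsRegularPoint.exp_mul hg
  flat := by
    filter_upwards [h.flat, hg.eventually (by simp), h.smooth.eventually (by simp)]
      with y h1 h2 h3 hy v hv
    rw [exp_mul_eq_zero] at hy
    rw [holoD_exp_mul_eq_zero (h3.differentiableAt (by simp)) (h2.differentiableAt (by simp)) hy]
      at hv
    rw [leviK_exp_mul h3 h2 hy hv, h1 hy v hv, hv]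
    simp

/-- Frobenius integrability of the Levi foliation: the components of `2∂r([a, J a])` are, up to
sign, the imaginary and real parts of the Levi form on `a`. -/
lemma IsFlatPoint.holoD_bracket {r : E → ℝ} {x : E} (h : IsFlatPoint r x) {a : E → E}
    (ha : ContDiffAt ℝ 1 a x) (ha0 : ∀ᶠ y in 𝓝 x, r y = 0 → holoD r y (a y) = 0) :
    holoD r x (Complex.I • fderiv ℝ a x (a x) - fderiv ℝ a x (Complex.I • a x)) = 0 := by
  have hax := ha0.self_of_nhds h.zero
  obtain ⟨ta, tIa⟩ := holoD_eq_zero_iff.1 hax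
  have hK := h.leviK_eq_zero hax hax
  rw [Complex.ext_iff] at hK
  simp only [leviK, Complex.zero_re, Complex.zero_im] at hK
  rw [holoD_sub, holoD_smul, h.holoD_fderiv_of_const ha ha0 ta, h.holoD_fderiv_of_const ha ha0 tIa]
  apply Complex.ext
  · simp; linarith [hK.2]
  · simp; linarith [hK.1]

/-- The effect on the D'Angelo form and on its curvature of changing the defining function `r` to
`exp (ε g) r`. -/
lemma IsFlatPoint.exp_mul_curvature {r g : E → ℝ} {x a n : E} (h : IsFlatPoint r x)
    (hg : ContDiffAt ℝ 3 g x) (ha : holoD r x a = 0) (hn : holoD r x n = 1) :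
    ∃ κ : ℝ, ∀ ε : ℝ,
      holoD (fun z => Real.exp (ε * g z) * r z) x a = 0 ∧
      holoD (fun z => Real.exp (ε * g z) * r z) x (Real.exp (-(ε * g x)) • n) = 1 ∧
      leviK (fun z => Real.exp (ε * g z) * r z) x a (Real.exp (-(ε * g x)) • n)
        = leviK r x a n + ε * holoD g x a ∧
      normalLevi (fun z => Real.exp (ε * g z) * r z) x a (Real.exp (-(ε * g x)) • n)
          - ‖leviK (fun z => Real.exp (ε * g z) * r z) x a (Real.exp (-(ε * g x)) • n)‖ ^ 2
        = normalLevi r x a n - ‖leviK r x a n‖ ^ 2 - ε * κ := by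
  have hn0 : holoD r x n ≠ 0 := by rw [hn]; exact one_ne_zero
  have hs2 : ContDiffAt ℝ (1 + 1 : ℕ∞) r x := h.smooth.of_le (by norm_cast)
  have hev := eventually_holoD_ne (h.smooth.of_le (by norm_num)) hn0
  set A := tangentFrame r a n with hA
  set N := normalFrame r n with hN
  have hAs : ContDiffAt ℝ 1 A x := contDiffAt_tangentFrame (m := 1) hs2 hn0
  have hNs : ContDiffAt ℝ 1 N x := contDiffAt_normalFrame (m := 1) hs2 hn0
  have hAx : A x = a := tangentFrame_self ha
  have hNx : N x = n := normalFrame_self hn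
  have hA0 : ∀ᶠ y in 𝓝 x, r y = 0 → holoD r y (A y) = 0 :=
    hev.mono fun y hy _ => holoD_tangentFrame hy
  have hN1 : ∀ᶠ y in 𝓝 x, r y = 0 → holoD r y (N y) = 1 :=
    hev.mono fun y hy _ => holoD_normalFrame hy
  set w := Complex.I • fderiv ℝ A x (A x) - fderiv ℝ A x (Complex.I • A x) with hw
  -- The bracket term of the curvature formula is again complex tangent, so the transformation rule
  -- for the D'Angelo form applies to it as well.
  have hw0 : holoD r x w = 0 := h.holoD_bracket hAs hA0
  have hPg : ContDiffAt ℝ 1 (fun y => holoD g y (A y)) x :=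
    contDiffAt_holoD (m := 1) (hg.of_le (by norm_cast)) hAs
  have hKs : ContDiffAt ℝ 1 (fun y => leviK r y (A y) (N y)) x :=
    contDiffAt_leviK (m := 1) (by exact_mod_cast h.smooth) hAs hNs
  have c0 := h.curvature hAs hA0 hNs hN1 hKs (.of_forall fun y _ => rfl)
  rw [← hw, hAx, hNx] at c0
  -- The constant is the derivative-and-bracket operator of the curvature formula applied to `2∂g`
  -- instead of to the D'Angelo form. That operator is linear, and the D'Angelo form changes by `ε *
  -- 2∂g`, so the curvature changes linearly in `ε`.
  refine ⟨(fderiv ℝ (fun y => holoD g y (A y)) x a + Complex.I *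
    fderiv ℝ (fun y => holoD g y (A y)) x (Complex.I • a) + Complex.I * holoD g x w).re,
    fun ε => ?_⟩
  have hε : ContDiffAt ℝ 3 (fun z => ε * g z) x := contDiffAt_const.mul hg
  have hf := h.exp_mul hε
  have hrd : ∀ᶠ y in 𝓝 x, ContDiffAt ℝ 3 r y := h.smooth.eventually (by simp)
  have hgd : ∀ᶠ y in 𝓝 x, ContDiffAt ℝ 3 g y := hg.eventually (by simp)
  have hA0' : ∀ᶠ y in 𝓝 x, Real.exp (ε * g y) * r y = 0 →
      holoD (fun z => Real.exp (ε * g z) * r z) y (A y) = 0 := by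
    filter_upwards [hA0, hrd, hgd] with y h1 h2 h3 hy
    have hy' : r y = 0 := (exp_mul_eq_zero (g := fun z => ε * g z)).1 hy
    exact (holoD_exp_mul_eq_zero (g := fun z => ε * g z) (h2.differentiableAt (by simp))
      ((h3.differentiableAt (by simp)).const_mul ε) hy').2 (h1 hy')
  have hN1' : ∀ᶠ y in 𝓝 x, Real.exp (ε * g y) * r y = 0 →
      holoD (fun z => Real.exp (ε * g z) * r z) y (Real.exp (-(ε * g y)) • N y) = 1 := by
    filter_upwards [hN1, hrd, hgd] with y h1 h2 h3 hy
    have hy' : r y = 0 := (exp_mul_eq_zero (g := fun z => ε * g z)).1 hy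
    rw [holoD_exp_mul (g := fun z => ε * g z) (h2.differentiableAt (by simp))
      ((h3.differentiableAt (by simp)).const_mul ε) hy']
    have : (Real.exp (-(ε * g y)) • N y : E) = ((Real.exp (-(ε * g y)) : ℝ) : ℂ) • N y := rfl
    rw [this, holoD_smul, h1 hy', mul_one, ← Complex.ofReal_mul, ← Real.exp_add]
    simp
  have hK' : ∀ᶠ y in 𝓝 x, r y = 0 → ∀ v, holoD r y v = 0 →
      leviK (fun z => Real.exp (ε * g z) * r z) y v (Real.exp (-(ε * g y)) • N y)
        = leviK r y v (N y) + ε * holoD g y v := by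
    filter_upwards [hN1, hrd, hgd] with y h1 h2 h3 hy v hv
    have : (Real.exp (-(ε * g y)) • N y : E) = ((Real.exp (-(ε * g y)) : ℝ) : ℂ) • N y := rfl
    rw [this, leviK_smul_right, leviK_exp_mul (g := fun z => ε * g z) h2 (contDiffAt_const.mul h3)
      hy hv, h1 hy, holoD_const_mul (h3.differentiableAt (by simp)), Complex.conj_ofReal,
      ← mul_assoc, ← Complex.ofReal_mul, ← Real.exp_add]
    simp
  have hN's : ContDiffAt ℝ 1 (fun y => Real.exp (-(ε * g y)) • N y) x :=
    ((contDiffAt_const.mul hg).neg.exp.of_le (by norm_num)).smul hNs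
  have hs' : ContDiffAt ℝ 1 (fun y => leviK r y (A y) (N y) + ε * holoD g y (A y)) x :=
    hKs.add (contDiffAt_const.mul hPg)
  have c1 := hf.curvature hAs hA0' hN's hN1' hs' (by
    filter_upwards [hK', hA0] with y h1 h2 hy
    have hy' : r y = 0 := (exp_mul_eq_zero (g := fun z => ε * g z)).1 hy
    exact (h1 hy' _ (h2 hy')).symm)
  have hKx := hK'.self_of_nhds h.zero
  rw [← hw, hAx, hNx, ← hNx, hKx w hw0, hNx] at c1
  have hA0x := hA0'.self_of_nhds hf.zero
  have hN1x := hN1'.self_of_nhds hf.zero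
  have hKa := hKx a ha
  rw [hAx] at hA0x
  rw [hNx] at hN1x hKa
  refine ⟨hA0x, hN1x, hKa, ?_⟩
  have hd : ∀ u, fderiv ℝ (fun y => leviK r y (A y) (N y) + ε * holoD g y (A y)) x u
      = fderiv ℝ (fun y => leviK r y (A y) (N y)) x u
        + ε * fderiv ℝ (fun y => holoD g y (A y)) x u := fun u => by
    rw [fderiv_fun_add (hKs.differentiableAt one_ne_zero)
      ((contDiffAt_const.mul hPg).differentiableAt one_ne_zero),
      fderiv_const_mul (hPg.differentiableAt one_ne_zero)]
    rfl
  rw [hd, hd] at c1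
  have := congrArg Complex.re (c1.symm.trans (show _ =
    ((-normalLevi r x a n + ‖leviK r x a n‖ ^ 2 : ℝ) : ℂ) + (ε : ℂ) * (fderiv ℝ (fun y => holoD g y (A y)) x a + Complex.I *
    fderiv ℝ (fun y => holoD g y (A y)) x (Complex.I • a) + Complex.I * holoD g x w) by
      rw [← c0]; ring))
  rw [Complex.add_re, Complex.re_ofReal_mul, Complex.ofReal_re, Complex.ofReal_re] at this
  linarith

end Flat

section Flat

variable {E : Type*} [NormedAddCommGroup E] [NormedSpace ℂ E]

/-! #### Compositions -/

lemma hess_comp {r : E → ℝ} {φ φ' : ℝ → ℝ} {φ'' : ℝ} {y : E} (hr : ContDiffAt ℝ 3 r y)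
    (h1 : ∀ᶠ t in 𝓝 (r y), HasDerivAt φ (φ' t) t) (h2 : HasDerivAt φ' φ'' (r y)) (v w : E) :
    hess (fun z => φ (r z)) y v w
      = φ'' * (fderiv ℝ r y v * fderiv ℝ r y w) + φ' (r y) * hess r y v w := by
  have he : fderiv ℝ (fun z => φ (r z)) =ᶠ[𝓝 y] fun z => φ' (r z) • fderiv ℝ r z := by
    filter_upwards [hr.continuousAt.eventually h1, hr.eventually (by simp)] with z hz hz'
    exact (hz.comp_hasFDerivAt z (hz'.differentiableAt (by simp)).hasFDerivAt).fderiv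
  have d1 := (hr.differentiableAt (by simp)).hasFDerivAt
  have d3 := ((contDiffAt_fderiv hr).differentiableAt two_ne_zero).hasFDerivAt
  have e : fderiv ℝ (fun z => φ' (r z) • fderiv ℝ r z) y = _ :=
    ((h2.comp_hasFDerivAt y d1).smul d3).fderiv
  rw [hess, he.fderiv_eq, e]
  simp [hess]
  ring

/-- Chain rule for `φ(t) = -(-t)^γ`, with the common factor `γ (-r)^(γ - 2)` taken out. The sign of
the Hessian then rests on the bracket alone, which makes sense up to `r = 0`. -/
lemma leviK_neg_rpow {r : E → ℝ} {y : E} (hr : ContDiffAt ℝ 3 r y) (hy : r y < 0) (γ : ℝ)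
    (v : E) : (leviK (fun z => -(-r z) ^ γ) y v v).re = γ * (-r y) ^ (γ - 2)
      * ((-r y) * (leviK r y v v).re + (1 - γ) * ‖holoD r y v‖ ^ 2) := by
  have h1 : ∀ᶠ t in 𝓝 (r y), HasDerivAt (fun t : ℝ => -(-t) ^ γ) (γ * (-t) ^ (γ - 1)) t := by
    filter_upwards [gt_mem_nhds hy] with t ht
    exact ((hasDerivAt_neg t).rpow_const (p := γ) (Or.inl (by linarith))).neg.congr_deriv (by ring)
  have h2 : HasDerivAt (fun t : ℝ => γ * (-t) ^ (γ - 1))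
      (γ * (1 - γ) * (-r y) ^ (γ - 2)) (r y) := by
    refine (((hasDerivAt_neg (r y)).rpow_const (p := γ - 1)
      (Or.inl (by linarith))).const_mul γ).congr_deriv ?_
    rw [show γ - 1 - 1 = γ - 2 by ring]
    ring
  have hp : (-r y) ^ (γ - 1) = (-r y) ^ (γ - 2) * (-r y) := by
    rw [← Real.rpow_add_one (by linarith)]; congr 1; ring
  rw [← Complex.normSq_eq_norm_sq, Complex.normSq_apply]
  simp only [leviK, holoD]
  rw [hess_comp (φ := fun t : ℝ => -(-t) ^ γ) hr h1 h2,
    hess_comp (φ := fun t : ℝ => -(-t) ^ γ) hr h1 h2, hp]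
  ring

lemma complexHessian_eq_leviK {X : Type*} [TopologicalSpace X] [ChartedSpace E X] (f : X → ℝ)
    (q : X) (v : E) : complexHessian f q v
      = (leviK (f ∘ (chartAt E q).symm) (chartAt E q q) v v).re / 4 := by
  rw [complexHessian, iteratedFDeriv_two_apply, iteratedFDeriv_two_apply]
  simp [leviK, hess]

/-- The complex Hessian is invariant under holomorphic maps. -/
lemma leviK_comp_holomorphic {f : E → ℝ} {ψ : E → E} {y : E} (hf : ContDiffAt ℝ 3 f (ψ y))
    (hψ : ContDiffAt ℝ 3 ψ y)
    (hol : ∀ᶠ z in 𝓝 y, ∀ w, fderiv ℝ ψ z (Complex.I • w) = Complex.I • fderiv ℝ ψ z w) (v : E) :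
    (leviK (f ∘ ψ) y v v).re = (leviK f (ψ y) (fderiv ℝ ψ y v) (fderiv ℝ ψ y v)).re := by
  have hψd : DifferentiableAt ℝ ψ y := hψ.differentiableAt (by simp)
  have hψ1 : ContDiffAt ℝ 2 (fderiv ℝ ψ) y := hψ.fderiv_right (by norm_num)
  have hψ2 := hψ1.differentiableAt two_ne_zero
  have he : fderiv ℝ (f ∘ ψ) =ᶠ[𝓝 y] fun z => (fderiv ℝ f (ψ z)).comp (fderiv ℝ ψ z) := by
    filter_upwards [hψ.continuousAt.eventually (hf.eventually (by simp)),
      hψ.eventually (by simp)] with z h1 h2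
    exact fderiv_comp z (h1.differentiableAt (by simp)) (h2.differentiableAt (by simp))
  have hc : HasFDerivAt (fun z => fderiv ℝ f (ψ z)) ((hess f (ψ y)).comp (fderiv ℝ ψ y)) y :=
    (((contDiffAt_fderiv hf).differentiableAt two_ne_zero).hasFDerivAt).comp y hψd.hasFDerivAt
  have H : ∀ v w, hess (f ∘ ψ) y v w = hess f (ψ y) (fderiv ℝ ψ y v) (fderiv ℝ ψ y w)
      + fderiv ℝ f (ψ y) (fderiv ℝ (fderiv ℝ ψ) y v w) := fun v w => by
    have e : fderiv ℝ (fun z => (fderiv ℝ f (ψ z)).comp (fderiv ℝ ψ z)) y = _ :=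
      (hc.clm_comp hψ2.hasFDerivAt).fderiv
    rw [hess, he.fderiv_eq, e]
    simp
    ring
  -- The second derivative of a holomorphic map is complex bilinear, so its values on `(v, v)` and
  -- `(i v, i v)` cancel in the Levi form.
  have hI : ∀ u w, fderiv ℝ (fderiv ℝ ψ) y u (Complex.I • w)
      = Complex.I • fderiv ℝ (fderiv ℝ ψ) y u w := fun u w => by
    have e1 : fderiv ℝ (fun z => fderiv ℝ ψ z (Complex.I • w)) y u
        = fderiv ℝ (fderiv ℝ ψ) y u (Complex.I • w) := by
      rw [(hψ2.hasFDerivAt.clm_apply (hasFDerivAt_const (Complex.I • w) y)).fderiv]; simp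
    have e2 : fderiv ℝ (fun z => fderiv ℝ ψ z w) y u = fderiv ℝ (fderiv ℝ ψ) y u w := by
      rw [(hψ2.hasFDerivAt.clm_apply (hasFDerivAt_const w y)).fderiv]; simp
    have e3 : (fun z => fderiv ℝ ψ z (Complex.I • w)) =ᶠ[𝓝 y]
        fun z => Complex.I • fderiv ℝ ψ z w := hol.mono fun z hz => hz w
    rw [← e1, e3.fderiv_eq, fderiv_I_smul (hψ2.clm_apply (differentiableAt_const w)), e2]
  have hs : fderiv ℝ (fderiv ℝ ψ) y (Complex.I • v) v
      = fderiv ℝ (fderiv ℝ ψ) y v (Complex.I • v) :=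
    (hψ.isSymmSndFDerivAt (by simp [minSmoothness_of_isRCLikeNormedField]; norm_num)) _ _
  simp only [leviK, H, hI, hs, I_smul_I_smul, map_neg, hol.self_of_nhds]
  ring

/-! #### Positivity near a point of a level set in dimension two -/

/-- The condition `∂bar_b ω - γ / (1 - γ) ω ∧ conj ω > 0` at `x`, in terms of the defining function
`r`. -/
def StrictAt (γ : ℝ) (r : E → ℝ) (x : E) : Prop :=
  ∀ a n, a ≠ 0 → holoD r x a = 0 → holoD r x n = 1 →
    0 < normalLevi r x a n - ‖leviK r x a n‖ ^ 2 - γ / (1 - γ) * ‖leviK r x a n‖ ^ 2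

/-- The condition `∂bar_b ω - γ / (1 - γ) ω ∧ conj ω ≥ 0` at `x`, in terms of the defining function
`r`. -/
def WeakAt (γ : ℝ) (r : E → ℝ) (x : E) : Prop :=
  ∀ a n, holoD r x a = 0 → holoD r x n = 1 →
    0 ≤ normalLevi r x a n - ‖leviK r x a n‖ ^ 2 - γ / (1 - γ) * ‖leviK r x a n‖ ^ 2

/-- Dimension two enters here: the complex tangent space, the kernel of the nonzero complex
functional `2∂r`, is a line, so `a` and `n` span. -/
lemma exists_frame (hdim : Module.finrank ℂ E = 2) {r : E → ℝ} {x : E}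
    (hdr : fderiv ℝ r x ≠ 0) : ∃ a n, a ≠ 0 ∧ holoD r x a = 0 ∧ holoD r x n = 1 ∧
      ∀ v, ∃ s t : ℂ, v = s • a + t • n := by
  have : FiniteDimensional ℂ E := Module.finite_of_finrank_eq_succ hdim
  let φ : E →ₗ[ℂ] ℂ :=
    { toFun := holoD r x
      map_add' := holoD_add r x
      map_smul' := fun c v => holoD_smul r x c v }
  obtain ⟨v, hv⟩ : ∃ v, fderiv ℝ r x v ≠ 0 := by
    by_contra! h0
    exact hdr (ContinuousLinearMap.ext h0)
  have hv' : holoD r x v ≠ 0 := fun h0 => hv (holoD_eq_zero_iff.1 h0).1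
  have hsurj : LinearMap.range φ = ⊤ := by
    refine LinearMap.range_eq_top.2 fun c => ⟨(c * (holoD r x v)⁻¹) • v, ?_⟩
    change holoD r x _ = c
    rw [holoD_smul, mul_assoc, inv_mul_cancel₀ hv', mul_one]
  have hker : Module.finrank ℂ (LinearMap.ker φ) = 1 := by
    have := φ.finrank_range_add_finrank_ker
    rw [hsurj, finrank_top, Module.finrank_self, hdim] at this
    omega
  obtain ⟨a, ha0, ha⟩ := finrank_eq_one_iff'.1 hker
  have hn : holoD r x ((holoD r x v)⁻¹ • v) = 1 := by rw [holoD_smul, inv_mul_cancel₀ hv']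
  refine ⟨a, (holoD r x v)⁻¹ • v, by simpa using ha0, a.2, hn, fun w => ?_⟩
  obtain ⟨s, hs⟩ := ha ⟨w - holoD r x w • (holoD r x v)⁻¹ • v, by
    change holoD r x _ = 0
    rw [holoD_sub, holoD_smul, hn, mul_one, sub_self]⟩
  refine ⟨s, holoD r x w, ?_⟩
  have := congrArg Subtype.val hs
  simp only [Submodule.coe_smul] at this
  rw [this]; abel

lemma frame_decomp {r : E → ℝ} {y a n v : E} (hn : holoD r y n ≠ 0) {s t : ℂ}
    (hv : v = s • a + t • n) :
    v = s • tangentFrame r a n y + holoD r y v • normalFrame r n y := by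
  have h2 : n = holoD r y n • normalFrame r n y := by
    rw [normalFrame, smul_smul, mul_inv_cancel₀ hn, one_smul]
  have h1 : a = tangentFrame r a n y + holoD r y a • normalFrame r n y := by
    rw [tangentFrame, sub_add_cancel]
  have h3 : v = s • (tangentFrame r a n y + holoD r y a • normalFrame r n y)
      + t • holoD r y n • normalFrame r n y := by rw [← h1, ← h2, hv]
  have h4 : holoD r y v = s * holoD r y a + t * holoD r y n := by
    rw [hv, holoD_add, holoD_smul, holoD_smul]
  rw [h4]
  nth_rewrite 1 [h3]
  module

/-- Hermitian symmetry makes the diagonal entries real and turns the two mixed terms into twice a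
real part. -/
lemma leviK_frame_re {r : E → ℝ} {y : E} (hr : ContDiffAt ℝ 3 r y) (s t : ℂ) (a n : E) :
    (leviK r y (s • a + t • n) (s • a + t • n)).re = ‖s‖ ^ 2 * (leviK r y a a).re
      + 2 * (s * (starRingEnd ℂ) t * leviK r y a n).re + ‖t‖ ^ 2 * (leviK r y n n).re := by
  have i1 := leviK_self_im hr a
  have i2 := leviK_self_im hr n
  rw [leviK_add_left, leviK_add_right, leviK_add_right]
  simp only [leviK_smul_left, leviK_smul_right]
  rw [leviK_conj hr a n, ← Complex.normSq_eq_norm_sq, ← Complex.normSq_eq_norm_sq,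
    Complex.normSq_apply, Complex.normSq_apply]
  simp [i1, i2]
  ring

lemma IsFlatPoint.eventually {r : E → ℝ} {x : E} (h : IsFlatPoint r x) :
    ∀ᶠ y in 𝓝 x, r y = 0 → IsFlatPoint r y := by
  have hc : ContinuousAt (fderiv ℝ r) x := (contDiffAt_fderiv h.smooth).continuousAt
  filter_upwards [h.smooth.eventually (by simp), hc.eventually_ne h.regular,
    eventually_eventually_nhds.2 h.flat] with y h1 h2 h3 h4
  exact ⟨⟨h1, h4, h2⟩, h3⟩

/-- Quantities on adapted frames are continuous. -/
lemma continuousAt_frame {r : E → ℝ} {x a n : E} (hr : ContDiffAt ℝ 3 r x)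
    (hn : holoD r x n = 1) :
    ContinuousAt (fun y => leviK r y (tangentFrame r a n y) (normalFrame r n y)) x ∧
    ContinuousAt (fun y => leviK r y (normalFrame r n y) (normalFrame r n y)) x ∧
    ContinuousAt (fun y => normalLevi r y (tangentFrame r a n y) (normalFrame r n y)) x ∧
    ContinuousAt (tangentFrame r a n) x := by
  have hn0 : holoD r x n ≠ 0 := by rw [hn]; exact one_ne_zero
  have h2 : ContDiffAt ℝ (0 + 1 : ℕ∞) r x := hr.of_le (by norm_cast)
  have h3 : ContDiffAt ℝ (0 + 1 + 1 : ℕ∞) r x := hr.of_le (by norm_cast)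
  have ha : ContDiffAt ℝ (0 : ℕ∞) (tangentFrame r a n) x := contDiffAt_tangentFrame h2 hn0
  have hN : ContDiffAt ℝ (0 : ℕ∞) (normalFrame r n) x := contDiffAt_normalFrame h2 hn0
  have hac := ha.continuousAt
  have hNc := hN.continuousAt
  have hIa : ContinuousAt (fun y => Complex.I • tangentFrame r a n y) x := hac.const_smul _
  have hh := (contDiffAt_hess hr).continuousAt
  have ht : ContinuousAt (third r) x := by
    have : ContDiffAt ℝ 0 (fderiv ℝ (hess r)) x := (contDiffAt_hess hr).fderiv_right (by norm_num)
    exact this.continuousAt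
  refine ⟨(contDiffAt_leviK h3 ha hN).continuousAt, (contDiffAt_leviK h3 hN hN).continuousAt,
    ?_, hac⟩
  have hK := (contDiffAt_leviK h3 hN ha).continuousAt
  have hKr := Complex.continuous_re.continuousAt.comp hK
  have hKi := Complex.continuous_im.continuousAt.comp hK
  exact ((((ht.clm_apply hNc).clm_apply hac).clm_apply hac).add
    (((ht.clm_apply hNc).clm_apply hIa).clm_apply hIa)).neg.add
    (((((hh.clm_apply hNc).clm_apply hac).mul hKr).add
      (((hh.clm_apply hNc).clm_apply hIa).mul hKi)).const_mul 2)

variable [CompleteSpace E]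

lemma IsFlatPoint.contDiffAt_levi_frame {r : E → ℝ} {x a n : E} (h : IsFlatPoint r x)
    (hn : holoD r x n = 1) :
    ContDiffAt ℝ 1 (fun y => (leviK r y (tangentFrame r a n y) (tangentFrame r a n y)).re) x ∧
    ∀ᶠ y in 𝓝 x, r y = 0 →
      (leviK r y (tangentFrame r a n y) (tangentFrame r a n y)).re = 0 := by
  obtain ⟨hs, h0⟩ := eventually_tangentFrame (a := a) h.smooth hn
  refine ⟨Complex.reCLM.contDiff.contDiffAt.comp x
    (contDiffAt_leviK (m := 1) (by exact_mod_cast h.smooth) hs hs), ?_⟩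
  filter_upwards [h.flat, h0] with y h1 h2 hy
  rw [h1 hy _ (h2 hy), Complex.zero_re]

/-- Since `1 + γ / (1 - γ) = 1 / (1 - γ)`, the CR condition becomes the discriminant condition of
the Levi form of `-(-r)^γ`. -/
lemma one_sub_mul_lt {γ A k : ℝ} (h1 : γ < 1) :
    0 < A - k - γ / (1 - γ) * k ↔ k < (1 - γ) * A := by
  have : 0 < 1 - γ := by linarith
  rw [show A - k - γ / (1 - γ) * k = ((1 - γ) * A - k) / (1 - γ) by field_simp; ring,
    div_pos_iff_of_pos_right this, sub_pos]

lemma one_sub_mul_le {γ A k : ℝ} (h1 : γ < 1) :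
    0 ≤ A - k - γ / (1 - γ) * k ↔ k ≤ (1 - γ) * A := by
  have : 0 < 1 - γ := by linarith
  rw [show A - k - γ / (1 - γ) * k = ((1 - γ) * A - k) / (1 - γ) by field_simp; ring,
    ← sub_nonneg (a := (1 - γ) * A)]
  exact ⟨fun h => by simpa [this.ne'] using mul_nonneg h this.le, fun h => div_nonneg h this.le⟩

/-- Completing the square after replacing `F` by its lower bound `A δ`: `A` times the form is at
least `(A δ |s| - |t| |k|)^2 + |t|^2 (m A - |k|^2)`. Only `t = 0` leaves no strict term, and there
`F > 0` suffices. -/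
lemma quadratic_pos {F A m δ : ℝ} {k s t : ℂ} (hδ : 0 < δ) (hA : 0 < A) (hF : A * δ < F)
    (hm : ‖k‖ ^ 2 < m * A) (hst : s ≠ 0 ∨ t ≠ 0) :
    0 < δ * (‖s‖ ^ 2 * F + 2 * (s * (starRingEnd ℂ) t * k).re) + ‖t‖ ^ 2 * m := by
  have h1 : -(‖s‖ * ‖t‖ * ‖k‖) ≤ (s * (starRingEnd ℂ) t * k).re := by
    have := Complex.abs_re_le_norm (s * (starRingEnd ℂ) t * k)
    rw [norm_mul, norm_mul, Complex.norm_conj] at this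
    exact (abs_le.1 this).1
  have hs : 0 ≤ ‖s‖ := norm_nonneg s
  have ht : 0 ≤ ‖t‖ := norm_nonneg t
  have hlow : 0 < δ * (‖s‖ ^ 2 * (A * δ) - 2 * (‖s‖ * ‖t‖ * ‖k‖)) + ‖t‖ ^ 2 * m ∨
      (t = 0 ∧ s ≠ 0) := by
    by_cases h0 : t = 0
    · right; exact ⟨h0, hst.resolve_right (not_not.2 h0)⟩
    · left
      have ht' : 0 < ‖t‖ := norm_pos_iff.2 h0
      have : 0 < (A * δ * ‖s‖ - ‖t‖ * ‖k‖) ^ 2 + ‖t‖ ^ 2 * (m * A - ‖k‖ ^ 2) := by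
        have := mul_pos (pow_pos ht' 2) (sub_pos.2 hm)
        positivity
      have h2 : (A * δ * ‖s‖ - ‖t‖ * ‖k‖) ^ 2 + ‖t‖ ^ 2 * (m * A - ‖k‖ ^ 2)
        = A * (δ * (‖s‖ ^ 2 * (A * δ) - 2 * (‖s‖ * ‖t‖ * ‖k‖)) + ‖t‖ ^ 2 * m) := by ring
      rw [h2] at this
      exact pos_of_mul_pos_right this hA.le
  rcases hlow with hlow | ⟨rfl, h0⟩
  · have h3 : ‖s‖ ^ 2 * (A * δ) ≤ ‖s‖ ^ 2 * F := mul_le_mul_of_nonneg_left hF.le (by positivity)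
    have h4 : δ * (‖s‖ ^ 2 * (A * δ) - 2 * (‖s‖ * ‖t‖ * ‖k‖))
        ≤ δ * (‖s‖ ^ 2 * F + 2 * (s * (starRingEnd ℂ) t * k).re) :=
      mul_le_mul_of_nonneg_left (by linarith) hδ.le
    linarith
  · have h5 : 0 < ‖s‖ := norm_pos_iff.2 h0
    have h6 : 0 < F := lt_trans (by positivity) hF
    simp
    positivity

/-- The boundary condition implies strict plurisubharmonicity of `-(-r)^γ` near the boundary. -/
lemma IsFlatPoint.eventually_pos_of_strictAt (hdim : Module.finrank ℂ E = 2) {r : E → ℝ} {x : E}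
    (h : IsFlatPoint r x) {γ : ℝ} (h1 : γ < 1) (hγ : StrictAt γ r x) :
    ∀ᶠ y in 𝓝 x, r y < 0 → ∀ v, v ≠ 0 →
      0 < (-r y) * (leviK r y v v).re + (1 - γ) * ‖holoD r y v‖ ^ 2 := by
  obtain ⟨a, n, ha0, ha, hn, hspan⟩ := exists_frame hdim h.regular
  have hst := (one_sub_mul_lt h1).1 (hγ a n ha0 ha hn)
  set A := normalLevi r x a n with hA
  have h1γ : 0 < 1 - γ := by linarith
  -- A value strictly between leaves room on both sides. The tangential Levi form exceeds `A' (-r)`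
  -- near `x`, while `|k|^2 < m A'` is an open condition, where `m = (1 - γ) + (-r) leviK(n, n)`.
  obtain ⟨A', hA'1, hA'2⟩ : ∃ A', ‖leviK r x a n‖ ^ 2 / (1 - γ) < A' ∧ A' < A :=
    exists_between (by rw [div_lt_iff₀ h1γ]; linarith)
  have hA'0 : 0 < A' := lt_of_le_of_lt (by positivity) hA'1
  rw [div_lt_iff₀ h1γ] at hA'1
  obtain ⟨hFs, hF0⟩ := h.contDiffAt_levi_frame (a := a) hn
  have hlow := eventually_lt_of_vanish (κ := -A') (h.smooth.of_le (by norm_num)) h.zero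
    (holoD_eq_one_iff.1 hn).1 hFs hF0 (by rw [h.fderiv_levi_frame ha hn]; linarith)
  obtain ⟨c1, c2, -, -⟩ := continuousAt_frame (a := a) h.smooth hn
  have hrc : ContinuousAt r x := h.smooth.continuousAt
  have hcont : ContinuousAt (fun y => ((1 - γ) + (-r y) *
      (leviK r y (normalFrame r n y) (normalFrame r n y)).re) * A'
      - ‖leviK r y (tangentFrame r a n y) (normalFrame r n y)‖ ^ 2) x :=
    ((continuousAt_const.add (hrc.neg.mul (Complex.continuous_re.continuousAt.comp c2))).mul
      continuousAt_const).sub (c1.norm.pow 2)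
  have hpos : ∀ᶠ y in 𝓝 x, 0 < ((1 - γ) + (-r y) *
      (leviK r y (normalFrame r n y) (normalFrame r n y)).re) * A'
      - ‖leviK r y (tangentFrame r a n y) (normalFrame r n y)‖ ^ 2 := by
    refine hcont.eventually (lt_mem_nhds ?_)
    beta_reduce
    rw [tangentFrame_self ha, normalFrame_self hn, h.zero]
    linarith
  filter_upwards [hlow, hpos, eventually_holoD_ne (h.smooth.of_le (by norm_num))
    (show holoD r x n ≠ 0 by rw [hn]; exact one_ne_zero), h.smooth.eventually (by simp)]
    with y h2 h3 h4 h5 hy v hv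
  obtain ⟨s, t, hv'⟩ := hspan v
  have hdec := frame_decomp h4 hv'
  have hnz : s ≠ 0 ∨ holoD r y v ≠ 0 := by
    by_contra! h0
    rw [h0.1, h0.2, zero_smul, zero_smul, add_zero] at hdec
    exact hv hdec
  set τ := holoD r y v with hτ
  rw [hdec, leviK_frame_re h5]
  have := quadratic_pos (δ := -r y) (s := s) (t := τ) (by linarith) hA'0
    (by have := h2 hy; linarith) (sub_pos.1 h3) hnz
  nlinarith [this]

/-- Otherwise `x` would be a local minimum, hence a critical point. -/
lemma frequently_neg {r : E → ℝ} {x : E} (h : IsRegularPoint r x) : ∃ᶠ y in 𝓝 x, r y < 0 := by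
  intro hc
  have : IsLocalMin r x := by
    filter_upwards [hc] with y hy
    rw [h.zero]; exact not_lt.1 hy
  exact h.regular this.fderiv_eq_zero

/-- Plurisubharmonicity of `-(-r)^γ` near the boundary implies the boundary condition. -/
lemma IsFlatPoint.weakAt_of_eventually_nonneg {r : E → ℝ} {x : E}
    (h : IsFlatPoint r x) {γ : ℝ} (h1 : γ < 1)
    (hpsh : ∀ᶠ y in 𝓝 x, r y < 0 → ∀ v,
      0 ≤ (-r y) * (leviK r y v v).re + (1 - γ) * ‖holoD r y v‖ ^ 2) : WeakAt γ r x := by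
  intro a n ha hn
  rw [one_sub_mul_le h1]
  by_contra! hlt
  have h1γ : 0 < 1 - γ := by linarith
  obtain ⟨A', hA'1, hA'2⟩ : ∃ A', normalLevi r x a n < A' ∧ A' < ‖leviK r x a n‖ ^ 2 / (1 - γ) :=
    exists_between (by rw [lt_div_iff₀ h1γ]; linarith)
  rw [lt_div_iff₀ h1γ] at hA'2
  obtain ⟨hFs, hF0⟩ := h.contDiffAt_levi_frame (a := a) hn
  have hup := eventually_lt_of_vanish (κ := A') (h.smooth.of_le (by norm_num)) h.zero
    (holoD_eq_one_iff.1 hn).1 hFs.neg (hF0.mono fun y hy hy' => by simp [hy hy']) (by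
      have e : fderiv ℝ
        (fun y => -(leviK r y (tangentFrame r a n y) (tangentFrame r a n y)).re) x
        = -fderiv ℝ (fun y => (leviK r y (tangentFrame r a n y) (tangentFrame r a n y)).re) x :=
        fderiv_fun_neg
      rw [e, neg_apply, h.fderiv_levi_frame ha hn]; linarith)
  obtain ⟨c1, c2, -, -⟩ := continuousAt_frame (a := a) h.smooth hn
  have hrc : ContinuousAt r x := h.smooth.continuousAt
  have cm : ContinuousAt (fun y => (1 - γ) + (-r y) *
      (leviK r y (normalFrame r n y) (normalFrame r n y)).re) x :=
    continuousAt_const.add (hrc.neg.mul (Complex.continuous_re.continuousAt.comp c2))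
  have hm : ∀ᶠ y in 𝓝 x, 0 < (1 - γ) + (-r y) *
      (leviK r y (normalFrame r n y) (normalFrame r n y)).re := by
    refine cm.eventually (lt_mem_nhds ?_)
    beta_reduce
    rw [h.zero]; linarith
  have hneg : ∀ᶠ y in 𝓝 x, 0 < ‖leviK r y (tangentFrame r a n y) (normalFrame r n y)‖ ^ 2
      - ((1 - γ) + (-r y) * (leviK r y (normalFrame r n y) (normalFrame r n y)).re) * A' := by
    refine ((c1.norm.pow 2).sub (cm.mul continuousAt_const)).eventually (lt_mem_nhds ?_)
    simp only [Pi.sub_apply, Pi.mul_apply, Pi.pow_apply]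
    rw [tangentFrame_self ha, normalFrame_self hn, h.zero]
    linarith
  obtain ⟨y, hy, h2, h3, h4, h5, h6, h7⟩ := ((frequently_neg h.toIsRegularPoint).and_eventually
    (hup.and (hm.and (hneg.and ((eventually_holoD_ne (h.smooth.of_le (by norm_num))
    (show holoD r x n ≠ 0 by rw [hn]; exact one_ne_zero)).and
    (hpsh.and (h.smooth.eventually (by simp)))))))).exists
  have hF := h2 hy
  set k := leviK r y (tangentFrame r a n y) (normalFrame r n y) with hk
  set m := (1 - γ) + (-r y) * (leviK r y (normalFrame r n y) (normalFrame r n y)).re with hmdef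
  set F := (leviK r y (tangentFrame r a n y) (tangentFrame r a n y)).re with hFdef
  -- The minimizer in `t` of the quadratic form at `s = 1`. Its minimum is `(-r) F - r^2 |k|^2 / m`,
  -- which is negative because `F < (-r) A'` and `m A' < |k|^2`.
  set t : ℂ := ((r y / m : ℝ) : ℂ) * k with ht
  have hP : holoD r y ((1 : ℂ) • tangentFrame r a n y + t • normalFrame r n y) = t := by
    rw [holoD_add, holoD_smul, holoD_smul, holoD_tangentFrame h5, holoD_normalFrame h5]
    ring
  have hq := h6 hy ((1 : ℂ) • tangentFrame r a n y + t • normalFrame r n y)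
  rw [leviK_frame_re h7, hP, ← hk, ← hFdef] at hq
  have hre : ((1 : ℂ) * (starRingEnd ℂ) t * k).re = r y / m * ‖k‖ ^ 2 := by
    rw [one_mul, ht, map_mul, Complex.conj_ofReal, mul_assoc, mul_comm ((starRingEnd ℂ) k),
      Complex.mul_conj, Complex.normSq_eq_norm_sq, Complex.re_ofReal_mul, Complex.ofReal_re]
  have hnt : ‖t‖ ^ 2 = (r y / m) ^ 2 * ‖k‖ ^ 2 := by
    rw [ht, norm_mul, mul_pow, Complex.norm_real, Real.norm_eq_abs, sq_abs]
  rw [hre, hnt, norm_one] at hq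
  have hq' : 0 ≤ (-r y) * F - (r y) ^ 2 / m * ‖k‖ ^ 2 := by
    have e : (-r y) * F - (r y) ^ 2 / m * ‖k‖ ^ 2 = -r y * (1 ^ 2 * F + 2 * (r y / m * ‖k‖ ^ 2) +
      (r y / m) ^ 2 * ‖k‖ ^ 2 * (leviK r y (normalFrame r n y) (normalFrame r n y)).re)
      + (1 - γ) * ((r y / m) ^ 2 * ‖k‖ ^ 2) := by
      have : (r y) ^ 2 / m * ‖k‖ ^ 2 = (r y / m) ^ 2 * ‖k‖ ^ 2 * m := by field_simp
      rw [this]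
      have : (-r y) * 2 * (r y / m * ‖k‖ ^ 2) = -2 * ((r y / m) ^ 2 * ‖k‖ ^ 2 * m) := by
        field_simp
      linear_combination (-1 : ℝ) * this + (r y / m) ^ 2 * ‖k‖ ^ 2 * hmdef
    rw [e]; exact hq
  have hk2 : m * A' < ‖k‖ ^ 2 := by linarith
  have h8 : (-r y) * F < (r y) ^ 2 * A' := by nlinarith
  have h9 : (r y) ^ 2 * A' < (r y) ^ 2 / m * ‖k‖ ^ 2 := by
    rw [div_mul_eq_mul_div, lt_div_iff₀ h3]
    have := mul_lt_mul_of_pos_left hk2 (show 0 < (r y) ^ 2 by nlinarith)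
    linarith
  linarith

/-- The condition `|k|^2 < (1 - γ) A` forces `A ≥ 0`, so lowering `γ` can only increase the
right-hand side. -/
lemma StrictAt.mono {r : E → ℝ} {x : E} {γ γ' : ℝ} (h1 : γ < 1) (hγ : γ' ≤ γ)
    (h : StrictAt γ r x) : StrictAt γ' r x := by
  intro a n ha0 ha hn
  have := (one_sub_mul_lt h1).1 (h a n ha0 ha hn)
  rw [one_sub_mul_lt (by linarith)]
  have hpos : 0 ≤ normalLevi r x a n := by
    by_contra! h0
    nlinarith [norm_nonneg (leviK r x a n), sq_nonneg ‖leviK r x a n‖]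
  nlinarith

/-- Positive curvature at `x` gives a positive exponent near `x`. -/
lemma IsFlatPoint.exists_strictAt (hdim : Module.finrank ℂ E = 2) {r : E → ℝ} {x : E}
    (h : IsFlatPoint r x) (h0 : StrictAt 0 r x) :
    ∃ γ : ℝ, 0 < γ ∧ γ < 1 ∧ ∀ᶠ y in 𝓝 x, r y = 0 → StrictAt γ r y := by
  obtain ⟨a, n, ha0, ha, hn, hspan⟩ := exists_frame hdim h.regular
  have hst := (one_sub_mul_lt one_pos).1 (h0 a n ha0 ha hn)
  obtain ⟨c1, -, c3, c4⟩ := continuousAt_frame (a := a) h.smooth hn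
  have hg : ContinuousAt (fun γ : ℝ => (1 - γ) * normalLevi r x a n - ‖leviK r x a n‖ ^ 2) 0 := by
    fun_prop
  have hev := hg.eventually (lt_mem_nhds (show (0 : ℝ) < _ by simpa using hst))
  obtain ⟨γ, hγ, hγ0, hγ1⟩ : ∃ γ : ℝ, 0 < (1 - γ) * normalLevi r x a n - ‖leviK r x a n‖ ^ 2 ∧
      0 < γ ∧ γ < 1 := by
    have h2 : ∀ᶠ γ : ℝ in 𝓝[>] 0, 0 < γ ∧ γ < 1 := by
      filter_upwards [Ioo_mem_nhdsGT (show (0 : ℝ) < 1 by norm_num)] with γ hγ using hγ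
    exact ((hev.filter_mono nhdsWithin_le_nhds).and h2).exists
  refine ⟨γ, hγ0, hγ1, ?_⟩
  have hc : ContinuousAt (fun y =>
      (1 - γ) * normalLevi r y (tangentFrame r a n y) (normalFrame r n y)
        - ‖leviK r y (tangentFrame r a n y) (normalFrame r n y)‖ ^ 2) x :=
    (continuousAt_const.mul c3).sub (c1.norm.pow 2)
  filter_upwards [hc.eventually (lt_mem_nhds (show (0 : ℝ) < _ by
      beta_reduce; rw [tangentFrame_self ha, normalFrame_self hn]; exact hγ)), h.eventually,
    eventually_holoD_ne (h.smooth.of_le (by norm_num))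
    (show holoD r x n ≠ 0 by rw [hn]; exact one_ne_zero)] with y h2 h3 h4 hy b m hb0 hb hm
  have hfl := h3 hy
  -- Every complex tangent vector is a multiple `s` of the frame vector and both sides scale by
  -- `|s|^2`. A single continuous inequality on the frame therefore controls all vectors.
  obtain ⟨s, t, hv'⟩ := hspan b
  have hdec := frame_decomp h4 hv'
  rw [hb, zero_smul, add_zero] at hdec
  have hs : s ≠ 0 := by
    rintro rfl
    exact hb0 (by rw [hdec, zero_smul])
  obtain ⟨e1, e2⟩ := hfl.normalLevi_congr hb (holoD_normalFrame h4) hm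
  rw [one_sub_mul_lt hγ1, e1, e2, hdec, normalLevi_smul hfl.smooth, leviK_smul_left, norm_mul,
    mul_pow]
  have : 0 < ‖s‖ ^ 2 := pow_pos (norm_pos_iff.2 hs) 2
  nlinarith

/-- The gap `c - c'` pays for the cross term: by Young's inequality `c' (u + w)^2 ≤ c u^2 + c' c /
(c - c') w^2`. With `w = ε |k1|` the last term is quadratic in `ε`, so for small `ε` it is absorbed
by `ε c₁ |k1|^2`. -/
lemma interpolation_ineq {c c' c₁ ε X0 X1 : ℝ} {k0 k1 : ℂ} (hc' : 0 < c') (hcc : c' < c)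
    (hε : 0 < ε) (hε1 : ε ≤ 1) (hεc : ε * (c' * c) ≤ c₁ * (c - c'))
    (h0 : c * ‖k0‖ ^ 2 ≤ X0) (h1 : c₁ * ‖k1‖ ^ 2 < X1) :
    c' * ‖(1 - ε : ℂ) * k0 + ε * k1‖ ^ 2 < (1 - ε) * X0 + ε * X1 := by
  have hn : ‖(1 - ε : ℂ) * k0 + ε * k1‖ ≤ (1 - ε) * ‖k0‖ + ε * ‖k1‖ := by
    refine (norm_add_le _ _).trans (le_of_eq ?_)
    rw [norm_mul, norm_mul, show (1 - ε : ℂ) = ((1 - ε : ℝ) : ℂ) by push_cast; rfl,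
      Complex.norm_of_nonneg (by linarith), Complex.norm_of_nonneg hε.le]
  set p := ‖k0‖
  set q := ‖k1‖
  have hp : 0 ≤ p := norm_nonneg _
  have hq : 0 ≤ q := norm_nonneg _
  have hsq : ‖(1 - ε : ℂ) * k0 + ε * k1‖ ^ 2 ≤ ((1 - ε) * p + ε * q) ^ 2 :=
    pow_le_pow_left₀ (norm_nonneg _) hn 2
  have hd : 0 < c - c' := by linarith
  have key : c' * ((1 - ε) * p + ε * q) ^ 2 * (c - c')
      ≤ (c * (c - c')) * ((1 - ε) * p) ^ 2 + c' * c * (ε * q) ^ 2 := by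
    nlinarith [sq_nonneg ((c - c') * ((1 - ε) * p) - c' * (ε * q))]
  have h3 : c' * c * (ε * q) ^ 2 ≤ ε * (c₁ * q ^ 2) * (c - c') := by
    have := mul_le_mul_of_nonneg_right hεc (show 0 ≤ ε * q ^ 2 by positivity)
    linarith
  -- Here `(1 - ε)^2 ≤ 1 - ε`.
  have h4 : c * ((1 - ε) * p) ^ 2 ≤ (1 - ε) * X0 := by
    have h5 : c * ((1 - ε) * p) ^ 2 ≤ (1 - ε) * (c * p ^ 2) := by
      have : 0 ≤ c * p ^ 2 := by have : 0 < c := by linarith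
                                 positivity
      nlinarith [mul_nonneg this (mul_nonneg hε.le (sub_nonneg.2 hε1))]
    exact h5.trans (mul_le_mul_of_nonneg_left h0 (by linarith))
  have h6 : ε * (c₁ * q ^ 2) < ε * X1 := mul_lt_mul_of_pos_left h1 hε
  have h7 : c' * ((1 - ε) * p + ε * q) ^ 2 ≤ (1 - ε) * X0 + ε * (c₁ * q ^ 2) := by
    have : c' * ((1 - ε) * p + ε * q) ^ 2 * (c - c')
      ≤ ((1 - ε) * X0 + ε * (c₁ * q ^ 2)) * (c - c') := by
      have := mul_le_mul_of_nonneg_right h4 hd.le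
      nlinarith
    exact le_of_mul_le_mul_right this hd
  have := mul_le_mul_of_nonneg_left hsq hc'.le
  linarith

/-- Interpolation between a weak and a strict condition. -/
lemma IsFlatPoint.strictAt_interpolation {r g : E → ℝ} {x : E}
    (h : IsFlatPoint r x) (hg : ContDiffAt ℝ 3 g x) {γ γ' γ₁ ε : ℝ} (hγ' : 0 < γ') (hγγ : γ' < γ)
    (hγ : γ < 1) (hε : 0 < ε) (hε1 : ε ≤ 1)
    (hεc : ε * (γ' / (1 - γ') * (γ / (1 - γ)))
      ≤ γ₁ / (1 - γ₁) * (γ / (1 - γ) - γ' / (1 - γ')))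
    (h0 : WeakAt γ r x) (h1 : StrictAt γ₁ (fun z => Real.exp (g z) * r z) x) :
    StrictAt γ' (fun z => Real.exp (ε * g z) * r z) x := by
  intro a n' ha0 ha hn'
  have hε3 : ContDiffAt ℝ 3 (fun z => ε * g z) x := contDiffAt_const.mul hg
  have hf := h.exp_mul hε3
  rw [holoD_exp_mul_eq_zero (g := fun z => ε * g z) (h.smooth.differentiableAt (by simp))
    (hε3.differentiableAt (by simp)) h.zero] at ha
  obtain ⟨v, hv⟩ : ∃ v, holoD r x v ≠ 0 := by
    by_contra! h0
    exact h.regular (ContinuousLinearMap.ext fun v => (holoD_eq_zero_iff.1 (h0 v)).1)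
  obtain ⟨n, hn⟩ : ∃ n, holoD r x n = 1 :=
    ⟨(holoD r x v)⁻¹ • v, by rw [holoD_smul, inv_mul_cancel₀ hv]⟩
  obtain ⟨κ, hκ⟩ := h.exp_mul_curvature hg ha hn
  -- The same `κ` serves for `ε` and for `1`, so the quantities at `ε` are convex combinations of
  -- those at `0` (weak condition) and at `1` (strict condition).
  obtain ⟨e1, e2, e3, e4⟩ := hκ ε
  obtain ⟨f1, f2, f3, f4⟩ := hκ 1
  simp only [one_mul] at f1 f2 f3 f4
  have w0 := h0 a n ha hn
  have w1 := h1 a _ ha0 f1 f2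
  obtain ⟨g1, g2⟩ := hf.normalLevi_congr e1 e2 hn'
  rw [g1, g2, e4, e3]
  rw [f4] at w1
  have hmono : γ' / (1 - γ') < γ / (1 - γ) := by
    rw [div_lt_div_iff₀ (by linarith) (by linarith)]; nlinarith
  have := interpolation_ineq (div_pos hγ' (by linarith)) hmono hε hε1 hεc
    (show γ / (1 - γ) * ‖leviK r x a n‖ ^ 2 ≤ normalLevi r x a n - ‖leviK r x a n‖ ^ 2 by linarith)
    (show γ₁ / (1 - γ₁) * ‖leviK r x a n + holoD g x a‖ ^ 2
      < normalLevi r x a n - ‖leviK r x a n‖ ^ 2 - κ by rw [f3] at w1; push_cast at w1; simpa using w1)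
  have e5 : (1 - ε : ℂ) * leviK r x a n + ε * (leviK r x a n + holoD g x a)
      = leviK r x a n + ε * holoD g x a := by ring
  rw [e5] at this
  linarith

end Flat

/-! ### Transfer to charts -/

section Transfer

variable {E : Type*} [NormedAddCommGroup E] [NormedSpace ℂ E]
  {X : Type*} [TopologicalSpace X] [ChartedSpace E X]

/-- The derivative at `q` of the preferred chart at `p`. -/
def chartDeriv (p q : X) : TangentSpace 𝓘(ℝ, E) q →L[ℝ] E :=
  mfderiv 𝓘(ℝ, E) 𝓘(ℝ, E) (chartAt E p) q

/-- The expression of a vector field in the preferred chart at `p`. -/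
def localField (p : X) (V : (q : X) → TangentSpace 𝓘(ℝ, E) q) (x : E) : E :=
  chartDeriv p ((chartAt E p).symm x) (V ((chartAt E p).symm x))

/-- The vector field near `p` with a given expression in the preferred chart at `p`. -/
def fieldOfLocal (p : X) (w : E → E) : (q : X) → TangentSpace 𝓘(ℝ, E) q :=
  VectorField.mpullback 𝓘(ℝ, E) 𝓘(ℝ, E) (chartAt E p) w

variable [IsManifold 𝓘(ℂ, E) ω X]

lemma chart_mdifferentiable (p : X) :
    (chartAt E p).MDifferentiable 𝓘(ℝ, E) 𝓘(ℝ, E) :=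
  have : IsManifold 𝓘(ℝ, E) 1 X := IsManifold.of_le (n := ∞) (by norm_cast)
  mdifferentiable_chart p

lemma chartDeriv_injective {p q : X} (hq : q ∈ (chartAt E p).source) :
    Function.Injective (chartDeriv (E := E) p q) :=
  (chart_mdifferentiable p).mfderiv_injective hq

lemma chartDeriv_surjective {p q : X} (hq : q ∈ (chartAt E p).source) :
    Function.Surjective (chartDeriv (E := E) p q) :=
  (chart_mdifferentiable p).mfderiv_surjective hq

lemma chartDeriv_eq_zero_iff {p q : X} (hq : q ∈ (chartAt E p).source)
    {v : TangentSpace 𝓘(ℝ, E) q} : chartDeriv p q v = 0 ↔ v = 0 :=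
  map_eq_zero_iff _ (chartDeriv_injective hq)

lemma mfderiv_eq_fderiv_chart {F : Type*} [NormedAddCommGroup F] [NormedSpace ℝ F] {p q : X}
    (hq : q ∈ (chartAt E p).source) {f : X → F} (hf : MDifferentiableAt 𝓘(ℝ, E) 𝓘(ℝ, F) f q)
    (v : TangentSpace 𝓘(ℝ, E) q) :
    mfderiv 𝓘(ℝ, E) 𝓘(ℝ, F) f q v
      = fderiv ℝ (f ∘ (chartAt E p).symm) (chartAt E p q) (chartDeriv p q v) := by
  have hs := (chart_mdifferentiable p).mdifferentiableAt_symm ((chartAt E p).map_source hq)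
  have hf' : MDifferentiableAt 𝓘(ℝ, E) 𝓘(ℝ, F) f ((chartAt E p).symm (chartAt E p q)) := by
    rwa [(chartAt E p).left_inv hq]
  have h1 := mfderiv_comp (chartAt E p q) hf' hs
  rw [mfderiv_eq_fderiv] at h1
  rw [h1]
  have h2 := (chart_mdifferentiable p).symm_comp_deriv hq
  have h3 := congrArg (fun φ => φ v) h2
  simp only [ContinuousLinearMap.comp_apply] at h3
  change _ = mfderiv 𝓘(ℝ, E) 𝓘(ℝ, F) f ((chartAt E p).symm (chartAt E p q))
    (mfderiv 𝓘(ℝ, E) 𝓘(ℝ, E) (chartAt E p).symm (chartAt E p q)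
      (mfderiv 𝓘(ℝ, E) 𝓘(ℝ, E) (chartAt E p) q v))
  rw [(chartAt E p).left_inv hq]
  exact congrArg (mfderiv 𝓘(ℝ, E) 𝓘(ℝ, F) f q) h3.symm

lemma contMDiffAt_chart {p q : X} (hq : q ∈ (chartAt E p).source) :
    ContMDiffAt 𝓘(ℝ, E) 𝓘(ℝ, E) ∞ (chartAt E p) q :=
  contMDiffAt_of_mem_maximalAtlas (IsManifold.chart_mem_maximalAtlas p) hq

lemma contMDiffAt_chart_symm {p : X} {x : E} (hx : x ∈ (chartAt E p).target) :
    ContMDiffAt 𝓘(ℝ, E) 𝓘(ℝ, E) ∞ (chartAt E p).symm x :=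
  contMDiffAt_symm_of_mem_maximalAtlas (IsManifold.chart_mem_maximalAtlas p) hx

lemma contDiffAt_comp_chart {F : Type*} [NormedAddCommGroup F] [NormedSpace ℝ F] {p : X} {x : E}
    (hx : x ∈ (chartAt E p).target) {f : X → F}
    (hf : ContMDiffAt 𝓘(ℝ, E) 𝓘(ℝ, F) ∞ f ((chartAt E p).symm x)) :
    ContDiffAt ℝ ∞ (f ∘ (chartAt E p).symm) x :=
  (hf.comp x (contMDiffAt_chart_symm hx)).contDiffAt

lemma isInvertible_chart_symm {p : X} {x : E} (hx : x ∈ (chartAt E p).target) :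
    (mfderiv 𝓘(ℝ, E) 𝓘(ℝ, E) (chartAt E p).symm x).IsInvertible :=
  ⟨(chart_mdifferentiable p).symm.mfderiv hx, rfl⟩

lemma isInvertible_chart {p q : X} (hq : q ∈ (chartAt E p).source) :
    (mfderiv 𝓘(ℝ, E) 𝓘(ℝ, E) (chartAt E p) q).IsInvertible :=
  ⟨(chart_mdifferentiable p).mfderiv hq, rfl⟩

lemma localField_eq_mpullback {p : X} (V : (q : X) → TangentSpace 𝓘(ℝ, E) q) {x : E}
    (hx : x ∈ (chartAt E p).target) : localField p V x
      = VectorField.mpullback 𝓘(ℝ, E) 𝓘(ℝ, E) (chartAt E p).symm V x := by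
  have h := (chart_mdifferentiable (E := E) p).symm.symm_comp_deriv hx
  have hi := isInvertible_chart_symm (E := E) hx
  rw [VectorField.mpullback_apply]
  have h3 := congrArg (fun φ => φ ((mfderiv 𝓘(ℝ, E) 𝓘(ℝ, E) (chartAt E p).symm x).inverse
    (V ((chartAt E p).symm x)))) h
  simp only [ContinuousLinearMap.comp_apply] at h3
  rw [hi.self_apply_inverse] at h3
  exact h3

lemma localField_fieldOfLocal {p : X} (w : E → E) {x : E} (hx : x ∈ (chartAt E p).target) :
    localField p (fieldOfLocal p w) x = w x := by
  have hs := (chartAt E p).map_target hx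
  have h := (isInvertible_chart (E := E) hs).self_apply_inverse
    (w (chartAt E p ((chartAt E p).symm x)))
  refine h.trans ?_
  rw [(chartAt E p).right_inv hx]

lemma localField_chart {p q : X} (hq : q ∈ (chartAt E p).source)
    (V : (q : X) → TangentSpace 𝓘(ℝ, E) q) :
    localField p V (chartAt E p q) = chartDeriv p q (V q) := by
  rw [localField, (chartAt E p).left_inv hq]

variable [CompleteSpace E]

lemma contDiffAt_localField {p : X} {V : (q : X) → TangentSpace 𝓘(ℝ, E) q} {x : E}
    (hx : x ∈ (chartAt E p).target)
    (hV : ContMDiffAt 𝓘(ℝ, E) 𝓘(ℝ, E).tangent ∞ (fun q => (⟨q, V q⟩ : TangentBundle 𝓘(ℝ, E) X))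
      ((chartAt E p).symm x)) : ContDiffAt ℝ ∞ (localField p V) x := by
  have : IsManifold 𝓘(ℝ, E) 1 X := IsManifold.of_le (n := ∞) (by norm_cast)
  have h := ContMDiffAt.mpullback_vectorField_preimage hV (contMDiffAt_chart_symm hx)
    (isInvertible_chart_symm hx) (le_of_eq (by norm_cast))
  rw [contMDiffAt_vectorSpace_iff_contDiffAt] at h
  refine h.congr_of_eventuallyEq ?_
  filter_upwards [(chartAt E p).open_target.mem_nhds hx] with y hy
    using localField_eq_mpullback V hy

lemma smoothField_fieldOfLocal {p : X} {w : E → E} {O : Set E}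
    (hw : ∀ x ∈ O, ContDiffAt ℝ ∞ w x) :
    SmoothField ((chartAt E p).source ∩ chartAt E p ⁻¹' O) (fieldOfLocal p w) := by
  have : IsManifold 𝓘(ℝ, E) 1 X := IsManifold.of_le (n := ∞) (by norm_cast)
  intro q hq
  refine ContMDiffAt.contMDiffWithinAt ?_
  exact ContMDiffAt.mpullback_vectorField_preimage
    (contMDiffAt_vectorSpace_iff_contDiffAt.2 (hw _ hq.2)) (contMDiffAt_chart hq.1)
    (isInvertible_chart hq.1) (le_of_eq (by norm_cast))

lemma SmoothField.contMDiffAt {U : Set X} {V : (q : X) → TangentSpace 𝓘(ℝ, E) q} {q : X}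
    (hV : SmoothField U V) (hU : IsOpen U) (hq : q ∈ U) :
    ContMDiffAt 𝓘(ℝ, E) 𝓘(ℝ, E).tangent ∞
      (fun q => (⟨q, V q⟩ : TangentBundle 𝓘(ℝ, E) X)) q :=
  ContMDiffOn.contMDiffAt hV (hU.mem_nhds hq)

lemma SmoothField.contDiffAt {p : X} {U : Set X} {V : (q : X) → TangentSpace 𝓘(ℝ, E) q} {x : E}
    (hV : SmoothField U V) (hU : IsOpen U) (hx : x ∈ (chartAt E p).target)
    (hxU : (chartAt E p).symm x ∈ U) : ContDiffAt ℝ ∞ (localField p V) x :=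
  contDiffAt_localField hx (hV.contMDiffAt hU hxU)

lemma chartDeriv_mlieBracket {p q : X} (hq : q ∈ (chartAt E p).source) {U : Set X}
    {V W : (q : X) → TangentSpace 𝓘(ℝ, E) q} (hV : SmoothField U V) (hW : SmoothField U W)
    (hU : IsOpen U) (hqU : q ∈ U) :
    chartDeriv p q (VectorField.mlieBracket 𝓘(ℝ, E) V W q)
      = VectorField.lieBracket ℝ (localField p V) (localField p W) (chartAt E p q) := by
  have h2 : IsManifold 𝓘(ℝ, E) (minSmoothness ℝ 2) X :=
    IsManifold.of_le (n := ∞) (by simp [minSmoothness_of_isRCLikeNormedField]; norm_cast)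
  have hx := (chartAt E p).map_source hq
  have hl := (chartAt E p).left_inv hq
  have hV' := (hV.contMDiffAt hU hqU).mdifferentiableAt (by simp)
  have hW' := (hW.contMDiffAt hU hqU).mdifferentiableAt (by simp)
  rw [← hl] at hV' hW'
  have h := VectorField.mpullback_mlieBracket hV' hW' (contMDiffAt_chart_symm hx)
    (by simp [minSmoothness_of_isRCLikeNormedField]; norm_cast)
  rw [← localField_eq_mpullback _ hx, localField_chart hq] at h
  rw [h, ← VectorField.mlieBracketWithin_univ, VectorField.mlieBracketWithin_eq_lieBracketWithin]
  refine (congrFun VectorField.lieBracketWithin_univ (chartAt E p q)).trans ?_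
  refine Filter.EventuallyEq.lieBracket_vectorField_eq ?_ ?_
  · filter_upwards [(chartAt E p).open_target.mem_nhds hx] with y hy
      using (localField_eq_mpullback V hy).symm
  · filter_upwards [(chartAt E p).open_target.mem_nhds hx] with y hy
      using (localField_eq_mpullback W hy).symm

omit [CompleteSpace E] in
-- Transition maps are holomorphic, so their real derivatives are restrictions of complex linear
-- maps. Hence `J` is multiplication by `i` in every chart.
lemma fderiv_transition_I_smul {p q : X} {x : E}
    (hx : x ∈ (chartAt E q).target) (hxp : (chartAt E q).symm x ∈ (chartAt E p).source) (w : E) :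
    fderiv ℝ (chartAt E p ∘ (chartAt E q).symm) x (Complex.I • w)
      = Complex.I • fderiv ℝ (chartAt E p ∘ (chartAt E q).symm) x w := by
  have h1 := (contDiffGroupoid ω 𝓘(ℂ, E)).compatible (chart_mem_atlas E q) (chart_mem_atlas E p)
  rw [contDiffGroupoid, mem_groupoid_of_pregroupoid] at h1
  have h2 : ContDiffOn ℂ ω (chartAt E p ∘ (chartAt E q).symm)
      ((chartAt E q).symm.trans (chartAt E p)).source := by simpa [contDiffPregroupoid] using h1.1
  have hmem : x ∈ ((chartAt E q).symm.trans (chartAt E p)).source := by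
    simp [hx, hxp]
  have h3 : DifferentiableAt ℂ (chartAt E p ∘ (chartAt E q).symm) x :=
    (h2.contDiffAt (((chartAt E q).symm.trans (chartAt E p)).open_source.mem_nhds hmem)
      ).differentiableAt (by simp)
  rw [h3.fderiv_restrictScalars ℝ]
  simp

omit [CompleteSpace E] in
lemma chartDeriv_eq_fderiv {p q : X} (hq : q ∈ (chartAt E p).source)
    (v : TangentSpace 𝓘(ℝ, E) q) : chartDeriv p q v
      = fderiv ℝ (chartAt E p ∘ (chartAt E q).symm) (chartAt E q q) v := by
  have h : MDifferentiableAt 𝓘(ℝ, E) 𝓘(ℝ, E) (chartAt E p) q :=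
    (chart_mdifferentiable p).mdifferentiableAt hq
  rw [chartDeriv, h.mfderiv]
  simp [writtenInExtChartAt, fderivWithin_univ]
  rfl

omit [CompleteSpace E] in
lemma chartDeriv_J {p q : X} (hq : q ∈ (chartAt E p).source) (v : TangentSpace 𝓘(ℝ, E) q) :
    chartDeriv p q (J q v) = Complex.I • chartDeriv p q v := by
  rw [chartDeriv_eq_fderiv hq, chartDeriv_eq_fderiv hq]
  exact fderiv_transition_I_smul (mem_chart_target E q)
    (by rwa [(chartAt E q).left_inv (mem_chart_source E q)]) _

omit [CompleteSpace E] in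
/-- The complex Hessian may be computed in any chart. -/
lemma complexHessian_eq_chart {p q : X} (hq : q ∈ (chartAt E p).source) {f : X → ℝ}
    (hf : ContMDiffAt 𝓘(ℝ, E) 𝓘(ℝ, ℝ) ∞ f q) (v : E) :
    complexHessian f q v = (leviK (f ∘ (chartAt E p).symm) (chartAt E p q)
      (chartDeriv p q v) (chartDeriv p q v)).re / 4 := by
  set ψ := chartAt E p ∘ (chartAt E q).symm with hψ
  have hx := mem_chart_target E q
  have hl := (chartAt E q).left_inv (mem_chart_source E q)
  have hψq : ψ (chartAt E q q) = chartAt E p q := by rw [hψ, Function.comp_apply, hl]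
  have hev : ∀ᶠ x in 𝓝 (chartAt E q q), x ∈ (chartAt E q).target ∧
      (chartAt E q).symm x ∈ (chartAt E p).source := by
    refine ((chartAt E q).open_target.mem_nhds hx |> Filter.Eventually.and <| ?_)
    refine ((chartAt E q).continuousAt_symm hx).eventually ?_
    rw [hl]
    exact (chartAt E p).open_source.mem_nhds hq
  have hc : ContMDiffAt 𝓘(ℝ, E) 𝓘(ℝ, E) ∞ (chartAt E p) ((chartAt E q).symm (chartAt E q q)) := by
    rw [hl]; exact contMDiffAt_chart hq
  have hψs : ContDiffAt ℝ 3 ψ (chartAt E q q) :=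
    (contDiffAt_comp_chart hx hc).of_le (by norm_cast)
  have hfs : ContDiffAt ℝ 3 (f ∘ (chartAt E p).symm) (ψ (chartAt E q q)) := by
    rw [hψq]
    refine (contDiffAt_comp_chart ((chartAt E p).map_source hq) ?_).of_le (by norm_cast)
    rwa [(chartAt E p).left_inv hq]
  have key := leviK_comp_holomorphic hfs hψs (hev.mono fun z hz w =>
    fderiv_transition_I_smul hz.1 hz.2 w) v
  have heq : (f ∘ (chartAt E q).symm) =ᶠ[𝓝 (chartAt E q q)] (f ∘ (chartAt E p).symm) ∘ ψ := by
    filter_upwards [hev] with z hz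
    simp [hψ, (chartAt E p).left_inv hz.2]
  have heq1 : hess (f ∘ (chartAt E q).symm) (chartAt E q q)
      = hess ((f ∘ (chartAt E p).symm) ∘ ψ) (chartAt E q q) := by
    rw [hess, hess]
    exact heq.fderiv.fderiv_eq
  have hv : chartDeriv p q v = fderiv ℝ ψ (chartAt E q q) v := chartDeriv_eq_fderiv hq v
  rw [complexHessian_eq_leviK, hv, ← hψq, ← key]
  simp only [leviK, heq1]

end Transfer

/-! ### Hypersurfaces in charts -/

section Hypersurface

variable {E : Type*} [NormedAddCommGroup E] [NormedSpace ℂ E]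
  {X : Type*} [TopologicalSpace X] [ChartedSpace E X]

/-- A smooth function on `X` which is, near `M`, a regular equation of `M`. -/
structure IsEquation (E : Type*) [NormedAddCommGroup E] [NormedSpace ℂ E]
    {X : Type*} [TopologicalSpace X] [ChartedSpace E X] (M : Set X) (ρ : X → ℝ) : Prop where
  smooth : ContMDiff 𝓘(ℝ, E) 𝓘(ℝ, ℝ) ∞ ρ
  zero : ∀ p ∈ M, ρ p = 0
  regular : ∀ p ∈ M, mfderiv 𝓘(ℝ, E) 𝓘(ℝ, ℝ) ρ p ≠ 0
  mem : ∀ p ∈ M, ∀ᶠ q in 𝓝 p, ρ q = 0 → q ∈ M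

/-- The expression of a function in the preferred chart at `c`. -/
abbrev inChart (E : Type*) [NormedAddCommGroup E] {X F : Type*} [TopologicalSpace X]
    [ChartedSpace E X] (c : X) (f : X → F) : E → F := f ∘ (chartAt E c).symm

/-- The purely imaginary form `v ↦ -i dρ(J v)`. -/
def defForm (E : Type*) [NormedAddCommGroup E] [NormedSpace ℂ E]
    {X : Type*} [TopologicalSpace X] [ChartedSpace E X] (ρ : X → ℝ) : CForm E X := fun q =>
  let d : E →L[ℝ] ℝ := mfderiv 𝓘(ℝ, E) 𝓘(ℝ, ℝ) ρ q
  (-Complex.I) • Complex.ofRealCLM.comp (d.comp (Complex.I • ContinuousLinearMap.id ℝ E))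

lemma defForm_apply (ρ : X → ℝ) (q : X) (v : TangentSpace 𝓘(ℝ, E) q) :
    defForm E ρ q v = -Complex.I * Complex.ofReal (mfderiv 𝓘(ℝ, E) 𝓘(ℝ, ℝ) ρ q (J q v)) := rfl

/-- Near `p`, the restriction of `η` to `M` is the form defined by `ρ`. -/
def AgreesNear (M : Set X) (η : CForm E X) (ρ : X → ℝ) (p : X) : Prop :=
  ∀ᶠ q in 𝓝 p, q ∈ M → ∀ v ∈ tangentOf M q, η q v = defForm E ρ q v

variable [IsManifold 𝓘(ℂ, E) ω X] {M : Set X} {ρ : X → ℝ} {c p : X}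

lemma eventually_chart (hc : p ∈ (chartAt E c).source) {P : X → Prop} (h : ∀ᶠ q in 𝓝 p, P q) :
    ∀ᶠ y in 𝓝 (chartAt E c p), y ∈ (chartAt E c).target ∧ P ((chartAt E c).symm y) := by
  have hx := (chartAt E c).map_source hc
  refine ((chartAt E c).open_target.mem_nhds hx |> Filter.Eventually.and <| ?_)
  refine ((chartAt E c).continuousAt_symm hx).eventually ?_
  rwa [(chartAt E c).left_inv hc]

lemma eventually_of_chart (hc : p ∈ (chartAt E c).source) {P : X → Prop}
    (h : ∀ᶠ y in 𝓝 (chartAt E c p), P ((chartAt E c).symm y)) : ∀ᶠ q in 𝓝 p, P q := by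
  filter_upwards [((chartAt E c).continuousAt hc).eventually h,
    (chartAt E c).open_source.mem_nhds hc] with q hq hs
  rwa [(chartAt E c).left_inv hs] at hq

lemma IsEquation.contDiffAt (hρ : IsEquation E M ρ) {y : E} (hy : y ∈ (chartAt E c).target) :
    ContDiffAt ℝ ∞ (inChart E c ρ) y :=
  contDiffAt_comp_chart hy (hρ.smooth _)

lemma IsEquation.mfderiv_apply (hρ : IsEquation E M ρ) (hc : p ∈ (chartAt E c).source)
    (v : TangentSpace 𝓘(ℝ, E) p) : mfderiv 𝓘(ℝ, E) 𝓘(ℝ, ℝ) ρ p v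
      = fderiv ℝ (inChart E c ρ) (chartAt E c p) (chartDeriv c p v) :=
  mfderiv_eq_fderiv_chart hc ((hρ.smooth p).mdifferentiableAt (by simp)) v

lemma IsEquation.isRegularPoint (hρ : IsEquation E M ρ) (hp : p ∈ M)
    (hc : p ∈ (chartAt E c).source) : IsRegularPoint (inChart E c ρ) (chartAt E c p) where
  smooth := (hρ.contDiffAt ((chartAt E c).map_source hc)).of_le (by norm_cast)
  zero := by simp [(chartAt E c).left_inv hc, hρ.zero p hp]
  regular h := hρ.regular p hp (by
    ext v
    rw [hρ.mfderiv_apply hc, h]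
    rfl)

lemma IsEquation.eventually_mem (hρ : IsEquation E M ρ) (hp : p ∈ M)
    (hc : p ∈ (chartAt E c).source) {P : X → Prop} (h : ∀ᶠ q in 𝓝 p, q ∈ M → P q) :
    ∀ᶠ y in 𝓝 (chartAt E c p), inChart E c ρ y = 0 →
      y ∈ (chartAt E c).target ∧ P ((chartAt E c).symm y) := by
  filter_upwards [eventually_chart hc h, eventually_chart hc (hρ.mem p hp)] with y h1 h2 h3
  exact ⟨h1.1, h1.2 (h2.2 h3)⟩

variable [CompleteSpace E]

/-- Testing with `ρ` itself gives one direction. For the other, any function vanishing on `M`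
vanishes on `ρ = 0` near `p`, so Lagrange multipliers apply. -/
lemma IsEquation.mem_tangentOf (hρ : IsEquation E M ρ) (hp : p ∈ M)
    (hc : p ∈ (chartAt E c).source) {v : TangentSpace 𝓘(ℝ, E) p} :
    v ∈ tangentOf M p ↔ fderiv ℝ (inChart E c ρ) (chartAt E c p) (chartDeriv c p v) = 0 := by
  constructor
  · intro h
    rw [← hρ.mfderiv_apply hc]
    exact h univ ρ isOpen_univ (mem_univ p) hρ.smooth.contMDiffOn fun q hq => hρ.zero q hq.1
  · intro h U f hU hpU hf hf0
    have hfp := hf.contMDiffAt (hU.mem_nhds hpU)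
    rw [mfderiv_eq_fderiv_chart hc (hfp.mdifferentiableAt (by simp))]
    have hr := hρ.isRegularPoint hp hc
    refine fderiv_eq_zero_of_vanish_real (hr.smooth.of_le (by norm_cast)) hr.zero hr.regular
      ((contDiffAt_comp_chart ((chartAt E c).map_source hc) ?_).of_le (by norm_cast)) ?_ h
    · rwa [(chartAt E c).left_inv hc]
    · have := hρ.eventually_mem hp hc (P := fun q => f q = 0)
        (by filter_upwards [hU.mem_nhds hpU] with q hq hqM using hf0 q ⟨hqM, hq⟩)
      exact this.mono fun y hy h0 => (hy h0).2

lemma IsEquation.mem_complexTangentOf (hρ : IsEquation E M ρ) (hp : p ∈ M)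
    (hc : p ∈ (chartAt E c).source) {v : TangentSpace 𝓘(ℝ, E) p} :
    v ∈ complexTangentOf M p
      ↔ holoD (inChart E c ρ) (chartAt E c p) (chartDeriv c p v) = 0 := by
  rw [holoD_eq_zero_iff, ← chartDeriv_J hc, ← hρ.mem_tangentOf hp hc, ← hρ.mem_tangentOf hp hc]
  rfl

lemma neg_mem_tangentOf {v : TangentSpace 𝓘(ℝ, E) p} (h : v ∈ tangentOf M p) :
    -v ∈ tangentOf M p := fun U f hU hp hf h0 => by
  rw [map_neg, h U f hU hp hf h0, neg_zero]

lemma mem_T10_iff {Z : CTangent E p} :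
    Z ∈ T10 M p ↔ Z.1 ∈ complexTangentOf M p ∧ Z.2 = -J p Z.1 := by
  constructor
  · rintro ⟨⟨h1, h2⟩, h3⟩
    refine ⟨⟨h1, ?_⟩, h3⟩
    rw [h3] at h2
    simpa using neg_mem_tangentOf h2
  · rintro ⟨⟨h1, h2⟩, h3⟩
    refine ⟨⟨h1, ?_⟩, h3⟩
    rw [h3]
    exact neg_mem_tangentOf h2

lemma IsEquation.mem_T10 (hρ : IsEquation E M ρ) (hp : p ∈ M)
    (hc : p ∈ (chartAt E c).source) {Z : CTangent E p} : Z ∈ T10 M p ↔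
      holoD (inChart E c ρ) (chartAt E c p) (chartDeriv c p Z.1) = 0 ∧
        chartDeriv c p Z.2 = -(Complex.I • chartDeriv c p Z.1) := by
  rw [mem_T10_iff, hρ.mem_complexTangentOf hp hc, ← chartDeriv_J hc, ← map_neg,
    (chartDeriv_injective hc).eq_iff]

lemma AgreesNear.eventually {η : CForm E X} (h : AgreesNear M η ρ p) :
    ∀ᶠ q in 𝓝 p, AgreesNear M η ρ q := eventually_eventually_nhds.2 h

lemma IsEquation.defForm_chart (hρ : IsEquation E M ρ) (hc : p ∈ (chartAt E c).source)
    (v : TangentSpace 𝓘(ℝ, E) p) : defForm E ρ p v = -Complex.I *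
      (fderiv ℝ (inChart E c ρ) (chartAt E c p) (Complex.I • chartDeriv c p v) : ℝ) := by
  rw [defForm_apply, hρ.mfderiv_apply hc, chartDeriv_J hc]

lemma IsT10Section.mono {U U' : Set X} {L : CField E X} (h : IsT10Section M U L) (hU : IsOpen U')
    (hUU : U' ⊆ U) : IsT10Section M U' L where
  isOpen := hU
  smooth := ⟨h.smooth.1.mono hUU, h.smooth.2.mono hUU⟩
  mem q hq := h.mem q ⟨hq.1, hUU hq.2⟩

/-- Near a point of `M` there are a section of `T^{1,0}_M` and a transversal field with given values
at the point. -/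
lemma IsEquation.exists_sections (hρ : IsEquation E M ρ) (hc : p ∈ (chartAt E c).source)
    {a n : E} (hn : holoD (inChart E c ρ) (chartAt E c p) n ≠ 0) :
    ∃ U, IsOpen U ∧ p ∈ U ∧ U ⊆ (chartAt E c).source ∧
      (∀ q ∈ U, holoD (inChart E c ρ) (chartAt E c q) n ≠ 0) ∧
      SmoothField U (fieldOfLocal c (fun _ => (0 : E))) ∧
      SmoothField U (fieldOfLocal c (fun y => -(Complex.I • normalFrame (inChart E c ρ) n y))) ∧
      IsT10Section M U (fun q => (fieldOfLocal c (tangentFrame (inChart E c ρ) a n) q,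
        fieldOfLocal c (fun y => -(Complex.I • tangentFrame (inChart E c ρ) a n y)) q)) := by
  set r := inChart E c ρ with hr
  set O : Set E := (chartAt E c).target ∩ (fun y => holoD r y n) ⁻¹' {0}ᶜ with hO
  have hsm : ∀ y ∈ (chartAt E c).target, ContDiffAt ℝ ∞ r y := fun y hy => hρ.contDiffAt hy
  have hholo : ContinuousOn (fun y => holoD r y n) (chartAt E c).target := fun y hy =>
    (contDiffAt_holoD (m := 0) ((hsm y hy).of_le (by norm_cast)) (a := fun _ => n)
      contDiffAt_const).continuousAt.continuousWithinAt
  have hOo : IsOpen O := hholo.isOpen_inter_preimage (chartAt E c).open_target isOpen_compl_singleton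
  set U := (chartAt E c).source ∩ chartAt E c ⁻¹' O
  have hUo : IsOpen U := (chartAt E c).isOpen_inter_preimage hOo
  have hne : ∀ q ∈ U, holoD r (chartAt E c q) n ≠ 0 := fun q hq => hq.2.2
  have hl : ∀ q ∈ U, ∀ w : E → E, chartDeriv c q (fieldOfLocal c w q) = w (chartAt E c q) := by
    intro q hq w
    rw [← localField_chart hq.1, localField_fieldOfLocal w hq.2.1]
  have hta : ∀ y ∈ O, ContDiffAt ℝ ∞ (tangentFrame r a n) y := fun y hy =>
    contDiffAt_tangentFrame (m := ⊤) (by simpa using hsm y hy.1) hy.2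
  have hta' : SmoothField U (fieldOfLocal c fun y => -(Complex.I • tangentFrame r a n y)) :=
    smoothField_fieldOfLocal fun y hy => ((hta y hy).const_smul Complex.I).neg
  refine ⟨U, hUo, ⟨hc, (chartAt E c).map_source hc, hn⟩, fun q hq => hq.1, hne,
    smoothField_fieldOfLocal fun y _ => contDiffAt_const,
    smoothField_fieldOfLocal fun y hy => ?_, hUo, ⟨smoothField_fieldOfLocal hta, hta'⟩,
      fun q hq => ?_⟩
  · exact ((contDiffAt_normalFrame (m := ⊤) (by simpa using hsm y hy.1) hy.2).const_smul
      Complex.I).neg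
  · rw [hρ.mem_T10 hq.1 hq.2.1]
    simp only [hl q hq.2]
    exact ⟨holoD_tangentFrame (hne q hq.2), trivial⟩

/-- The expression in a chart of a section of `T^{1,0}_M`. -/
lemma IsEquation.t10Section_chart (hρ : IsEquation E M ρ) (hp : p ∈ M)
    (hc : p ∈ (chartAt E c).source) {U : Set X} {L : CField E X} (hL : IsT10Section M U L)
    (hpU : p ∈ U) :
    ContDiffAt ℝ 1 (localField c fun q => (L q).1) (chartAt E c p) ∧
    ContDiffAt ℝ 1 (localField c fun q => (L q).2) (chartAt E c p) ∧
    (∀ᶠ y in 𝓝 (chartAt E c p), inChart E c ρ y = 0 →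
      holoD (inChart E c ρ) y (localField c (fun q => (L q).1) y) = 0) ∧
    (∀ᶠ y in 𝓝 (chartAt E c p), inChart E c ρ y = 0 →
      localField c (fun q => (L q).2) y = -(Complex.I • localField c (fun q => (L q).1) y)) := by
  have hx := (chartAt E c).map_source hc
  have hpU' : (chartAt E c).symm (chartAt E c p) ∈ U := by rwa [(chartAt E c).left_inv hc]
  have key := hρ.eventually_mem hp hc (P := fun q => q ∈ M ∧ L q ∈ T10 M q)
    (by filter_upwards [hL.isOpen.mem_nhds hpU] with q hq hqM using ⟨hqM, hL.mem q ⟨hqM, hq⟩⟩)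
  refine ⟨(hL.smooth.1.contDiffAt hL.isOpen hx hpU').of_le (by norm_cast),
    (hL.smooth.2.contDiffAt hL.isOpen hx hpU').of_le (by norm_cast), ?_, ?_⟩
  all_goals
    filter_upwards [key] with y hy h0
    obtain ⟨hyt, hyM, hyL⟩ := hy h0
    have h := (hρ.mem_T10 hyM ((chartAt E c).map_target hyt)).1 hyL
    rw [(chartAt E c).right_inv hyt] at h
  · exact h.1
  · exact h.2

/-- A pairing with a form that near `p` is the one defined by `ρ`. -/
lemma IsEquation.pair_eq (hρ : IsEquation E M ρ) (hp : p ∈ M) (hc : p ∈ (chartAt E c).source)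
    {η : CForm E X} (hη : AgreesNear M η ρ p) {Z : CTangent E p} (hZ : Z ∈ CTangentOf M p) :
    pair η Z = ⟨fderiv ℝ (inChart E c ρ) (chartAt E c p) (Complex.I • chartDeriv c p Z.2),
      -fderiv ℝ (inChart E c ρ) (chartAt E c p) (Complex.I • chartDeriv c p Z.1)⟩ := by
  have h := hη.self_of_nhds hp
  rw [pair, h _ hZ.1, h _ hZ.2, hρ.defForm_chart hc, hρ.defForm_chart hc]
  apply Complex.ext <;> simp

lemma chartDeriv_bracket (hc : p ∈ (chartAt E c).source) {U : Set X} {Z W : CField E X}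
    (hZ : SmoothCField U Z) (hW : SmoothCField U W) (hU : IsOpen U) (hpU : p ∈ U) :
    chartDeriv c p (bracket Z W p).1
      = VectorField.lieBracket ℝ (localField c fun q => (Z q).1) (localField c fun q => (W q).1)
          (chartAt E c p)
        - VectorField.lieBracket ℝ (localField c fun q => (Z q).2) (localField c fun q => (W q).2)
          (chartAt E c p) ∧
    chartDeriv c p (bracket Z W p).2
      = VectorField.lieBracket ℝ (localField c fun q => (Z q).1) (localField c fun q => (W q).2)
          (chartAt E c p)
        + VectorField.lieBracket ℝ (localField c fun q => (Z q).2) (localField c fun q => (W q).1)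
          (chartAt E c p) := by
  constructor
  · rw [bracket, map_sub, chartDeriv_mlieBracket hc hZ.1 hW.1 hU hpU,
      chartDeriv_mlieBracket hc hZ.2 hW.2 hU hpU]
  · rw [bracket, map_add, chartDeriv_mlieBracket hc hZ.1 hW.2 hU hpU,
      chartDeriv_mlieBracket hc hZ.2 hW.1 hU hpU]

lemma SmoothField.neg {U : Set X} {V : (q : X) → TangentSpace 𝓘(ℝ, E) q} (h : SmoothField U V) :
    SmoothField U (fun q => -V q) := by
  have : IsManifold 𝓘(ℝ, E) 1 X := IsManifold.of_le (n := ∞) (by norm_cast)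
  exact ContMDiffOn.neg_section h

lemma SmoothCField.conj {U : Set X} {Z : CField E X} (h : SmoothCField U Z) :
    SmoothCField U Z.conj := ⟨h.1, h.2.neg⟩

lemma localField_neg (V : (q : X) → TangentSpace 𝓘(ℝ, E) q) :
    localField c (fun q => -V q) = fun y => -localField c V y := by
  ext y
  simp [localField]

/-- The bracket of a section of `T^{1,0}_M` with its conjugate. -/
lemma IsEquation.bracket_conj (hρ : IsEquation E M ρ) (hp : p ∈ M)
    (hc : p ∈ (chartAt E c).source) {U : Set X} {L : CField E X} (hL : IsT10Section M U L)
    (hpU : p ∈ U) :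
    (bracket L L.conj p).1 = 0 ∧
    chartDeriv c p (bracket L L.conj p).2 = (2 : ℝ) • VectorField.lieBracket ℝ
      (localField c fun q => (L q).1) (fun y => Complex.I • localField c (fun q => (L q).1) y)
        (chartAt E c p) := by
  obtain ⟨ha, hb, ha0, hba⟩ := hρ.t10Section_chart hp hc hL hpU
  have h := (hρ.isRegularPoint hp hc).conj_bracket ha hb ha0 hba
  have h' := chartDeriv_bracket hc hL.smooth hL.smooth.conj hL.isOpen hpU
  have e : (localField c fun q => (L.conj q).2) = fun y => -localField c (fun q => (L q).2) y :=
    localField_neg _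
  have e' : (localField c fun q => (L.conj q).1) = localField c fun q => (L q).1 := rfl
  rw [e, e', h.1, h.2] at h'
  exact ⟨(chartDeriv_eq_zero_iff hc).1 h'.1, h'.2⟩

/-- The Levi form in a chart. -/
lemma IsEquation.leviForm_eq (hρ : IsEquation E M ρ) (hp : p ∈ M)
    (hc : p ∈ (chartAt E c).source) {η : CForm E X} (hη : AgreesNear M η ρ p) {U : Set X}
    {L : CField E X} (hL : IsT10Section M U L) (hpU : p ∈ U) :
    leviForm η L L p = ((2 * (leviK (inChart E c ρ) (chartAt E c p) (chartDeriv c p (L p).1)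
      (chartDeriv c p (L p).1)).re : ℝ) : ℂ) := by
  obtain ⟨h1, h2⟩ := hρ.bracket_conj hp hc hL hpU
  obtain ⟨ha, -, ha0, -⟩ := hρ.t10Section_chart hp hc hL hpU
  have hreg := hρ.isRegularPoint hp hc
  have ht : bracket L L.conj p ∈ CTangentOf M p := by
    constructor
    · rw [h1, hρ.mem_tangentOf hp hc]; simp
    · rw [hρ.mem_tangentOf hp hc, h2, map_smul, hreg.fderiv_lieBracket ha (ha.const_smul Complex.I)
        (ha0.mono fun y hy h0 => (holoD_eq_zero_iff.1 (hy h0)).1)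
        (ha0.mono fun y hy h0 => (holoD_eq_zero_iff.1 (hy h0)).2), smul_zero]
  rw [leviForm, hρ.pair_eq hp hc hη ht, h1, h2, real_smul_I, map_smul, hreg.levi_bracket ha ha0,
    localField_chart hc (fun q => (L q).1)]
  apply Complex.ext <;> simp

end Hypersurface

/-! ### D'Angelo forms in charts -/

section DAngelo

variable {E : Type*} [NormedAddCommGroup E] [NormedSpace ℂ E] [CompleteSpace E]
  {X : Type*} [TopologicalSpace X] [ChartedSpace E X] [IsManifold 𝓘(ℂ, E) ω X]
  {M : Set X} {ρ : X → ℝ} {c p : X}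

lemma IsTransversal.mono {U U' : Set X} {η : CForm E X} {T : CField E X}
    (h : IsTransversal M U η T) (hUU : U' ⊆ U) : IsTransversal M U' η T where
  smooth := ⟨h.smooth.1.mono hUU, h.smooth.2.mono hUU⟩
  tangent q hq := h.tangent q ⟨hq.1, hUU hq.2⟩
  imaginary q hq := h.imaginary q ⟨hq.1, hUU hq.2⟩
  normalized q hq := h.normalized q ⟨hq.1, hUU hq.2⟩

/-- For `T = i b` the two conditions `dρ(b) = 0` and `dρ(J b) = 1` are the imaginary and real parts
of `2∂ρ(J b) = 1`. Thus `J b` is the normalized normal vector of the chart computations. -/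
lemma IsEquation.transversal_iff (hρ : IsEquation E M ρ) (hp : p ∈ M)
    (hc : p ∈ (chartAt E c).source) {η : CForm E X} (hη : AgreesNear M η ρ p)
    {Z : CTangent E p} (hZ : Z.1 = 0) :
    Z ∈ CTangentOf M p ∧ pair η Z = 1 ↔
      holoD (inChart E c ρ) (chartAt E c p) (Complex.I • chartDeriv c p Z.2) = 1 := by
  have h1 : Z.1 ∈ tangentOf M p := by rw [hZ, hρ.mem_tangentOf hp hc]; simp
  rw [holoD_eq_one_iff, I_smul_I_smul, map_neg, neg_eq_zero]
  constructor
  · rintro ⟨h, h'⟩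
    rw [hρ.pair_eq hp hc hη h] at h'
    exact ⟨congrArg Complex.re h', (hρ.mem_tangentOf hp hc).1 h.2⟩
  · rintro ⟨h, h'⟩
    have h2 : Z ∈ CTangentOf M p := ⟨h1, (hρ.mem_tangentOf hp hc).2 h'⟩
    refine ⟨h2, ?_⟩
    rw [hρ.pair_eq hp hc hη h2, h, hZ]
    apply Complex.ext <;> simp

/-- The expression of a transversal field in a chart. -/
lemma IsEquation.transversal_chart (hρ : IsEquation E M ρ) (hp : p ∈ M)
    (hc : p ∈ (chartAt E c).source) {η : CForm E X} (hη : AgreesNear M η ρ p) {U : Set X}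
    {T : CField E X} (hT : IsTransversal M U η T) (hU : IsOpen U) (hpU : p ∈ U) :
    ContDiffAt ℝ 1 (localField c fun q => (T q).1) (chartAt E c p) ∧
    ContDiffAt ℝ 1 (localField c fun q => (T q).2) (chartAt E c p) ∧
    (∀ᶠ y in 𝓝 (chartAt E c p), inChart E c ρ y = 0 → localField c (fun q => (T q).1) y = 0) ∧
    (∀ᶠ y in 𝓝 (chartAt E c p), inChart E c ρ y = 0 →
      holoD (inChart E c ρ) y (Complex.I • localField c (fun q => (T q).2) y) = 1) := by
  have hx := (chartAt E c).map_source hc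
  have hpU' : (chartAt E c).symm (chartAt E c p) ∈ U := by rwa [(chartAt E c).left_inv hc]
  have key := hρ.eventually_mem hp hc (P := fun q => (T q).1 = 0 ∧
      holoD (inChart E c ρ) (chartAt E c q) (Complex.I • chartDeriv c q (T q).2) = 1) (by
    filter_upwards [hU.mem_nhds hpU, hη.eventually, (chartAt E c).open_source.mem_nhds hc]
      with q hq hqη hqc hqM
    have hi := hT.imaginary q ⟨hqM, hq⟩
    exact ⟨hi, (hρ.transversal_iff hqM hqc hqη hi).1
      ⟨hT.tangent q ⟨hqM, hq⟩, hT.normalized q ⟨hqM, hq⟩⟩⟩)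
  refine ⟨(hT.smooth.1.contDiffAt hU hx hpU').of_le (by norm_cast),
    (hT.smooth.2.contDiffAt hU hx hpU').of_le (by norm_cast), ?_, ?_⟩
  all_goals
    filter_upwards [key] with y hy h0
    obtain ⟨hyt, h1, h2⟩ := hy h0
  · rw [localField, h1, map_zero]
  · rwa [(chartAt E c).right_inv hyt] at h2

lemma IsEquation.bracket_mem (hρ : IsEquation E M ρ) (hp : p ∈ M)
    (hc : p ∈ (chartAt E c).source) {η : CForm E X} (hη : AgreesNear M η ρ p) {U : Set X}
    {T L : CField E X} (hT : IsTransversal M U η T) (hL : IsT10Section M U L) (hpU : p ∈ U) :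
    bracket T L p ∈ CTangentOf M p := by
  obtain ⟨ht, hb, ht0, hb1⟩ := hρ.transversal_chart hp hc hη hT hL.isOpen hpU
  obtain ⟨ha, hl, ha0, hla⟩ := hρ.t10Section_chart hp hc hL hpU
  obtain ⟨h1, h2, -⟩ := (hρ.isRegularPoint hp hc).dangelo_bracket ht hb ha hl ht0 hb1 ha0 hla
  obtain ⟨e1, e2⟩ := chartDeriv_bracket hc hT.smooth hL.smooth hL.isOpen hpU
  exact ⟨by rw [hρ.mem_tangentOf hp hc, e1, h1], by rw [hρ.mem_tangentOf hp hc, e2, h2]⟩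

/-- The D'Angelo form in a chart. -/
lemma IsEquation.pair_bracket (hρ : IsEquation E M ρ) (hp : p ∈ M)
    (hc : p ∈ (chartAt E c).source) {η : CForm E X} (hη : AgreesNear M η ρ p) {U : Set X}
    {T L : CField E X} (hT : IsTransversal M U η T) (hL : IsT10Section M U L) (hpU : p ∈ U) :
    pair η (bracket T L p) = leviK (inChart E c ρ) (chartAt E c p) (chartDeriv c p (L p).1)
      (Complex.I • chartDeriv c p (T p).2) := by
  obtain ⟨ht, hb, ht0, hb1⟩ := hρ.transversal_chart hp hc hη hT hL.isOpen hpU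
  obtain ⟨ha, hl, ha0, hla⟩ := hρ.t10Section_chart hp hc hL hpU
  obtain ⟨-, -, h3, h4⟩ := (hρ.isRegularPoint hp hc).dangelo_bracket ht hb ha hl ht0 hb1 ha0 hla
  obtain ⟨e1, e2⟩ := chartDeriv_bracket hc hT.smooth hL.smooth hL.isOpen hpU
  rw [hρ.pair_eq hp hc hη (hρ.bracket_mem hp hc hη hT hL hpU), e1, e2, h3, h4,
    localField_chart hc (fun q => (L q).1), localField_chart hc (fun q => (T q).2)]

lemma SmoothForm.pairField {U : Set X} {β : CForm E X} {Z : CField E X} (hβ : SmoothForm U β)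
    (hU : IsOpen U) (hZ : SmoothCField U Z) :
    ContMDiffOn 𝓘(ℝ, E) 𝓘(ℝ, ℂ) ∞ (pairField β Z) U :=
  (hβ U subset_rfl hU _ hZ.1).add ((contDiff_const.mul contDiff_id :
    ContDiff ℝ ∞ fun z : ℂ => Complex.I * z).contMDiff.comp_contMDiffOn
      (hβ U subset_rfl hU _ hZ.2))

lemma dirDeriv_chart (hc : p ∈ (chartAt E c).source) {g : X → ℂ}
    (hg : ContMDiffAt 𝓘(ℝ, E) 𝓘(ℝ, ℂ) ∞ g p) (Z : CTangent E p) :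
    dirDeriv g Z = fderiv ℝ (inChart E c g) (chartAt E c p) (chartDeriv c p Z.1)
      + Complex.I * fderiv ℝ (inChart E c g) (chartAt E c p) (chartDeriv c p Z.2) := by
  have h := mfderiv_eq_fderiv_chart hc (hg.mdifferentiableAt (by simp))
  exact congrArg₂ (fun u v : ℂ => u + Complex.I * v) (h Z.1) (h Z.2)

lemma contDiffAt_inChart {F : Type*} [NormedAddCommGroup F] [NormedSpace ℝ F]
    (hc : p ∈ (chartAt E c).source) {g : X → F} (hg : ContMDiffAt 𝓘(ℝ, E) 𝓘(ℝ, F) ∞ g p) :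
    ContDiffAt ℝ ∞ (inChart E c g) (chartAt E c p) := by
  refine contDiffAt_comp_chart ((chartAt E c).map_source hc) ?_
  rwa [(chartAt E c).left_inv hc]

/-- Derivatives along `M` of a function constant on `M`. -/
lemma IsEquation.dirDeriv_eq_zero (hρ : IsEquation E M ρ) (hp : p ∈ M) {g : X → ℂ}
    (hg : ContMDiffAt 𝓘(ℝ, E) 𝓘(ℝ, ℂ) ∞ g p) {k : ℂ} (h0 : ∀ᶠ q in 𝓝 p, q ∈ M → g q = k)
    {Z : CTangent E p} (hZ : Z ∈ CTangentOf M p) : dirDeriv g Z = 0 := by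
  have hc := mem_chart_source E p
  have hr := hρ.isRegularPoint hp hc
  have h : ∀ u, fderiv ℝ (inChart E p ρ) (chartAt E p p) u = 0 →
      fderiv ℝ (inChart E p g) (chartAt E p p) u = 0 := fun u hu => by
    rw [fderiv_eq_of_eq (hr.smooth.of_le (by norm_cast)) hr.zero hr.regular
      ((contDiffAt_inChart hc hg).of_le (by norm_cast)) (contDiffAt_const (c := k))
      ((hρ.eventually_mem hp hc h0).mono fun y hy h => (hy h).2) hu, fderiv_fun_const]
    rfl
  rw [dirDeriv_chart hc hg, h _ ((hρ.mem_tangentOf hp hc).1 hZ.1),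
    h _ ((hρ.mem_tangentOf hp hc).1 hZ.2)]
  simp

/-- A D'Angelo form and its `(1,1)`-differential in a chart. -/
theorem IsEquation.dangelo (hρ : IsEquation E M ρ) (hp : p ∈ M)
    (hc : p ∈ (chartAt E c).source) {η : CForm E X} (hη : AgreesNear M η ρ p)
    (hf : IsFlatPoint (inChart E c ρ) (chartAt E c p)) {U : Set X} {T L : CField E X}
    {σ : CForm E X} (hT : IsTransversal M U η T) (hσ : IsDAngeloForm M U η T σ)
    (hL : IsT10Section M U L) (hpU : p ∈ U) :
    pair σ (L p) = leviK (inChart E c ρ) (chartAt E c p) (chartDeriv c p (L p).1)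
      (Complex.I • chartDeriv c p (T p).2) ∧
    (extD σ L L.conj p).re = normalLevi (inChart E c ρ) (chartAt E c p) (chartDeriv c p (L p).1)
      (Complex.I • chartDeriv c p (T p).2) - ‖leviK (inChart E c ρ) (chartAt E c p)
        (chartDeriv c p (L p).1) (Complex.I • chartDeriv c p (T p).2)‖ ^ 2 := by
  have hU := hL.isOpen
  have hreg := hf.toIsRegularPoint
  -- the values of `σ` on sections of `T^{1,0}`
  have hval : ∀ L' U', IsT10Section M U' L' → U' ⊆ U → ∀ q ∈ M ∩ U', q ∈ (chartAt E c).source →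
      AgreesNear M η ρ q → pair σ (L' q) = leviK (inChart E c ρ) (chartAt E c q)
        (chartDeriv c q (L' q).1) (Complex.I • chartDeriv c q (T q).2) := by
    intro L' U' hL' hU' q hq hqc hqη
    rw [hσ.on_T10 U' L' hU' hL' q hq]
    exact hρ.pair_bracket hq.1 hqc hqη (hT.mono hU') hL' hq.2
  refine ⟨hval L U hL subset_rfl p ⟨hp, hpU⟩ hc hη, ?_⟩
  obtain ⟨ht, hb, ht0, hb1⟩ := hρ.transversal_chart hp hc hη hT hU hpU
  obtain ⟨ha, hl, ha0, hla⟩ := hρ.t10Section_chart hp hc hL hpU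
  have hLp := (hρ.mem_T10 hp hc).1 (hL.mem p ⟨hp, hpU⟩)
  have hs := (hσ.smooth.pairField hU hL.smooth).contMDiffAt (hU.mem_nhds hpU)
  have hs' := (hσ.smooth.pairField hU hL.smooth.conj).contMDiffAt (hU.mem_nhds hpU)
  -- A form of type `(1,0)` gives zero on `conj L` along `M`, and `L` is tangent to `M`.
  have h1 : dirDeriv (CRGeometry.pairField σ L.conj) (L p) = 0 := by
    refine hρ.dirDeriv_eq_zero hp hs' (k := 0) ?_ (hL.mem p ⟨hp, hpU⟩).1
    filter_upwards [hU.mem_nhds hpU] with q hq hqM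
      using hσ.on_T01 q ⟨hqM, hq⟩ _ (hL.mem q ⟨hqM, hq⟩)
  have hK : ∀ᶠ y in 𝓝 (chartAt E c p), inChart E c ρ y = 0 →
      inChart E c (CRGeometry.pairField σ L) y
        = leviK (inChart E c ρ) y (localField c (fun q => (L q).1) y)
          (Complex.I • localField c (fun q => (T q).2) y) := by
    have key := hρ.eventually_mem hp hc (P := fun q => pair σ (L q) = leviK (inChart E c ρ)
        (chartAt E c q) (chartDeriv c q (L q).1) (Complex.I • chartDeriv c q (T q).2)) (by
      filter_upwards [hU.mem_nhds hpU, hη.eventually, (chartAt E c).open_source.mem_nhds hc]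
        with q hq hqη hqc hqM using hval L U hL subset_rfl q ⟨hqM, hq⟩ hqc hqη)
    filter_upwards [key] with y hy h0
    obtain ⟨hyt, h⟩ := hy h0
    rwa [(chartAt E c).right_inv hyt] at h
  have hcurv := hf.curvature ha ha0 (hb.const_smul Complex.I) hb1
    ((contDiffAt_inChart hc hs).of_le (by norm_cast)) hK
  simp only [localField_chart hc (fun q => (L q).1), localField_chart hc (fun q => (T q).2)]
    at hcurv
  have h2 : dirDeriv (CRGeometry.pairField σ L) (L.conj p)
      = fderiv ℝ (inChart E c (CRGeometry.pairField σ L)) (chartAt E c p)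
          (chartDeriv c p (L p).1)
        + Complex.I * fderiv ℝ (inChart E c (CRGeometry.pairField σ L)) (chartAt E c p)
          (Complex.I • chartDeriv c p (L p).1) := by
    rw [dirDeriv_chart hc hs]
    congr 3
    change chartDeriv c p (-(L p).2) = _
    rw [map_neg, hLp.2, neg_neg]
  -- the bracket term
  obtain ⟨hb01, hb02⟩ := hρ.bracket_conj hp hc hL hpU
  rw [lieBracket_I_smul (ha.differentiableAt (by simp)),
    localField_chart hc (fun q => (L q).1)] at hb02
  have hw := hf.holoD_bracket ha ha0
  rw [localField_chart hc (fun q => (L q).1)] at hw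
  set w := Complex.I • fderiv ℝ (localField c fun q => (L q).1) (chartAt E c p)
    (chartDeriv c p (L p).1) - fderiv ℝ (localField c fun q => (L q).1) (chartAt E c p)
      (Complex.I • chartDeriv c p (L p).1) with hwdef
  obtain ⟨n', hn'⟩ : ∃ n : E, holoD (inChart E c ρ) (chartAt E c p) n = 1 :=
    ⟨_, hb1.self_of_nhds hreg.zero⟩
  -- The values of `σ` are known only on sections of `T^{1,0}_M`. An auxiliary section whose real
  -- part at `p` is the imaginary part of `[L, conj L]` makes `σ` computable on the bracket.
  obtain ⟨U', hU', hpU', hUs, -, -, -, hL'⟩ := hρ.exists_sections hc (a := (2 : ℝ) • w) (n := n')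
    (by rw [hn']; exact one_ne_zero)
  set L' : CField E X := fun q =>
    (fieldOfLocal c (tangentFrame (inChart E c ρ) ((2 : ℝ) • w) n') q,
      fieldOfLocal c (fun y => -(Complex.I • tangentFrame (inChart E c ρ) ((2 : ℝ) • w) n' y)) q)
  have h2w : holoD (inChart E c ρ) (chartAt E c p) ((2 : ℝ) • w) = 0 := by
    rw [← Complex.coe_smul, holoD_smul, hw, mul_zero]
  have hL'1 : chartDeriv c p (L' p).1 = (2 : ℝ) • w := by
    rw [← localField_chart hc (fun q => (L' q).1),
      localField_fieldOfLocal _ ((chartAt E c).map_source hc), tangentFrame_self h2w]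
  have hL'p : (L' p).1 = (bracket L L.conj p).2 :=
    chartDeriv_injective hc (hL'1.trans hb02.symm)
  have hL'' := hL'.mono (hU'.inter hU) inter_subset_left
  have e1 := hval L' _ hL'' inter_subset_right p ⟨hp, hpU', hpU⟩ hc hη
  have e2 := hσ.on_T01 p ⟨hp, hpU⟩ _ (hL'.mem p ⟨hp, hpU'⟩)
  have h3 : pair σ (bracket L L.conj p) = Complex.I * leviK (inChart E c ρ) (chartAt E c p) w
      (Complex.I • chartDeriv c p (T p).2) := by
    rw [hL'1, ← Complex.coe_smul, leviK_smul_left] at e1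
    -- The second summand is zero, so `σ` on the real vector is half of its value on `L'`.
    have e3 : pair σ (L' p) + pair σ (CTangent.conj (L' p)) = 2 * σ p (L' p).1 := by
      simp only [pair, CTangent.conj, map_neg]
      ring
    rw [e1, e2, hL'p] at e3
    rw [pair, hb01, map_zero, zero_add]
    push_cast at e3
    linear_combination (-Complex.I / 2) * e3
  rw [extD, h1, h2, h3]
  have := congrArg Complex.re hcurv
  simp only [Complex.ofReal_re] at this
  have e4 : (0 - (fderiv ℝ (inChart E c (CRGeometry.pairField σ L)) (chartAt E c p)
          (chartDeriv c p (L p).1)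
        + Complex.I * fderiv ℝ (inChart E c (CRGeometry.pairField σ L)) (chartAt E c p)
          (Complex.I • chartDeriv c p (L p).1)) - Complex.I * leviK (inChart E c ρ)
            (chartAt E c p) w (Complex.I • chartDeriv c p (T p).2))
      = -(fderiv ℝ (inChart E c (CRGeometry.pairField σ L)) (chartAt E c p)
          (chartDeriv c p (L p).1)
        + Complex.I * fderiv ℝ (inChart E c (CRGeometry.pairField σ L)) (chartAt E c p)
          (Complex.I • chartDeriv c p (L p).1) + Complex.I * leviK (inChart E c ρ)
            (chartAt E c p) w (Complex.I • chartDeriv c p (T p).2)) := by ring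
  rw [e4, Complex.neg_re, this]
  ring

/-- The `(1,0)`-form with given D'Angelo form on the complex tangent space and vanishing on the
normal frame. -/
def dangeloLocal [FiniteDimensional ℝ E] (r : E → ℝ) (n y : E) : E →L[ℝ] ℂ :=
  LinearMap.toContinuousLinearMap
    -- The factor `1 / 2` compensates that a complex linear form takes the value `2 σ(a)` on `L = a
    -- - i J a`.
    { toFun := fun u => (1 / 2 : ℂ)
        * leviK r y (u - holoD r y u • normalFrame r n y) (normalFrame r n y)
      map_add' := fun u v => by
        simp only [holoD_add, add_smul, leviK_sub_left, leviK_add_left]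
        ring
      map_smul' := fun s u => by
        simp only [← Complex.coe_smul, holoD_smul, leviK_sub_left, leviK_smul_left,
          RingHom.id_apply, smul_eq_mul]
        ring }

/-- A form given in a chart by a family of linear forms that takes smooth fields to smooth functions
is smooth. -/
lemma smoothForm_of_chart {U : Set X} (hUc : U ⊆ (chartAt E c).source) {s : E → E →L[ℝ] ℂ}
    (hs : ∀ q ∈ U, ∀ v : E → E, ContDiffAt ℝ ∞ v (chartAt E c q) →
      ContDiffAt ℝ ∞ (fun y => s y (v y)) (chartAt E c q)) {β : CForm E X}
    (hβ : ∀ q ∈ U, ∀ v, β q v = s (chartAt E c q) (chartDeriv c q v)) : SmoothForm U β := by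
  intro U' hU' hU'o V hV q hq
  have hqc := hUc (hU' hq)
  refine ContMDiffAt.contMDiffWithinAt ?_
  have h1 := hs q (hU' hq) (localField c V) (hV.contDiffAt hU'o ((chartAt E c).map_source hqc)
    (by rwa [(chartAt E c).left_inv hqc]))
  refine ((contMDiffAt_iff_contDiffAt.2 h1).comp q (contMDiffAt_chart hqc)).congr_of_eventuallyEq ?_
  filter_upwards [hU'o.mem_nhds hq] with q' hq'
  rw [Function.comp_apply, localField_chart (hUc (hU' hq')), hβ q' (hU' hq')]

/-- Near each point of `M` there are a transversal field, its D'Angelo form, and a section of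
`T^{1,0}_M` with given values at the point. -/
theorem IsEquation.exists_dangelo [FiniteDimensional ℝ E] (hρ : IsEquation E M ρ)
    (hc : p ∈ (chartAt E c).source) {η : CForm E X} (hη : AgreesNear M η ρ p) {a n : E}
    (ha : holoD (inChart E c ρ) (chartAt E c p) a = 0)
    (hn : holoD (inChart E c ρ) (chartAt E c p) n = 1) :
    ∃ (U : Set X) (T : CField E X) (σ : CForm E X) (L : CField E X), IsOpen U ∧ p ∈ U ∧
      (∀ q ∈ U, (T q).1 = 0 ∧ AgreesNear M η ρ q) ∧
      IsTransversal M U η T ∧ IsDAngeloForm M U η T σ ∧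
      IsT10Section M U L ∧ chartDeriv c p (L p).1 = a ∧
      Complex.I • chartDeriv c p (T p).2 = n := by
  obtain ⟨U₁, hU₁, hpU₁, hUc₁, hne₁, hz₁, hb₁, hL₁⟩ := hρ.exists_sections hc (a := a) (n := n)
    (by rw [hn]; exact one_ne_zero)
  obtain ⟨U₂, hU₂, hU₂o, hpU₂⟩ := eventually_nhds_iff.1 hη.eventually
  set r := inChart E c ρ with hr
  set U := U₁ ∩ U₂
  have hU : IsOpen U := hU₁.inter hU₂o
  have hUc : U ⊆ (chartAt E c).source := fun q hq => hUc₁ hq.1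
  have hl : ∀ q ∈ U, ∀ w : E → E, chartDeriv c q (fieldOfLocal c w q) = w (chartAt E c q) := by
    intro q hq w
    rw [← localField_chart (hUc hq), localField_fieldOfLocal w ((chartAt E c).map_source (hUc hq))]
  set T : CField E X := fun q => (fieldOfLocal c (fun _ => (0 : E)) q,
    fieldOfLocal c (fun y => -(Complex.I • normalFrame r n y)) q) with hTdef
  have hT1 : ∀ q ∈ U, (T q).1 = 0 := fun q hq =>
    (chartDeriv_eq_zero_iff (hUc hq)).1 (hl q hq fun _ => 0)
  have hT2 : ∀ q ∈ U, Complex.I • chartDeriv c q (T q).2 = normalFrame r n (chartAt E c q) := by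
    intro q hq
    have : chartDeriv c q (T q).2 = -(Complex.I • normalFrame r n (chartAt E c q)) :=
      hl q hq fun y => -(Complex.I • normalFrame r n y)
    rw [this, smul_neg, I_smul_I_smul, neg_neg]
  have hTt : ∀ q ∈ M ∩ U, T q ∈ CTangentOf M q ∧ pair η (T q) = 1 := fun q hq =>
    (hρ.transversal_iff hq.1 (hUc hq.2) (hU₂ q hq.2.2) (hT1 q hq.2)).2
      (by rw [hT2 q hq.2]; exact holoD_normalFrame (hne₁ q hq.2.1))
  have hT : IsTransversal M U η T :=
    ⟨⟨hz₁.mono inter_subset_left, hb₁.mono inter_subset_left⟩, fun q hq => (hTt q hq).1,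
      fun q hq => hT1 q hq.2, fun q hq => (hTt q hq).2⟩
  set σ : CForm E X := fun q => (dangeloLocal r n (chartAt E c q)).comp (chartDeriv c q) with hσdef
  have hσa : ∀ (q : X) (v : TangentSpace 𝓘(ℝ, E) q), σ q v = (1 / 2 : ℂ) * leviK r (chartAt E c q)
      (chartDeriv c q v - holoD r (chartAt E c q) (chartDeriv c q v)
        • normalFrame r n (chartAt E c q)) (normalFrame r n (chartAt E c q)) := fun q v => rfl
  have hσt : ∀ (q : X) (v : TangentSpace 𝓘(ℝ, E) q), holoD r (chartAt E c q) (chartDeriv c q v) = 0 →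
      σ q v = (1 / 2 : ℂ) * leviK r (chartAt E c q) (chartDeriv c q v)
        (normalFrame r n (chartAt E c q)) := by
    intro q v hv
    rw [hσa, hv, zero_smul, sub_zero]
  have hσI : ∀ (q : X) (v w : TangentSpace 𝓘(ℝ, E) q),
      holoD r (chartAt E c q) (chartDeriv c q v) = 0 →
      chartDeriv c q w = -(Complex.I • chartDeriv c q v) →
      σ q w = -Complex.I * ((1 / 2 : ℂ) * leviK r (chartAt E c q) (chartDeriv c q v)
        (normalFrame r n (chartAt E c q))) := by
    intro q v w hv hw
    rw [← neg_smul] at hw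
    rw [hσt q w (by rw [hw, holoD_smul, hv, mul_zero]), hw, leviK_smul_left]
    ring
  have hsmooth : SmoothForm U σ := by
    refine smoothForm_of_chart hUc (s := dangeloLocal r n) (fun q hq v hv => ?_) fun q hq v => rfl
    have hr' : ContDiffAt ℝ ∞ r (chartAt E c q) :=
      hρ.contDiffAt ((chartAt E c).map_source (hUc hq))
    have hnf : ContDiffAt ℝ ∞ (normalFrame r n) (chartAt E c q) :=
      contDiffAt_normalFrame (m := ⊤) (by simpa using hr') (hne₁ q hq.1)
    have hh : ContDiffAt ℝ ∞ (fun y => holoD r y (v y)) (chartAt E c q) :=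
      contDiffAt_holoD (m := ⊤) (by simpa using hr') hv
    exact contDiffAt_const.mul (contDiffAt_leviK (m := ⊤) (by simpa using hr')
      (hv.sub (hh.smul hnf)) hnf)
  refine ⟨U, T, σ, _, hU, ⟨hpU₁, hpU₂⟩, fun q hq => ⟨hT1 q hq, hU₂ q hq.2⟩, hT,
    ⟨hsmooth, ?_, ?_, ?_⟩, hL₁.mono hU inter_subset_left, ?_, ?_⟩
  · intro U' L' hU' hL' q hq
    have hqU := hU' hq.2
    obtain ⟨h1, h2⟩ := (hρ.mem_T10 hq.1 (hUc hqU)).1 (hL'.mem q hq)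
    rw [hρ.pair_bracket hq.1 (hUc hqU) (hU₂ q hqU.2) (hT.mono hU') hL' hq.2, hT2 q hqU, pair,
      hσt q _ h1, hσI q _ _ h1 h2]
    linear_combination (-(1 / 2 : ℂ) * leviK (inChart E c ρ) (chartAt E c q)
      (chartDeriv c q (L' q).1) (normalFrame r n (chartAt E c q))) * Complex.I_sq
  · intro q hq Z hZ
    obtain ⟨h1, h2⟩ := (hρ.mem_T10 hq.1 (hUc hq.2)).1 hZ
    rw [pair, CTangent.conj, map_neg, hσt q _ h1, hσI q _ _ h1 h2]
    linear_combination ((1 / 2 : ℂ) * leviK (inChart E c ρ) (chartAt E c q)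
      (chartDeriv c q Z.1) (normalFrame r n (chartAt E c q))) * Complex.I_sq
  · intro q hq
    have hN : chartDeriv c q (T q).2 = (-Complex.I) • normalFrame r n (chartAt E c q) := by
      rw [← hT2 q hq.2, neg_smul, I_smul_I_smul, neg_neg]
    rw [pair, hT1 q hq.2, map_zero, hσa, hN, holoD_smul, holoD_normalFrame (hne₁ q hq.2.1), mul_one,
      sub_self, ← zero_smul ℂ (0 : E), leviK_smul_left]
    simp
  · change chartDeriv c p (fieldOfLocal c _ p) = a
    rw [hl p ⟨hpU₁, hpU₂⟩]
    exact tangentFrame_self ha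
  · rw [hT2 p ⟨hpU₁, hpU₂⟩, normalFrame_self hn]

end DAngelo

/-! ### The boundary conditions as conditions on equations of `M` -/

section Flat

variable {E : Type*} [NormedAddCommGroup E] [NormedSpace ℂ E]

lemma fderiv_neg_fun (r : E → ℝ) : fderiv ℝ (fun z => -r z) = fun z => -fderiv ℝ r z :=
  funext fun _ => _root_.fderiv_fun_neg

lemma holoD_neg (r : E → ℝ) (x v : E) : holoD (fun z => -r z) x v = -holoD r x v := by
  rw [holoD, holoD, fderiv_neg_fun]
  apply Complex.ext <;> simp

lemma hess_neg (r : E → ℝ) (x : E) : hess (fun z => -r z) x = -hess r x := by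
  rw [hess, fderiv_neg_fun, hess]
  exact _root_.fderiv_fun_neg

lemma third_neg (r : E → ℝ) (x : E) : third (fun z => -r z) x = -third r x := by
  have h : fderiv ℝ (fderiv ℝ fun z => -r z) = fun z => -fderiv ℝ (fderiv ℝ r) z :=
    funext (hess_neg r)
  rw [third, h, third]
  exact _root_.fderiv_fun_neg

/-- A trivialization determines its equation only up to sign. Changing the sign of `r` changes that
of the normalized normal vector, and the two cancel. -/
lemma levi_neg (r : E → ℝ) (x a n : E) :
    normalLevi (fun z => -r z) x a (-n) = normalLevi r x a n ∧
      leviK (fun z => -r z) x a (-n) = leviK r x a n := by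
  constructor
  · simp only [normalLevi, leviK, hess_neg, third_neg, smul_neg, map_neg,
      neg_apply]
    ring
  · simp only [leviK, hess_neg, smul_neg, map_neg, neg_apply, neg_neg]

lemma StrictAt.neg {γ : ℝ} {r : E → ℝ} {x : E} (h : StrictAt γ (fun z => -r z) x) :
    StrictAt γ r x := by
  intro a n ha h0 h1
  have := h a (-n) ha (by rw [holoD_neg, h0, neg_zero])
    (by rw [holoD_neg, ← neg_one_smul ℂ n, holoD_smul, h1]; ring)
  rwa [(levi_neg r x a n).1, (levi_neg r x a n).2] at this

lemma WeakAt.neg {γ : ℝ} {r : E → ℝ} {x : E} (h : WeakAt γ (fun z => -r z) x) :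
    WeakAt γ r x := by
  intro a n h0 h1
  have := h a (-n) (by rw [holoD_neg, h0, neg_zero])
    (by rw [holoD_neg, ← neg_one_smul ℂ n, holoD_smul, h1]; ring)
  rwa [(levi_neg r x a n).1, (levi_neg r x a n).2] at this

variable {X : Type*} [TopologicalSpace X] [ChartedSpace E X] [IsManifold 𝓘(ℂ, E) ω X]
  {M : Set X} {ρ : X → ℝ} {c p : X}

lemma IsEquation.neg (hρ : IsEquation E M ρ) : IsEquation E M (fun q => -ρ q) where
  smooth := hρ.smooth.neg
  zero p hp := by rw [hρ.zero p hp, neg_zero]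
  regular p hp h := hρ.regular p hp (by
    have e : mfderiv 𝓘(ℝ, E) 𝓘(ℝ, ℝ) (fun q => -ρ q) p = -mfderiv 𝓘(ℝ, E) 𝓘(ℝ, ℝ) ρ p :=
      mfderiv_neg
    rw [e] at h
    exact neg_eq_zero.1 h)
  mem p hp := (hρ.mem p hp).mono fun q h hq => h (neg_eq_zero.1 hq)

lemma agreesNear_defForm (M : Set X) (ρ : X → ℝ) (p : X) : AgreesNear M (defForm E ρ) ρ p :=
  Filter.Eventually.of_forall fun _ _ _ _ => rfl

/-- On a Levi-flat hypersurface the Levi form is identically zero, so positivity is no restriction.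
-/
lemma IsLeviFlat.isPositiveTrivialization (hflat : IsLeviFlat E M) {η : CForm E X}
    (hη : IsTrivialization M η) : IsPositiveTrivialization M η where
  toIsTrivialization := hη
  levi_nonneg p hp U L hpU hL := by
    have h : L p ∈ nullSpace M η p := by
      rw [hflat η hη p hp]
      exact hL.mem p ⟨hp, hpU⟩
    rw [h.2 U L L hpU hL hL rfl, Complex.zero_re]

variable [CompleteSpace E]

lemma smoothForm_of_locally {U : Set X} {β : CForm E X}
    (h : ∀ q ∈ U, ∃ U' : Set X, IsOpen U' ∧ q ∈ U' ∧ SmoothForm U' β) : SmoothForm U β := by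
  intro U' hU' hU'o V hV q hq
  obtain ⟨U₁, hU₁, hq₁, hs⟩ := h q (hU' hq)
  exact ((hs (U' ∩ U₁) inter_subset_right (hU'o.inter hU₁) V (hV.mono inter_subset_left)).contMDiffAt
    ((hU'o.inter hU₁).mem_nhds ⟨hq, hq₁⟩)).contMDiffWithinAt

lemma IsEquation.isTrivialization (hdim : Module.finrank ℂ E = 2) (hρ : IsEquation E M ρ) :
    IsTrivialization M (defForm E ρ) where
  smooth := by
    refine ⟨univ, isOpen_univ, subset_univ M, smoothForm_of_locally fun c _ =>
      ⟨(chartAt E c).source, (chartAt E c).open_source, mem_chart_source E c, ?_⟩⟩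
    refine smoothForm_of_chart subset_rfl (s := fun y => (-Complex.I) • Complex.ofRealCLM.comp
      ((fderiv ℝ (inChart E c ρ) y).comp (Complex.I • ContinuousLinearMap.id ℝ E))) ?_ ?_
    · intro q hq v hv
      have hr : ContDiffAt ℝ ∞ (inChart E c ρ) (chartAt E c q) :=
        hρ.contDiffAt ((chartAt E c).map_source hq)
      have h1 : ContDiffAt ℝ ∞ (fun y => fderiv ℝ (inChart E c ρ) y (Complex.I • v y))
          (chartAt E c q) := (hr.fderiv_right (m := ∞) (by simp)).clm_apply (hv.const_smul Complex.I)
      exact contDiffAt_const.mul (Complex.ofRealCLM.contDiff.contDiffAt.comp _ h1)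
    · intro q hq v
      rw [hρ.defForm_chart hq]
      rfl
  imaginary p _ v _ := by
    rw [defForm_apply, neg_mul, Complex.neg_re, Complex.I_mul_re, neg_neg]
    exact Complex.ofReal_im _
  annihilates p hp v hv := by
    rw [defForm_apply, hv.2 univ ρ isOpen_univ (mem_univ p) hρ.smooth.contMDiffOn
      fun q hq => hρ.zero q hq.1]
    exact (by simp : -Complex.I * Complex.ofReal 0 = 0)
  nonvanishing p hp := by
    have hc := mem_chart_source E p
    obtain ⟨a, n, -, -, hn, -⟩ := exists_frame hdim (hρ.isRegularPoint hp hc).regular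
    obtain ⟨v, hv⟩ := chartDeriv_surjective hc (-(Complex.I • n))
    rw [holoD_eq_one_iff] at hn
    refine ⟨v, ?_, ?_⟩
    · rw [hρ.mem_tangentOf hp hc, hv, map_neg, hn.2, neg_zero]
    · rw [hρ.defForm_chart hc, hv, smul_neg, I_smul_I_smul, neg_neg, hn.1]
      simp

/-- Over a Levi-flat hypersurface the points of a chart are flat. -/
lemma IsEquation.isFlatPoint (hdim : Module.finrank ℂ E = 2) (hρ : IsEquation E M ρ)
    (hflat : IsLeviFlat E M) (hp : p ∈ M) (hc : p ∈ (chartAt E c).source) :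
    IsFlatPoint (inChart E c ρ) (chartAt E c p) where
  toIsRegularPoint := hρ.isRegularPoint hp hc
  flat := by
    have key := hρ.eventually_mem hp hc (P := fun q => q ∈ M) (Filter.Eventually.of_forall
      fun q hq => hq)
    filter_upwards [key] with y hy h0 v hv
    obtain ⟨hyt, hyM⟩ := hy h0
    obtain ⟨q, hq⟩ : ∃ q, q = (chartAt E c).symm y := ⟨_, rfl⟩
    have hqc : q ∈ (chartAt E c).source := hq ▸ (chartAt E c).map_target hyt
    have hqM : q ∈ M := hq ▸ hyM
    obtain rfl : y = chartAt E c q := by rw [hq, (chartAt E c).right_inv hyt]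
    have hreg := hρ.isRegularPoint hqM hqc
    obtain ⟨a, n, -, -, hn, -⟩ := exists_frame hdim hreg.regular
    -- The vector `v` is realized as the real part at `q` of a section of `T^{1,0}_M`, to which the
    -- bracket definition of Levi-flatness applies.
    obtain ⟨U, hU, hqU, -, -, -, -, hL⟩ := hρ.exists_sections hqc (a := v) (n := n)
      (by rw [hn]; exact one_ne_zero)
    have hη := hρ.isTrivialization hdim
    have hnull := hL.mem q ⟨hqM, hqU⟩
    rw [← hflat _ hη q hqM] at hnull
    have h := hnull.2 U _ _ hqU hL hL rfl
    rw [hρ.leviForm_eq hqM hqc (agreesNear_defForm M ρ q) hL hqU] at h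
    simp only at h
    rw [← localField_chart hqc, localField_fieldOfLocal _ hyt, tangentFrame_self hv,
      Complex.ofReal_eq_zero] at h
    exact Complex.ext (by simpa using h) (leviK_self_im hreg.smooth v)

/-! ### The CR conditions at a point as inequalities for the equation -/

section Pointwise

variable (hρ : IsEquation E M ρ) (hp : p ∈ M) (hc : p ∈ (chartAt E c).source) {η : CForm E X}
  (hη : AgreesNear M η ρ p) (hf : IsFlatPoint (inChart E c ρ) (chartAt E c p))
include hρ hp hc hη hf

lemma IsEquation.dfForm_eq {γ : ℝ} {U : Set X} {T L : CField E X}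
    {σ : CForm E X} (hT : IsTransversal M U η T) (hσ : IsDAngeloForm M U η T σ)
    (hL : IsT10Section M U L) (hpU : p ∈ U) :
    dfForm γ σ L p = normalLevi (inChart E c ρ) (chartAt E c p) (chartDeriv c p (L p).1)
      (Complex.I • chartDeriv c p (T p).2) - ‖leviK (inChart E c ρ) (chartAt E c p)
        (chartDeriv c p (L p).1) (Complex.I • chartDeriv c p (T p).2)‖ ^ 2
      - γ / (1 - γ) * ‖leviK (inChart E c ρ) (chartAt E c p)
        (chartDeriv c p (L p).1) (Complex.I • chartDeriv c p (T p).2)‖ ^ 2 ∧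
    holoD (inChart E c ρ) (chartAt E c p) (chartDeriv c p (L p).1) = 0 ∧
    holoD (inChart E c ρ) (chartAt E c p) (Complex.I • chartDeriv c p (T p).2) = 1 ∧
    (L p ≠ 0 ↔ chartDeriv c p (L p).1 ≠ 0) := by
  obtain ⟨h1, h2⟩ := hρ.dangelo hp hc hη hf hT hσ hL hpU
  have h3 := (hρ.mem_T10 hp hc).1 (hL.mem p ⟨hp, hpU⟩)
  refine ⟨by rw [dfForm, h1, h2], h3.1, ?_, not_congr ⟨fun h => by rw [h]; exact map_zero _,
    fun h => ?_⟩⟩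
  · have h4 := ((hρ.transversal_chart hp hc hη hT hL.isOpen hpU).2.2.2).self_of_nhds hf.zero
    rwa [localField_chart hc (fun q => (T q).2)] at h4
  · have h5 := h3.2
    rw [h, smul_zero, neg_zero] at h5
    exact Prod.ext ((chartDeriv_eq_zero_iff hc).1 h) ((chartDeriv_eq_zero_iff hc).1 h5)

/-- Every normalized pair `(a, n)` comes from some `L` and `T`, and conversely. As the left side
mentions no chart, the condition on the right is chart independent. -/
lemma IsEquation.strictAt_iff [FiniteDimensional ℝ E] {γ : ℝ} :
    (∀ (U : Set X) (T : CField E X) (σ : CForm E X) (L : CField E X), p ∈ U →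
      IsTransversal M U η T → IsDAngeloForm M U η T σ → IsT10Section M U L →
      L p ≠ 0 → 0 < dfForm γ σ L p) ↔ StrictAt γ (inChart E c ρ) (chartAt E c p) := by
  constructor
  · intro h a n ha h0 h1
    obtain ⟨U, T, σ, L, hU, hpU, -, hT, hσ, hL, hLa, hTn⟩ := hρ.exists_dangelo hc hη h0 h1
    obtain ⟨e1, -, -, e4⟩ := hρ.dfForm_eq hp hc hη hf (γ := γ) hT hσ hL hpU
    rw [hLa, hTn] at e1
    rw [← e1]
    exact h U T σ L hpU hT hσ hL (e4.2 (by rwa [hLa]))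
  · intro h U T σ L hpU hT hσ hL hL0
    obtain ⟨e1, e2, e3, e4⟩ := hρ.dfForm_eq hp hc hη hf (γ := γ) hT hσ hL hpU
    rw [e1]
    exact h _ _ (e4.1 hL0) e2 e3

lemma IsEquation.weakAt_iff [FiniteDimensional ℝ E] {γ : ℝ} :
    (∀ (U : Set X) (T : CField E X) (σ : CForm E X) (L : CField E X), p ∈ U →
      IsTransversal M U η T → IsDAngeloForm M U η T σ → IsT10Section M U L →
      0 ≤ dfForm γ σ L p) ↔ WeakAt γ (inChart E c ρ) (chartAt E c p) := by
  constructor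
  · intro h a n h0 h1
    obtain ⟨U, T, σ, L, hU, hpU, -, hT, hσ, hL, hLa, hTn⟩ := hρ.exists_dangelo hc hη h0 h1
    obtain ⟨e1, -, -, -⟩ := hρ.dfForm_eq hp hc hη hf (γ := γ) hT hσ hL hpU
    rw [hLa, hTn] at e1
    rw [← e1]
    exact h U T σ L hpU hT hσ hL
  · intro h U T σ L hpU hT hσ hL
    obtain ⟨e1, e2, e3, -⟩ := hρ.dfForm_eq hp hc hη hf (γ := γ) hT hσ hL hpU
    rw [e1]
    exact h _ _ e2 e3

end Pointwise

end Flat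

/-! ### The D'Angelo form as leafwise Chern connection -/

section Chern

variable {E : Type*} [NormedAddCommGroup E] [NormedSpace ℂ E] [CompleteSpace E]
  {X : Type*} [TopologicalSpace X] [ChartedSpace E X] [IsManifold 𝓘(ℂ, E) ω X]
  {M : Set X} {ρ : X → ℝ} {c p : X}

/-- The purely imaginary form `σ - conj σ`. -/
def subConj (σ : CForm E X) : CForm E X := fun q =>
  σ q - (Complex.conjCLE : ℂ →L[ℝ] ℂ).comp (σ q)

lemma subConj_apply (σ : CForm E X) (q : X) (v : TangentSpace 𝓘(ℝ, E) q) :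
    subConj σ q v = σ q v - (starRingEnd ℂ) (σ q v) := rfl

/-- For `σ` of type `(1,0)` this gives `θ(L) = σ(L)` and `θ(conj L) = -conj (σ(L))`, the
compatibility of `θ` with a frame of unit length. -/
lemma pair_subConj (σ : CForm E X) {q : X} (Z : CTangent E q) :
    pair (subConj σ) Z = pair σ Z - (starRingEnd ℂ) (pair σ Z.conj) := by
  simp only [pair, subConj_apply, CTangent.conj, map_neg, map_add, map_mul, Complex.conj_I]
  ring

lemma SmoothForm.subConj {U : Set X} {σ : CForm E X} (h : SmoothForm U σ) :
    SmoothForm U (subConj σ) := fun U' hU' hU'o V hV =>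
  (h U' hU' hU'o V hV).sub ((Complex.conjCLE : ℂ →L[ℝ] ℂ).contMDiff.comp_contMDiffOn
    (h U' hU' hU'o V hV))

lemma conj_conj' {q : X} (Z : CTangent E q) : Z.conj.conj = Z := by
  simp [CTangent.conj]

lemma dirDeriv_sub_conj {f g : X → ℂ} (hf : ContMDiffAt 𝓘(ℝ, E) 𝓘(ℝ, ℂ) ∞ f p)
    (hg : ContMDiffAt 𝓘(ℝ, E) 𝓘(ℝ, ℂ) ∞ g p) (Z : CTangent E p) :
    dirDeriv (fun q => f q - (starRingEnd ℂ) (g q)) Z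
      = dirDeriv f Z - (starRingEnd ℂ) (dirDeriv g Z.conj) := by
  have hc := mem_chart_source E p
  have hg' : ContMDiffAt 𝓘(ℝ, E) 𝓘(ℝ, ℂ) ∞ (fun q => (starRingEnd ℂ) (g q)) p :=
    (Complex.conjCLE : ℂ →L[ℝ] ℂ).contMDiff.contMDiffAt.comp p hg
  rw [dirDeriv_chart hc hf, dirDeriv_chart hc hg, dirDeriv_chart hc (hf.sub hg')]
  have h : fderiv ℝ (inChart E p fun q => f q - (starRingEnd ℂ) (g q)) (chartAt E p p)
      = fderiv ℝ (inChart E p f) (chartAt E p p)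
        - (Complex.conjCLE : ℂ →L[ℝ] ℂ).comp (fderiv ℝ (inChart E p g) (chartAt E p p)) := by
    have h1 := (contDiffAt_inChart hc hf).differentiableAt (by simp)
    have h2 := (contDiffAt_inChart hc hg).differentiableAt (by simp)
    exact (h1.hasFDerivAt.sub
      ((Complex.conjCLE : ℂ →L[ℝ] ℂ).hasFDerivAt.comp _ h2.hasFDerivAt)).fderiv
  rw [h]
  simp only [sub_apply, ContinuousLinearMap.comp_apply, CTangent.conj, map_neg,
    map_add, map_mul, Complex.conj_I, ContinuousLinearEquiv.coe_coe, Complex.conjCLE_apply]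
  ring

/-- The differential of `σ - conj σ`. -/
lemma IsEquation.extD_subConj (hρ : IsEquation E M ρ) (hp : p ∈ M) {U : Set X} {L : CField E X}
    {σ : CForm E X} (hσ : SmoothForm U σ) (hL : IsT10Section M U L) (hpU : p ∈ U) :
    (extD (subConj σ) L L.conj p).re = 2 * (extD σ L L.conj p).re := by
  have h1 := (hσ.pairField hL.isOpen hL.smooth).contMDiffAt (hL.isOpen.mem_nhds hpU)
  have h2 := (hσ.pairField hL.isOpen hL.smooth.conj).contMDiffAt (hL.isOpen.mem_nhds hpU)
  have e1 : pairField (subConj σ) L.conj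
      = fun q => pairField σ L.conj q - (starRingEnd ℂ) (pairField σ L q) := by
    ext q
    simp only [pairField, pair_subConj, CField.conj, conj_conj']
  have e2 : pairField (subConj σ) L
      = fun q => pairField σ L q - (starRingEnd ℂ) (pairField σ L.conj q) := by
    ext q
    simp only [pairField, pair_subConj, CField.conj]
  have e3 := (hρ.bracket_conj hp (mem_chart_source E p) hL hpU).1
  have e4 : pair σ (CTangent.conj (bracket L L.conj p)) = -pair σ (bracket L L.conj p) := by
    simp [pair, CTangent.conj, e3]
  -- Conjugation interchanges `L` and `conj L` and hence reverses the sign of `d`, so `dσ` and minus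
  -- its conjugate add up to twice a real part.
  rw [extD, extD, e1, e2, dirDeriv_sub_conj h2 h1, dirDeriv_sub_conj h1 h2, pair_subConj, e4]
  simp only [CField.conj, conj_conj', Complex.sub_re, Complex.conj_re, map_neg, Complex.neg_re]
  ring

/-- If `h` is normalized by an equation of `M`, then a D'Angelo form gives the Chern connection. -/
lemma IsEquation.isLeafwiseChernForm (hρ : IsEquation E M ρ) {h : BilinField E X}
    (hh : IsNormalMetric M h)
    (hnorm : ∀ q ∈ M, ∀ v ∈ tangentOf M q, mfderiv 𝓘(ℝ, E) 𝓘(ℝ, ℝ) ρ q (J q v) = (1 : ℝ) →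
      h q v v = 1) {U : Set X} (hU : IsOpen U) {T : CField E X} {σ : CForm E X}
    (hT : IsTransversal M U (defForm E ρ) T) (hT0 : ∀ q ∈ U, (T q).1 = 0)
    (hσ : IsDAngeloForm M U (defForm E ρ) T σ) :
    IsLeafwiseChernForm M U h (fun q => (T q).2) (subConj σ) := by
  have hη : ∀ q ∈ M ∩ U, mfderiv 𝓘(ℝ, E) 𝓘(ℝ, ℝ) ρ q (J q (T q).2) = (1 : ℝ) := by
    intro q hq
    have h1 := hT.normalized q hq
    rw [pair, hT.imaginary q hq, map_zero, defForm_apply, zero_add, ← mul_assoc, mul_neg,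
      Complex.I_mul_I, neg_neg, one_mul] at h1
    exact Complex.ofReal_injective h1
  have hV1 : ∀ q ∈ M ∩ U, h q (T q).2 (T q).2 = 1 := fun q hq =>
    hnorm q hq.1 _ (hT.tangent q hq).2 (hη q hq)
  have hconj : ∀ (U' : Set X) (L : CField E X), U' ⊆ U → IsT10Section M U' L → ∀ q ∈ M ∩ U',
      pair (subConj σ) (L q) = pair σ (L q) ∧
      pair (subConj σ) (L.conj q) = -(starRingEnd ℂ) (pair σ (L q)) := by
    intro U' L hU' hL q hq
    have h1 := hσ.on_T01 q ⟨hq.1, hU' hq.2⟩ _ (hL.mem q hq)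
    constructor
    · rw [pair_subConj, h1, map_zero, sub_zero]
    · rw [pair_subConj, CField.conj, h1, conj_conj', zero_sub]
  refine ⟨hT.smooth.2, fun q hq => (hT.tangent q hq).2, fun q hq hV => ?_, hσ.smooth.subConj,
    fun U' L hU' hL q hq => ?_, fun U' L hU' hL q hq => ?_⟩
  · have h1 := hV.2 univ ρ isOpen_univ (mem_univ q) hρ.smooth.contMDiffOn fun x hx => hρ.zero x hx.1
    rw [hη q hq] at h1
    exact one_ne_zero (α := ℝ) h1
  · have hqU := hU' hq.2
    have hc := mem_chart_source E q
    rw [(hconj U' L hU' hL q hq).2, hσ.on_T10 U' L hU' hL q hq]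
    have hbr := hρ.bracket_mem hq.1 hc (agreesNear_defForm M ρ q) (hT.mono hU') hL hq.2
    have hx := (chartAt E q).map_source hc
    -- The real part of `T` vanishes on all of `U`, so its derivative drops out of the brackets in
    -- every direction.
    have ez : localField q (fun x => (T x).1) =ᶠ[𝓝 (chartAt E q q)] fun _ => (0 : E) := by
      filter_upwards [eventually_chart hc (hU.mem_nhds hqU)] with y hy
      rw [localField, hT0 _ hy.2, map_zero]
    have hV0 : SmoothCField U' (fun x => ((T x).2, 0) : CField E X) :=
      ⟨hT.smooth.2.mono hU', by
        have : IsManifold 𝓘(ℝ, E) 1 X := IsManifold.of_le (n := ∞) (by norm_cast)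
        exact (Bundle.contMDiff_zeroSection ℝ (TangentSpace 𝓘(ℝ, E))).contMDiffOn⟩
    obtain ⟨f1, f2⟩ := chartDeriv_bracket hc hL.smooth.conj hV0 hL.isOpen hq.2
    obtain ⟨g1, g2⟩ := chartDeriv_bracket hc (hT.mono hU').smooth hL.smooth hL.isOpen hq.2
    have e0 : localField q (fun x => (((T x).2, 0) : CTangent E x).2) = fun _ => (0 : E) := by
      ext y
      exact map_zero _
    have e1 : (localField q fun x => (L.conj x).2) = fun y => -localField q (fun x => (L x).2) y :=
      localField_neg _
    have e2 : (localField q fun x => (L.conj x).1) = localField q fun x => (L x).1 := rfl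
    simp only [e0, e1, e2, lieBracket_apply, ez.fderiv_eq, ez.self_of_nhds,
      _root_.fderiv_fun_neg, fderiv_fun_const, map_zero, map_neg, neg_apply, Pi.zero_apply,
      zero_apply, sub_zero, zero_sub, add_zero, zero_add, sub_neg_eq_add] at f1 f2 g1 g2
    have k1 : (bracket L.conj (fun x => ((T x).2, 0)) q).1 = -(bracket T L q).2 :=
      chartDeriv_injective hc (by rw [f1, map_neg, g2]; abel)
    have k2 : (bracket L.conj (fun x => ((T x).2, 0)) q).2 = -(bracket T L q).1 :=
      chartDeriv_injective hc (by rw [f2, map_neg, g1]; abel)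
    have hd : fderiv ℝ (inChart E q ρ) (chartAt E q q) (Complex.I • chartDeriv q q (T q).2) = 1 := by
      rw [← chartDeriv_J hc, ← hρ.mfderiv_apply hc]
      exact hη q ⟨hq.1, hqU⟩
    have hVt := (hρ.mem_tangentOf hq.1 hc).1 (hT.tangent q ⟨hq.1, hqU⟩).2
    -- Modulo the complex tangent space a tangent vector `v` is `dρ(J v)` times the frame. Applied
    -- to both components of `[T, L]`, this matches `[conj L, V]` with `-conj (σ(L))` times the
    -- frame.
    have hm : ∀ v ∈ tangentOf M q, -v - (-fderiv ℝ (inChart E q ρ) (chartAt E q q)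
        (Complex.I • chartDeriv q q v)) • (T q).2 ∈ complexTangentOf M q := by
      intro v hv
      rw [hρ.mem_tangentOf hq.1 hc] at hv
      rw [hρ.mem_complexTangentOf hq.1 hc, holoD_eq_zero_iff, map_sub, map_neg, map_smul, smul_sub,
        smul_neg, real_smul_I]
      simp only [map_sub, map_neg, map_smul, hv, hVt, hd]
      simp
    rw [hρ.pair_eq hq.1 hc (agreesNear_defForm M ρ q) hbr]
    constructor
    · have := hm _ hbr.2
      rw [← k1] at this
      simpa using this
    · have := hm _ hbr.1
      rw [← k2] at this
      simpa using this
  · obtain ⟨W, hW, hMW, hWs⟩ := hh.smooth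
    have hqW : q ∈ U ∩ W := ⟨hU' hq.2, hMW hq.1⟩
    have hs := hT.smooth.2.mono (inter_subset_left : U ∩ W ⊆ U)
    have h1 := (hWs (U ∩ W) inter_subset_right (hU.inter hW) _ _ hs hs).contMDiffAt
      ((hU.inter hW).mem_nhds hqW)
    have h2 : ContMDiffAt 𝓘(ℝ, E) 𝓘(ℝ, ℂ) ∞
        (fun x => ((h x (T x).2 (T x).2 : ℝ) : ℂ)) q :=
      Complex.ofRealCLM.contMDiff.contMDiffAt.comp q h1
    -- The frame has length one along `M`, so the left side of the metric condition is zero and the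
    -- two connection terms cancel.
    rw [hρ.dirDeriv_eq_zero hq.1 h2 (k := 1) ?_ (hL.mem q hq).1, (hconj U' L hU' hL q hq).1,
      (hconj U' L hU' hL q hq).2, hV1 q ⟨hq.1, hU' hq.2⟩]
    · simp
    · filter_upwards [hU.mem_nhds (hU' hq.2)] with x hx hxM
      rw [hV1 x ⟨hxM, hx⟩, Complex.ofReal_one]

/-- Positive leafwise curvature in terms of a normalized equation of `M`. -/
theorem IsEquation.strictAt_zero [FiniteDimensional ℝ E] (hρ : IsEquation E M ρ)
    {h : BilinField E X} (hh : IsNormalMetric M h) (hpos : HasPositiveLeafwiseCurvature M h)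
    (hnorm : ∀ q ∈ M, ∀ v ∈ tangentOf M q, mfderiv 𝓘(ℝ, E) 𝓘(ℝ, ℝ) ρ q (J q v) = (1 : ℝ) →
      h q v v = 1) (hp : p ∈ M) (hc : p ∈ (chartAt E c).source)
    (hf : IsFlatPoint (inChart E c ρ) (chartAt E c p)) :
    StrictAt 0 (inChart E c ρ) (chartAt E c p) := by
  have hη := agreesNear_defForm (E := E) M ρ p
  intro a n ha h0 h1
  obtain ⟨U, T, σ, L, hU, hpU, hT0, hT, hσ, hL, hLa, hTn⟩ := hρ.exists_dangelo hc hη h0 h1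
  obtain ⟨e1, -, -, e4⟩ := hρ.dfForm_eq hp hc hη hf (γ := 0) hT hσ hL hpU
  rw [hLa, hTn] at e1
  rw [← e1, dfForm]
  have := hpos p hp U _ _ L hpU (hρ.isLeafwiseChernForm hh hnorm hU hT (fun q hq => (hT0 q hq).1) hσ)
    hL (e4.2 (by rwa [hLa]))
  rw [hρ.extD_subConj hp hσ.smooth hL hpU] at this
  simp only [zero_div, zero_mul, sub_zero]
  linarith

end Chern

/-! ### Global equations and defining functions -/

section Global

lemma eventually_neg_of_fderiv_neg {E : Type*} [NormedAddCommGroup E] [NormedSpace ℝ E]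
    {f : E → ℝ} {x u : E} (hf : DifferentiableAt ℝ f x) (hx : f x = 0) (hu : fderiv ℝ f x u < 0) :
    ∀ᶠ t in 𝓝[>] (0 : ℝ), f (x + t • u) < 0 := by
  have h1 : HasDerivAt (fun t : ℝ => x + t • u) u 0 := by
    simpa using ((hasDerivAt_id (0 : ℝ)).smul_const u).const_add x
  have h2 : HasDerivAt (fun t : ℝ => f (x + t • u)) (fderiv ℝ f x u) 0 :=
    HasFDerivAt.comp_hasDerivAt (0 : ℝ) (f := fun t : ℝ => x + t • u)
      (by simpa using hf.hasFDerivAt) h1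
  have h3 := (hasDerivAt_iff_tendsto_slope.1 h2).mono_left
    (nhdsWithin_mono 0 fun t (ht : (0 : ℝ) < t) => ne_of_gt ht)
  filter_upwards [h3.eventually_lt_const hu, self_mem_nhdsWithin] with t ht ht0
  rw [slope_def_field, sub_zero, zero_smul, add_zero, hx, sub_zero, div_neg_iff] at ht
  exact (ht.resolve_left fun h => absurd h.2 (not_lt.2 (le_of_lt ht0))).1

variable {E : Type*} [NormedAddCommGroup E] [NormedSpace ℂ E] [FiniteDimensional ℝ E]
  {X : Type*} [TopologicalSpace X] [ChartedSpace E X] [IsManifold 𝓘(ℂ, E) ω X]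
  {M Ω : Set X} {ρ : X → ℝ} {c p : X}

lemma IsDefiningFunction.isOpen (h : IsDefiningFunction E Ω ρ) : IsOpen Ω := by
  rw [h.eq_sublevel]
  exact isOpen_lt h.smooth.continuous continuous_const

lemma IsDefiningFunction.eq_zero (h : IsDefiningFunction E Ω ρ) (hp : p ∈ frontier Ω) :
    ρ p = 0 := by
  have h1 : p ∉ Ω := by
    have := hp.2
    rwa [h.isOpen.interior_eq] at this
  have h2 : p ∈ {q | ρ q ≤ 0} := by
    refine closure_minimal ?_ (isClosed_le h.smooth.continuous continuous_const) hp.1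
    intro q hq
    rw [h.eq_sublevel] at hq
    exact le_of_lt (show ρ q < 0 from hq)
  refine le_antisymm h2 (not_lt.1 fun h3 => h1 ?_)
  rw [h.eq_sublevel]
  exact h3

/-- Zeros of `ρ` close to the boundary are still regular, hence limits of points with `ρ < 0`. They
lie in the closure of `Ω` but not in `Ω`. -/
lemma IsDefiningFunction.isEquation [CompleteSpace E] (h : IsDefiningFunction E Ω ρ) :
    IsEquation E (frontier Ω) ρ where
  smooth := h.smooth
  zero p hp := h.eq_zero hp
  regular := h.regular
  mem p hp := by
    have hc := mem_chart_source E p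
    have hs : ∀ y ∈ (chartAt E p).target, ContDiffAt ℝ ∞ (inChart E p ρ) y := fun y hy =>
      contDiffAt_comp_chart hy (h.smooth _)
    have hx := (chartAt E p).map_source hc
    have h0 : fderiv ℝ (inChart E p ρ) (chartAt E p p) ≠ 0 := fun h0 => h.regular p hp (by
      ext v
      rw [mfderiv_eq_fderiv_chart hc ((h.smooth p).mdifferentiableAt (by simp)), h0]
      rfl)
    have hcont : ContinuousAt (fderiv ℝ (inChart E p ρ)) (chartAt E p p) :=
      ((hs _ hx).fderiv_right (m := 0) (by simp)).continuousAt
    refine eventually_of_chart hc ?_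
    filter_upwards [hcont.eventually_ne h0, (chartAt E p).open_target.mem_nhds hx] with y hy hyt hy0
    have hreg : IsRegularPoint (inChart E p ρ) y := ⟨(hs y hyt).of_le (by norm_cast), hy0, hy⟩
    refine ⟨?_, fun hi => ?_⟩
    · rw [mem_closure_iff_frequently]
      refine ((chartAt E p).continuousAt_symm hyt).frequently
        ((frequently_neg hreg).mono fun z hz => ?_)
      rw [h.eq_sublevel]
      exact hz
    · have := interior_subset hi
      rw [h.eq_sublevel] at this
      exact absurd hy0 (ne_of_lt this)

/-- The differential of a real function. -/
def realDiff (E : Type*) [NormedAddCommGroup E] [NormedSpace ℂ E]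
    {X : Type*} [TopologicalSpace X] [ChartedSpace E X] (ρ : X → ℝ) (q : X) :
    TangentSpace 𝓘(ℝ, E) q →L[ℝ] ℝ := mfderiv 𝓘(ℝ, E) 𝓘(ℝ, ℝ) ρ q

lemma IsEquation.realDiff_exp_mul [CompleteSpace E] (hρ : IsEquation E M ρ) {f : X → ℝ}
    (hf : ContMDiff 𝓘(ℝ, E) 𝓘(ℝ, ℝ) ∞ f) (hp : p ∈ M) (v : TangentSpace 𝓘(ℝ, E) p) :
    realDiff E (fun q => Real.exp (f q) * ρ q) p v = Real.exp (f p) * realDiff E ρ p v := by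
  have hc := mem_chart_source E p
  have hs : ContMDiff 𝓘(ℝ, E) 𝓘(ℝ, ℝ) ∞ fun q => Real.exp (f q) * ρ q :=
    (Real.contDiff_exp.contMDiff.comp hf).mul hρ.smooth
  have h' : realDiff E ρ p v = _ := hρ.mfderiv_apply hc v
  refine (mfderiv_eq_fderiv_chart hc ((hs p).mdifferentiableAt (by simp)) v).trans ?_
  rw [h']
  have h := fderiv_exp_mul (r := inChart E p ρ) (g := inChart E p f) (y := chartAt E p p)
    ((contDiffAt_inChart hc (hρ.smooth p)).differentiableAt (by simp))
    ((contDiffAt_inChart hc (hf p)).differentiableAt (by simp))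
  have h0 : inChart E p ρ (chartAt E p p) = 0 := (hρ.isRegularPoint hp hc).zero
  rw [h0, zero_mul, zero_smul, add_zero] at h
  have h1 : inChart E p f (chartAt E p p) = f p := by simp [(chartAt E p).left_inv hc]
  rw [h1] at h
  exact congrArg (fun φ : E →L[ℝ] ℝ => φ (chartDeriv p p v)) h

lemma IsEquation.exp_mul [CompleteSpace E] (hρ : IsEquation E M ρ) {f : X → ℝ}
    (hf : ContMDiff 𝓘(ℝ, E) 𝓘(ℝ, ℝ) ∞ f) : IsEquation E M (fun q => Real.exp (f q) * ρ q) where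
  smooth := (Real.contDiff_exp.contMDiff.comp hf).mul hρ.smooth
  zero p hp := by rw [hρ.zero p hp, mul_zero]
  regular p hp h := hρ.regular p hp (by
    ext v
    have := hρ.realDiff_exp_mul hf hp v
    rw [realDiff, h] at this
    exact (mul_eq_zero.1 this.symm).resolve_left (Real.exp_ne_zero _))
  mem p hp := (hρ.mem p hp).mono fun q h hq => h (exp_mul_eq_zero.1 hq)

lemma IsDefiningFunction.exp_mul [CompleteSpace E] (h : IsDefiningFunction E Ω ρ) {f : X → ℝ}
    (hf : ContMDiff 𝓘(ℝ, E) 𝓘(ℝ, ℝ) ∞ f) :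
    IsDefiningFunction E Ω (fun q => Real.exp (f q) * ρ q) where
  smooth := (Real.contDiff_exp.contMDiff.comp hf).mul h.smooth
  eq_sublevel := by
    rw [h.eq_sublevel]
    ext q
    refine ⟨fun hq => mul_neg_of_pos_of_neg (Real.exp_pos _) hq, fun hq => ?_⟩
    exact (pos_iff_neg_of_mul_neg hq).1 (Real.exp_pos _)
  regular := (h.isEquation.exp_mul hf).regular

variable [T2Space X] [SigmaCompactSpace X]

/-- Smooth functions on a closed set extend. -/
lemma exists_smooth_extension (hM : IsClosed M) {F : X → ℝ}
    (hF : ∀ p ∈ M, ∃ g : X → ℝ,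
      ∀ᶠ q in 𝓝 p, ContMDiffAt 𝓘(ℝ, E) 𝓘(ℝ, ℝ) ∞ g q ∧ (q ∈ M → g q = F q)) :
    ∃ f : X → ℝ, ContMDiff 𝓘(ℝ, E) 𝓘(ℝ, ℝ) ∞ f ∧ ∀ p ∈ M, f p = F p := by
  obtain ⟨f, hf⟩ := exists_contMDiffMap_forall_mem_convex_of_local 𝓘(ℝ, E) (n := ⊤)
    -- The set of allowed values is a point on `M` and the whole line elsewhere, convex in both
    -- cases, so local extensions can be averaged.
    (t := fun q => {y : ℝ | q ∈ M → y = F q}) (fun q => by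
      by_cases hq : q ∈ M
      · simp [hq]
      · simp [hq, convex_univ]) (fun p => by
      by_cases hp : p ∈ M
      · obtain ⟨g, hg⟩ := hF p hp
        exact ⟨_, hg, g, fun y hy => hy.1.contMDiffWithinAt, fun y hy => hy.2⟩
      · exact ⟨Mᶜ, hM.isOpen_compl.mem_nhds hp, fun _ => 0, contMDiffOn_const,
          fun y hy hy' => absurd hy' hy⟩)
  exact ⟨f, f.contMDiff, fun p hp => hf p hp⟩

/-- A domain with smooth boundary has a global defining function. -/
theorem HasSmoothBoundary.exists_isDefiningFunction [CompleteSpace E] (hΩ : IsOpen Ω)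
    (h : HasSmoothBoundary E Ω) : ∃ ρ : X → ℝ, IsDefiningFunction E Ω ρ := by
  have hloc : ∀ x : X, ∃ (U : Set X) (g : X → ℝ), IsOpen U ∧ x ∈ U ∧
      ContMDiffOn 𝓘(ℝ, E) 𝓘(ℝ, ℝ) ∞ g U ∧ (∀ q ∈ U, q ∈ Ω ↔ g q < 0) ∧
      ∀ q ∈ U, q ∈ frontier Ω → mfderiv 𝓘(ℝ, E) 𝓘(ℝ, ℝ) g q ≠ 0 := by
    intro x
    by_cases hx : x ∈ frontier Ω
    · obtain ⟨U, r, hU, hxU, hr, hdr, hs⟩ := h x hx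
      have hc := mem_chart_source E x
      have hra : ∀ q ∈ U, ContMDiffAt 𝓘(ℝ, E) 𝓘(ℝ, ℝ) ∞ r q := fun q hq =>
        hr.contMDiffAt (hU.mem_nhds hq)
      have h0 : fderiv ℝ (inChart E x r) (chartAt E x x) ≠ 0 := fun h0 => hdr (by
        ext v
        rw [mfderiv_eq_fderiv_chart hc ((hra x hxU).mdifferentiableAt (by simp)), h0]
        rfl)
      have hcont : ContinuousAt (fderiv ℝ (inChart E x r)) (chartAt E x x) :=
        ((contDiffAt_inChart hc (hra x hxU)).fderiv_right (m := 0) (by simp)).continuousAt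
      have hev : ∀ᶠ q in 𝓝 x, q ∈ U ∧ mfderiv 𝓘(ℝ, E) 𝓘(ℝ, ℝ) r q ≠ 0 := by
        filter_upwards [hU.mem_nhds hxU, (chartAt E x).open_source.mem_nhds hc,
          ((chartAt E x).continuousAt hc).eventually (hcont.eventually_ne h0)] with q hq hqc hq0
        refine ⟨hq, fun hd => hq0 ?_⟩
        ext v
        obtain ⟨w, rfl⟩ := chartDeriv_surjective hqc v
        rw [← mfderiv_eq_fderiv_chart hqc ((hra q hq).mdifferentiableAt (by simp)), hd]
        rfl
      obtain ⟨U', hU', hU'o, hxU'⟩ := eventually_nhds_iff.1 hev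
      exact ⟨U', r, hU'o, hxU', hr.mono fun q hq => (hU' q hq).1,
        fun q hq => hs q (hU' q hq).1, fun q hq _ => (hU' q hq).2⟩
    · by_cases hxΩ : x ∈ Ω
      · exact ⟨Ω, fun _ => -1, hΩ, hxΩ, contMDiffOn_const, fun q hq => by simp [hq],
          fun q hq hqf => absurd hq (hΩ.interior_eq ▸ hqf.2)⟩
      · have hxc : x ∉ closure Ω := fun hxc => hx ⟨hxc, by rwa [hΩ.interior_eq]⟩
        exact ⟨(closure Ω)ᶜ, fun _ => 1, isClosed_closure.isOpen_compl, hxc, contMDiffOn_const,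
          fun q hq =>
            ⟨fun hq' => absurd (subset_closure hq') hq, fun hq' => absurd hq' (by norm_num)⟩,
          fun q hq hqf => absurd hqf.1 hq⟩
  choose U g hU hxU hg hgs hgd using hloc
  obtain ⟨f, hf⟩ := SmoothPartitionOfUnity.exists_isSubordinate 𝓘(ℝ, E) isClosed_univ U hU
    fun x _ => mem_iUnion.2 ⟨x, hxU x⟩
  have hfU : ∀ (i x : X), f i x ≠ 0 → x ∈ U i := fun i x hx => hf i (subset_tsupport _ hx)
  set ρ : X → ℝ := fun x => ∑ᶠ i, f i x • g i x with hρ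
  have hsm : ContMDiff 𝓘(ℝ, E) 𝓘(ℝ, ℝ) ∞ ρ := f.contMDiff_finsum_smul (n := ⊤) fun i x hx =>
    (hg i).contMDiffAt ((hU i).mem_nhds (hf i hx))
  have hneg : ∀ x ∈ Ω, ρ x < 0 := fun x hx =>
    f.finsum_smul_mem_convex (g := g) (t := Iio 0) (mem_univ x)
      (fun i hi => (hgs i x (hfU i x hi)).1 hx) (convex_Iio 0)
  have hpos : ∀ x, x ∉ Ω → 0 ≤ ρ x := fun x hx =>
    f.finsum_smul_mem_convex (g := g) (t := Ici 0) (mem_univ x)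
      (fun i hi => not_lt.1 fun h0 => hx ((hgs i x (hfU i x hi)).2 h0)) (convex_Ici 0)
  have hsub : Ω = {q | ρ q < 0} := by
    ext q
    exact ⟨hneg q, fun hq => by_contra fun hq' => absurd hq (not_lt.2 (hpos q hq'))⟩
  -- On `Ω` all terms of the sum are nonpositive, so each one bounds `ρ` from above.
  have hle : ∀ x ∈ Ω, ∀ i, ρ x ≤ f i x * g i x := by
    intro x hx i
    have hfin : Function.HasFiniteSupport fun j => -(f j x • g j x) := by
      refine (f.locallyFinite.point_finite x).subset fun j hj => ?_
      simp only [Function.mem_support, ne_eq, neg_eq_zero, smul_eq_mul, mul_eq_zero, not_or] at hj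
      exact hj.1
    have := single_le_finsum i hfin fun j => by
      by_cases hj : f j x = 0
      · simp [hj]
      · rw [smul_eq_mul, neg_nonneg]
        exact mul_nonpos_of_nonneg_of_nonpos (f.nonneg j x)
          (le_of_lt ((hgs j x (hfU j x hj)).1 hx))
    rw [finsum_neg_distrib] at this
    exact neg_le_neg_iff.1 this
  refine ⟨ρ, hsm, hsub, fun p hp hd => ?_⟩
  have hpΩ : p ∉ Ω := by
    have := hp.2
    rwa [hΩ.interior_eq] at this
  obtain ⟨i, hi⟩ := f.exists_pos_of_mem (mem_univ p)
  have hpU := hfU i p hi.ne'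
  have hgp := (hg i).contMDiffAt ((hU i).mem_nhds hpU)
  have hfp : ContMDiffAt 𝓘(ℝ, E) 𝓘(ℝ, ℝ) ∞ (f i) p := (f i).contMDiff.contMDiffAt
  have hc := mem_chart_source E p
  have hx := (chartAt E p).map_source hc
  have hl := (chartAt E p).left_inv hc
  have hz : ∀ k : X → ℝ, ContMDiffAt 𝓘(ℝ, E) 𝓘(ℝ, ℝ) ∞ k p → (∀ᶠ q in 𝓝 p, q ∈ Ω → k q < 0) →
      (p ∉ Ω → 0 ≤ k p) → k p = 0 := by
    intro k hk hk1 hk2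
    refine le_antisymm ?_ (hk2 hpΩ)
    have hfr : ∃ᶠ q in 𝓝 p, q ∈ Ω := mem_closure_iff_frequently.1 hp.1
    refine le_of_tendsto_of_frequently hk.continuousAt ((hfr.and_eventually hk1).mono ?_)
    exact fun q hq => le_of_lt (hq.2 hq.1)
  have hg0 : g i p = 0 := hz (g i) hgp
    (by filter_upwards [(hU i).mem_nhds hpU] with q hq using (hgs i q hq).1)
    fun _ => not_lt.1 fun h0 => hpΩ ((hgs i p hpU).2 h0)
  have hρ0 : ρ p = 0 := hz ρ (hsm p) (Filter.Eventually.of_forall hneg) (hpos p)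
  set G := inChart E p (g i) with hG
  set F := inChart E p (f i) with hF
  set R := inChart E p ρ with hR
  have hGd : DifferentiableAt ℝ G (chartAt E p p) :=
    (contDiffAt_inChart hc hgp).differentiableAt (by simp)
  have hFd : DifferentiableAt ℝ F (chartAt E p p) :=
    (contDiffAt_inChart hc hfp).differentiableAt (by simp)
  have hRd : DifferentiableAt ℝ R (chartAt E p p) :=
    (contDiffAt_inChart hc (hsm p)).differentiableAt (by simp)
  have hG0 : G (chartAt E p p) = 0 := by rw [hG, inChart, Function.comp_apply, hl, hg0]
  have hF0 : F (chartAt E p p) = f i p := by rw [hF, inChart, Function.comp_apply, hl]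
  have hR0 : R (chartAt E p p) = 0 := by rw [hR, inChart, Function.comp_apply, hl, hρ0]
  have hR' : fderiv ℝ R (chartAt E p p) = 0 := by
    ext v
    obtain ⟨w, rfl⟩ := chartDeriv_surjective hc v
    rw [← mfderiv_eq_fderiv_chart hc ((hsm p).mdifferentiableAt (by simp)), hd]
    rfl
  obtain ⟨u, hu⟩ : ∃ u, fderiv ℝ G (chartAt E p p) u < 0 := by
    by_contra! hcon
    refine hgd i p hpU hp ?_
    ext v
    rw [mfderiv_eq_fderiv_chart hc (hgp.mdifferentiableAt (by simp))]
    refine le_antisymm (α := ℝ) ?_ (hcon _)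
    have := hcon (-chartDeriv p p v)
    rw [map_neg] at this
    exact neg_nonneg.1 this
  -- If `dρ` vanished at `p`, then moving in a direction where `g i` decreases would enter `Ω` and
  -- make `f i * g i - ρ` negative, against the bound above.
  have hD : HasFDerivAt (fun y => F y * G y - R y) (f i p • fderiv ℝ G (chartAt E p p))
      (chartAt E p p) := by
    have := (hFd.hasFDerivAt.mul hGd.hasFDerivAt).sub hRd.hasFDerivAt
    rw [hG0, hR', hF0, zero_smul, add_zero, sub_zero] at this
    exact this
  have e1 := eventually_neg_of_fderiv_neg hGd hG0 hu
  have e2 := eventually_neg_of_fderiv_neg hD.differentiableAt (by rw [hG0, hR0]; ring)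
    (u := u) (by rw [hD.fderiv]; exact mul_neg_of_pos_of_neg hi hu)
  have e3 : ∀ᶠ t in 𝓝[>] (0 : ℝ), (chartAt E p).symm (chartAt E p p + t • u) ∈ U i := by
    have ht : Filter.Tendsto (fun t : ℝ => chartAt E p p + t • u) (𝓝[>] 0)
        (𝓝 (chartAt E p p)) := by
      refine Filter.Tendsto.mono_left ?_ nhdsWithin_le_nhds
      have : ContinuousAt (fun t : ℝ => chartAt E p p + t • u) 0 := by fun_prop
      simpa [ContinuousAt] using this
    exact ht.eventually ((eventually_chart hc ((hU i).mem_nhds hpU)).mono fun y hy => hy.2)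
  obtain ⟨t, h1, h2, h3⟩ := (e1.and (e2.and e3)).exists
  have h4 := hle _ ((hgs i _ h3).2 h1) i
  exact absurd h2 (not_lt.2 (sub_nonneg.2 h4))

end Global

/-! ### Equations adapted to trivializations and metrics, and the comparison of the indices -/

section Adapted

variable {E : Type*} [NormedAddCommGroup E] [NormedSpace ℂ E] [FiniteDimensional ℝ E]
  [CompleteSpace E] {X : Type*} [TopologicalSpace X] [ChartedSpace E X] [IsManifold 𝓘(ℂ, E) ω X]
  {M Ω : Set X} {ρ : X → ℝ} {c p : X}

lemma defForm_eq (ρ : X → ℝ) (q : X) (v : TangentSpace 𝓘(ℝ, E) q) :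
    defForm E ρ q v = -Complex.I * (realDiff E ρ q (J q v) : ℂ) := rfl

lemma defForm_neg (ρ : X → ℝ) (q : X) (v : TangentSpace 𝓘(ℝ, E) q) :
    defForm E (fun x => -ρ x) q v = -defForm E ρ q v := by
  have e : realDiff E (fun x => -ρ x) q = -realDiff E ρ q := mfderiv_neg
  rw [defForm_eq, defForm_eq, e, neg_apply, Complex.ofReal_neg, mul_neg]

lemma IsEquation.realDiff_eq_zero (hρ : IsEquation E M ρ) {v : TangentSpace 𝓘(ℝ, E) p}
    (hv : v ∈ tangentOf M p) : realDiff E ρ p v = 0 :=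
  hv univ ρ isOpen_univ (mem_univ p) hρ.smooth.contMDiffOn fun x hx => hρ.zero x hx.1

/-- The normal line `T_p M` modulo complex tangent vectors has coordinate `dρ(J v)`. Trivializations
and normal metrics are thus determined by their values on one normalized vector. -/
lemma IsEquation.sub_smul_mem (hρ : IsEquation E M ρ) (hp : p ∈ M)
    {v w : TangentSpace 𝓘(ℝ, E) p} (hv : v ∈ tangentOf M p) (hw : w ∈ tangentOf M p)
    (hw1 : realDiff E ρ p (J p w) = 1) :
    v - realDiff E ρ p (J p v) • w ∈ complexTangentOf M p := by
  have hc := mem_chart_source E p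
  have e : ∀ u : TangentSpace 𝓘(ℝ, E) p, realDiff E ρ p (J p u)
      = fderiv ℝ (inChart E p ρ) (chartAt E p p) (Complex.I • chartDeriv p p u) := by
    intro u
    rw [← chartDeriv_J hc]
    exact hρ.mfderiv_apply hc _
  rw [e] at hw1
  rw [hρ.mem_tangentOf hp hc] at hv hw
  rw [hρ.mem_complexTangentOf hp hc, holoD_eq_zero_iff, map_sub, map_smul, smul_sub, real_smul_I, e]
  simp [hv, hw, hw1]

lemma not_mem_complexTangentOf (hρ : IsEquation E M ρ) {v : TangentSpace 𝓘(ℝ, E) p}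
    (hv : realDiff E ρ p (J p v) = 1) : v ∉ complexTangentOf M p := fun h => by
  rw [hρ.realDiff_eq_zero h.2] at hv
  exact zero_ne_one hv

lemma IsEquation.exists_field (hdim : Module.finrank ℂ E = 2) (hρ : IsEquation E M ρ)
    (hp : p ∈ M) : ∃ (U : Set X) (b : (q : X) → TangentSpace 𝓘(ℝ, E) q), IsOpen U ∧ p ∈ U ∧
      SmoothField U b ∧ ∀ q ∈ M ∩ U, b q ∈ tangentOf M q ∧ realDiff E ρ q (J q (b q)) = 1 := by
  have hc := mem_chart_source E p
  obtain ⟨a, n, -, ha, hn, -⟩ := exists_frame hdim (hρ.isRegularPoint hp hc).regular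
  obtain ⟨U, T, -, -, hU, hpU, -, hT, -⟩ :=
    hρ.exists_dangelo hc (agreesNear_defForm M ρ p) ha hn
  refine ⟨U, fun q => (T q).2, hU, hpU, hT.smooth.2, fun q hq => ⟨(hT.tangent q hq).2, ?_⟩⟩
  have h1 := hT.normalized q hq
  rw [pair, hT.imaginary q hq, map_zero, defForm_eq, zero_add, ← mul_assoc, mul_neg,
    Complex.I_mul_I, neg_neg, one_mul] at h1
  exact Complex.ofReal_injective h1

variable [T2Space X] [SigmaCompactSpace X]

/-- A function of the normalized tangent vectors, smooth on smooth fields, comes from a smooth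
function on `X`. -/
lemma IsEquation.exists_function (hdim : Module.finrank ℂ E = 2) (hρ : IsEquation E M ρ)
    (hM : IsClosed M) {G : (q : X) → TangentSpace 𝓘(ℝ, E) q → ℝ}
    (hG : ∀ p ∈ M, ∀ (U : Set X) (b : (q : X) → TangentSpace 𝓘(ℝ, E) q), IsOpen U → p ∈ U →
      SmoothField U b → b p ∈ tangentOf M p → realDiff E ρ p (J p (b p)) = 1 →
      ∀ᶠ q in 𝓝 p, ContMDiffAt 𝓘(ℝ, E) 𝓘(ℝ, ℝ) ∞ (fun x => G x (b x)) q)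
    (hG' : ∀ p ∈ M, ∀ v ∈ tangentOf M p, ∀ w ∈ tangentOf M p, realDiff E ρ p (J p v) = 1 →
      realDiff E ρ p (J p w) = 1 → G p v = G p w) :
    ∃ f : X → ℝ, ContMDiff 𝓘(ℝ, E) 𝓘(ℝ, ℝ) ∞ f ∧ ∀ p ∈ M, ∀ v ∈ tangentOf M p,
      realDiff E ρ p (J p v) = 1 → f p = G p v := by
  have hex : ∀ q : X, ∃ v : TangentSpace 𝓘(ℝ, E) q, q ∈ M →
      v ∈ tangentOf M q ∧ realDiff E ρ q (J q v) = 1 := by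
    intro q
    by_cases hq : q ∈ M
    · obtain ⟨U, b, -, hqU, -, hb⟩ := hρ.exists_field hdim hq
      exact ⟨b q, fun _ => hb q ⟨hq, hqU⟩⟩
    · exact ⟨0, fun h => absurd h hq⟩
  choose β hβ using hex
  obtain ⟨f, hf, hfF⟩ := exists_smooth_extension (E := E) hM (F := fun q => G q (β q)) (by
    intro p hp
    obtain ⟨U, b, hU, hpU, hb, hbn⟩ := hρ.exists_field hdim hp
    refine ⟨fun q => G q (b q), ?_⟩
    filter_upwards [hG p hp U b hU hpU hb (hbn p ⟨hp, hpU⟩).1 (hbn p ⟨hp, hpU⟩).2,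
      hU.mem_nhds hpU] with q h1 hq
    refine ⟨h1, fun hqM => ?_⟩
    have h2 := hbn q ⟨hqM, hq⟩
    have h3 := hβ q hqM
    exact hG' q hqM _ h2.1 _ h3.1 h2.2 h3.2)
  refine ⟨f, hf, fun p hp v hv hv1 => ?_⟩
  rw [hfF p hp]
  exact hG' p hp _ (hβ p hp).1 _ hv (hβ p hp).2 hv1

lemma contMDiffAt_log_of_contMDiffOn {U : Set X} (hU : IsOpen U) (hp : p ∈ U) {u : X → ℝ}
    (hu : ContMDiffOn 𝓘(ℝ, E) 𝓘(ℝ, ℝ) ∞ u U) (h0 : u p ≠ 0) :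
    ∀ᶠ q in 𝓝 p, ContMDiffAt 𝓘(ℝ, E) 𝓘(ℝ, ℝ) ∞ (fun x => Real.log (u x)) q := by
  have hc := (hu.contMDiffAt (hU.mem_nhds hp)).continuousAt
  filter_upwards [hc.eventually_ne h0, hU.mem_nhds hp] with q hq hqU
  exact (Real.contDiffAt_log.2 hq).contMDiffAt.comp q (hu.contMDiffAt (hU.mem_nhds hqU))

/-- Every trivialization is, up to sign, the form of an equation of `M`. -/
theorem IsEquation.exists_of_trivialization (hdim : Module.finrank ℂ E = 2)
    (hρ : IsEquation E M ρ) (hM : IsClosed M) {η : CForm E X} (hη : IsTrivialization M η) :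
    ∃ f : X → ℝ, ContMDiff 𝓘(ℝ, E) 𝓘(ℝ, ℝ) ∞ f ∧ ∀ p ∈ M,
      AgreesNear M η (fun q => Real.exp (f q) * ρ q) p ∨
      AgreesNear M η (fun q => -(Real.exp (f q) * ρ q)) p := by
  obtain ⟨W, hW, hMW, hWs⟩ := hη.smooth
  have hdec : ∀ q ∈ M, ∀ v ∈ tangentOf M q, ∀ w ∈ tangentOf M q, realDiff E ρ q (J q w) = 1 →
      η q v = realDiff E ρ q (J q v) * η q w := by
    intro q hq v hv w hw hw1
    have := hη.annihilates q hq _ (hρ.sub_smul_mem hq hv hw hw1)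
    rw [map_sub, map_smul, sub_eq_zero] at this
    rw [this, Complex.real_smul]
  have hne : ∀ q ∈ M, ∀ w ∈ tangentOf M q, realDiff E ρ q (J q w) = 1 → (η q w).im ≠ 0 := by
    intro q hq w hw hw1 h0
    obtain ⟨v, hv, hv0⟩ := hη.nonvanishing q hq
    apply hv0
    rw [hdec q hq v hv w hw hw1, Complex.ext (hη.imaginary q hq w hw) h0 (w := 0), mul_zero]
  have hsm : ∀ (U : Set X) (b : (q : X) → TangentSpace 𝓘(ℝ, E) q), IsOpen U → SmoothField U b →
      ContMDiffOn 𝓘(ℝ, E) 𝓘(ℝ, ℝ) ∞ (fun x => (η x (b x)).im) (U ∩ W) := by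
    intro U b hU hb
    exact Complex.imCLM.contMDiff.comp_contMDiffOn
      (hWs (U ∩ W) inter_subset_right (hU.inter hW) b (hb.mono inter_subset_left))
  -- `Real.log` depends only on the absolute value, so `f` is smooth whatever the sign of `Im η`.
  -- That sign is locally constant on `M` but may differ between components, whence the alternative
  -- in the conclusion.
  obtain ⟨f, hf, hfG⟩ := hρ.exists_function hdim hM (G := fun q v => Real.log (η q v).im)
    (fun p hp U b hU hpU hb hbt hb1 => contMDiffAt_log_of_contMDiffOn (hU.inter hW)
      ⟨hpU, hMW hp⟩ (hsm U b hU hb) (hne p hp _ hbt hb1))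
    (fun p hp v hv w hw hv1 hw1 => by
      rw [hdec p hp v hv w hw hw1, hv1, Complex.ofReal_one, one_mul])
  refine ⟨f, hf, fun p hp => ?_⟩
  obtain ⟨U, b, hU, hpU, hb, hbn⟩ := hρ.exists_field hdim hp
  have hcont := ((hsm U b hU hb).contMDiffAt ((hU.inter hW).mem_nhds ⟨hpU, hMW hp⟩)).continuousAt
  have hformula : ∀ q ∈ M ∩ U, ∀ v ∈ tangentOf M q,
      η q v = (realDiff E ρ q (J q v) * (η q (b q)).im : ℝ) * Complex.I ∧
      defForm E (fun q => Real.exp (f q) * ρ q) q v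
        = -(realDiff E ρ q (J q v) * |(η q (b q)).im| : ℝ) * Complex.I := by
    intro q hq v hv
    obtain ⟨h1, h2⟩ := hbn q hq
    constructor
    · rw [hdec q hq.1 v hv _ h1 h2]
      apply Complex.ext <;> simp [hη.imaginary q hq.1 _ h1]
    · rw [defForm_eq, hρ.realDiff_exp_mul hf hq.1, hfG q hq.1 _ h1 h2,
        Real.exp_log_eq_abs (hne q hq.1 _ h1 h2)]
      push_cast
      ring
  have hp0 := hne p hp _ (hbn p ⟨hp, hpU⟩).1 (hbn p ⟨hp, hpU⟩).2
  rcases lt_or_gt_of_ne hp0 with h0 | h0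
  · left
    filter_upwards [hcont.eventually_lt_const h0, hU.mem_nhds hpU] with q hq hqU hqM v hv
    obtain ⟨h1, h2⟩ := hformula q ⟨hqM, hqU⟩ v hv
    rw [h1, h2, abs_of_neg hq]
    push_cast
    ring
  · right
    filter_upwards [hcont.eventually_const_lt h0, hU.mem_nhds hpU] with q hq hqU hqM v hv
    obtain ⟨h1, h2⟩ := hformula q ⟨hqM, hqU⟩ v hv
    rw [h1, defForm_neg, h2, abs_of_pos hq]
    ring

/-- Every metric of the normal bundle is normalized by an equation of `M`. -/
theorem IsEquation.exists_of_metric (hdim : Module.finrank ℂ E = 2)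
    (hρ : IsEquation E M ρ) (hM : IsClosed M) {h : BilinField E X} (hh : IsNormalMetric M h) :
    ∃ f : X → ℝ, ContMDiff 𝓘(ℝ, E) 𝓘(ℝ, ℝ) ∞ f ∧ ∀ q ∈ M, ∀ v ∈ tangentOf M q,
      realDiff E (fun q => Real.exp (f q) * ρ q) q (J q v) = 1 → h q v v = 1 := by
  obtain ⟨W, hW, hMW, hWs⟩ := hh.smooth
  have hdec : ∀ q ∈ M, ∀ v ∈ tangentOf M q, ∀ w ∈ tangentOf M q, realDiff E ρ q (J q w) = 1 →
      h q v v = realDiff E ρ q (J q v) ^ 2 * h q w w := by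
    intro q hq v hv w hw hw1
    have hd : ∀ u ∈ tangentOf M q, h q v u = realDiff E ρ q (J q v) * h q w u := by
      intro u hu
      have := hh.descends q hq _ (hρ.sub_smul_mem hq hv hw hw1) u hu
      rw [map_sub, map_smul, sub_apply, smul_apply, sub_eq_zero] at this
      exact this
    rw [hd v hv, hh.symm q hq w hw v hv, hd w hw]
    ring
  have hpos : ∀ q ∈ M, ∀ w ∈ tangentOf M q, realDiff E ρ q (J q w) = 1 → 0 < h q w w :=
    fun q hq w hw hw1 => hh.pos q hq w hw (not_mem_complexTangentOf hρ hw1)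
  -- Multiplying the equation by `exp f` shrinks normalized vectors by `exp (-f)`, and `h` is
  -- quadratic: hence half the logarithm.
  obtain ⟨f, hf, hfG⟩ := hρ.exists_function hdim hM (G := fun q v => Real.log (h q v v) / 2)
    (fun p hp U b hU hpU hb hbt hb1 => by
      have hs := hb.mono (inter_subset_left : U ∩ W ⊆ U)
      filter_upwards [contMDiffAt_log_of_contMDiffOn (hU.inter hW)
        ⟨hpU, hMW hp⟩ (hWs (U ∩ W) inter_subset_right (hU.inter hW) b b hs hs)
          (hpos p hp _ hbt hb1).ne'] with q hq
      exact ((contDiff_id.div_const (2 : ℝ)).contMDiff.contMDiffAt).comp q hq)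
    (fun p hp v hv w hw hv1 hw1 => by
      rw [hdec p hp v hv w hw hw1, hv1, one_pow, one_mul])
  refine ⟨f, hf, fun q hq v hv hv1 => ?_⟩
  obtain ⟨U, b, hU, hqU, hb, hbn⟩ := hρ.exists_field hdim hq
  obtain ⟨h1, h2⟩ := hbn q ⟨hq, hqU⟩
  rw [hρ.realDiff_exp_mul hf hq, hfG q hq _ h1 h2] at hv1
  have hb0 := hpos q hq _ h1 h2
  have he : Real.exp (Real.log (h q (b q) (b q)) / 2) ^ 2 = h q (b q) (b q) := by
    rw [← Real.exp_nat_mul, Nat.cast_ofNat, mul_div_cancel₀ _ (two_ne_zero' ℝ), Real.exp_log hb0]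
  rw [hdec q hq v hv _ h1 h2, ← he, ← mul_pow, mul_comm, hv1, one_pow]

end Adapted

/-! ### The boundary conditions for global equations -/

section Indices

variable {E : Type*} [NormedAddCommGroup E] [NormedSpace ℂ E] [FiniteDimensional ℝ E]
  [CompleteSpace E] {X : Type*} [TopologicalSpace X] [ChartedSpace E X] [IsManifold 𝓘(ℂ, E) ω X]
  {M Ω : Set X} {ρ : X → ℝ} {c p : X} {γ : ℝ}

/-- The strict boundary condition with exponent `γ` for the equation `ρ` of `M`. -/
def IsStrict (E : Type*) [NormedAddCommGroup E] [NormedSpace ℂ E]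
    {X : Type*} [TopologicalSpace X] [ChartedSpace E X] (M : Set X) (γ : ℝ) (ρ : X → ℝ) : Prop :=
  ∀ p ∈ M, ∀ c : X, p ∈ (chartAt E c).source → StrictAt γ (inChart E c ρ) (chartAt E c p)

/-- The weak boundary condition with exponent `γ` for the equation `ρ` of `M`. -/
def IsWeak (E : Type*) [NormedAddCommGroup E] [NormedSpace ℂ E]
    {X : Type*} [TopologicalSpace X] [ChartedSpace E X] (M : Set X) (γ : ℝ) (ρ : X → ℝ) : Prop :=
  ∀ p ∈ M, ∀ c : X, p ∈ (chartAt E c).source → WeakAt γ (inChart E c ρ) (chartAt E c p)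

variable (hdim : Module.finrank ℂ E = 2) (hρ : IsEquation E M ρ) (hflat : IsLeviFlat E M)
include hdim hρ hflat

/-- Both sides express the same chart-free condition on D'Angelo forms. -/
lemma IsEquation.strictAt_congr {c' : X} (hp : p ∈ M) (hc : p ∈ (chartAt E c).source)
    (hc' : p ∈ (chartAt E c').source) (h : StrictAt γ (inChart E c ρ) (chartAt E c p)) :
    StrictAt γ (inChart E c' ρ) (chartAt E c' p) :=
  (hρ.strictAt_iff hp hc' (agreesNear_defForm M ρ p) (hρ.isFlatPoint hdim hflat hp hc')).1
    ((hρ.strictAt_iff hp hc (agreesNear_defForm M ρ p) (hρ.isFlatPoint hdim hflat hp hc)).2 h)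

lemma IsEquation.isStrict_of_strongDF {η : CForm E X} (hη : IsTrivialization M η)
    (hA : ∀ p ∈ M, AgreesNear M η ρ p ∨ AgreesNear M η (fun q => -ρ q) p)
    (h : StrongDF M γ η) : IsStrict E M γ ρ := by
  intro p hp c hc
  have h' : ∀ (U : Set X) (T : CField E X) (σ : CForm E X) (L : CField E X), p ∈ U →
      IsTransversal M U η T → IsDAngeloForm M U η T σ → IsT10Section M U L →
      L p ≠ 0 → 0 < dfForm γ σ L p := fun U T σ L hpU hT hσ hL hL0 =>
    h p hp U T σ L hpU hT hσ hL (by rw [hflat η hη p hp]; exact hL.mem p ⟨hp, hpU⟩) hL0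
  rcases hA p hp with hA | hA
  · exact (hρ.strictAt_iff hp hc hA (hρ.isFlatPoint hdim hflat hp hc)).1 h'
  · exact ((hρ.neg.strictAt_iff hp hc hA (hρ.neg.isFlatPoint hdim hflat hp hc)).1 h').neg

lemma IsEquation.isWeak_of_weakDF {η : CForm E X} (hη : IsTrivialization M η)
    (hA : ∀ p ∈ M, AgreesNear M η ρ p ∨ AgreesNear M η (fun q => -ρ q) p)
    (h : WeakDF M γ η) : IsWeak E M γ ρ := by
  intro p hp c hc
  have h' : ∀ (U : Set X) (T : CField E X) (σ : CForm E X) (L : CField E X), p ∈ U →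
      IsTransversal M U η T → IsDAngeloForm M U η T σ → IsT10Section M U L →
      0 ≤ dfForm γ σ L p := fun U T σ L hpU hT hσ hL =>
    h p hp U T σ L hpU hT hσ hL (by rw [hflat η hη p hp]; exact hL.mem p ⟨hp, hpU⟩)
  rcases hA p hp with hA | hA
  · exact (hρ.weakAt_iff hp hc hA (hρ.isFlatPoint hdim hflat hp hc)).1 h'
  · exact ((hρ.neg.weakAt_iff hp hc hA (hρ.neg.isFlatPoint hdim hflat hp hc)).1 h').neg

lemma IsEquation.strongDF_of_isStrict (h : IsStrict E M γ ρ) : StrongDF M γ (defForm E ρ) := by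
  intro p hp U T σ L hpU hT hσ hL _ hL0
  have hc := mem_chart_source E p
  exact (hρ.strictAt_iff hp hc (agreesNear_defForm M ρ p) (hρ.isFlatPoint hdim hflat hp hc)).2
    (h p hp p hc) U T σ L hpU hT hσ hL hL0

lemma IsEquation.weakDF_of_isWeak (h : IsWeak E M γ ρ) : WeakDF M γ (defForm E ρ) := by
  intro p hp U T σ L hpU hT hσ hL _
  have hc := mem_chart_source E p
  exact (hρ.weakAt_iff hp hc (agreesNear_defForm M ρ p) (hρ.isFlatPoint hdim hflat hp hc)).2
    (h p hp p hc) U T σ L hpU hT hσ hL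

/-- On a compact hypersurface positivity for the exponent `0` extends to a positive exponent. -/
lemma IsEquation.exists_isStrict (hM : IsCompact M) (h : IsStrict E M 0 ρ) :
    ∃ γ : ℝ, 0 < γ ∧ γ < 1 ∧ IsStrict E M γ ρ := by
  have key : ∃ γ : ℝ, 0 < γ ∧ γ < 1 ∧ ∀ p ∈ M, p ∈ M → ∀ c : X, p ∈ (chartAt E c).source →
      StrictAt γ (inChart E c ρ) (chartAt E c p) := by
    refine hM.induction_on (p := fun s => ∃ γ : ℝ, 0 < γ ∧ γ < 1 ∧ ∀ p ∈ s, p ∈ M → ∀ c : X,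
      p ∈ (chartAt E c).source → StrictAt γ (inChart E c ρ) (chartAt E c p))
      ⟨1 / 2, by norm_num, by norm_num, fun p hp => absurd hp (notMem_empty p)⟩ ?_ ?_ ?_
    · rintro s t hst ⟨γ, h0, h1, h2⟩
      exact ⟨γ, h0, h1, fun p hp => h2 p (hst hp)⟩
    · rintro s t ⟨γ, h0, h1, h2⟩ ⟨γ', h0', h1', h2'⟩
      refine ⟨min γ γ', lt_min h0 h0', min_lt_of_left_lt h1, fun p hp hpM c hc => ?_⟩
      rcases hp with hp | hp
      · exact (h2 p hp hpM c hc).mono h1 (min_le_left _ _)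
      · exact (h2' p hp hpM c hc).mono h1' (min_le_right _ _)
    · intro p hp
      have hc := mem_chart_source E p
      obtain ⟨γ, h0, h1, h2⟩ := (hρ.isFlatPoint hdim hflat hp hc).exists_strictAt hdim (h p hp p hc)
      refine ⟨{q | q ∈ M → ∀ c : X, q ∈ (chartAt E c).source →
        StrictAt γ (inChart E c ρ) (chartAt E c q)}, mem_nhdsWithin_of_mem_nhds ?_,
        γ, h0, h1, fun q hq => hq⟩
      filter_upwards [((chartAt E p).continuousAt hc).eventually h2,
        -- Openness is available only in the chart at `p`; chart independence carries the inequality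
        -- to every other chart around `q`.
        (chartAt E p).open_source.mem_nhds hc] with q hq hqs hqM c' hc'
      refine hρ.strictAt_congr hdim hflat hqM hqs hc' (hq ?_)
      rw [inChart, Function.comp_apply, (chartAt E p).left_inv hqs, hρ.zero q hqM]
  obtain ⟨γ, h0, h1, h2⟩ := key
  exact ⟨γ, h0, h1, fun p hp => h2 p hp hp⟩

omit hdim hρ hflat [FiniteDimensional ℝ E] in
lemma complexHessian_neg_rpow (hρ : ContMDiff 𝓘(ℝ, E) 𝓘(ℝ, ℝ) ∞ ρ)
    (hc : p ∈ (chartAt E c).source) (hp : ρ p < 0) (v : E) :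
    complexHessian (fun q => -(-ρ q) ^ γ) p v = γ * (-ρ p) ^ (γ - 2)
      * ((-ρ p) * (leviK (inChart E c ρ) (chartAt E c p) (chartDeriv c p v)
        (chartDeriv c p v)).re
        + (1 - γ) * ‖holoD (inChart E c ρ) (chartAt E c p) (chartDeriv c p v)‖ ^ 2) / 4 := by
  have hs : ContMDiffAt 𝓘(ℝ, E) 𝓘(ℝ, ℝ) ∞ (fun q => -(-ρ q) ^ γ) p := by
    have h1 : ContDiffAt ℝ ∞ (fun t : ℝ => -(-t) ^ γ) (ρ p) :=
      ((contDiffAt_id.neg).rpow_const_of_ne (by simpa using hp.ne)).neg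
    exact h1.contMDiffAt.comp p (hρ p)
  have e : inChart E c ρ (chartAt E c p) = ρ p := by
    rw [inChart, Function.comp_apply, (chartAt E c).left_inv hc]
  have h2 := leviK_neg_rpow (r := inChart E c ρ) (y := chartAt E c p)
    ((contDiffAt_inChart hc (hρ p)).of_le (by norm_cast)) (by rwa [e]) γ (chartDeriv c p v)
  rw [e] at h2
  rw [complexHessian_eq_chart hc hs, ← h2]
  rfl

lemma IsEquation.exists_isStrictlyPSHOn (hΩ : Ω = {q | ρ q < 0}) (h0 : 0 < γ) (h1 : γ < 1)
    (h : IsStrict E M γ ρ) :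
    ∃ W : Set X, IsOpen W ∧ M ⊆ W ∧ IsStrictlyPSHOn E (fun q => -(-ρ q) ^ γ) (Ω ∩ W) := by
  refine ⟨interior {q | ρ q < 0 → ∀ v : E, v ≠ 0 → 0 < complexHessian (fun q => -(-ρ q) ^ γ) q v},
    isOpen_interior, fun p hp => ?_, fun q hq => ?_⟩
  · have hc := mem_chart_source E p
    rw [mem_interior_iff_mem_nhds]
    have key := (hρ.isFlatPoint hdim hflat hp hc).eventually_pos_of_strictAt hdim h1 (h p hp p hc)
    filter_upwards [((chartAt E p).continuousAt hc).eventually key,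
      (chartAt E p).open_source.mem_nhds hc] with q hq hqs hq0 v hv
    have e : inChart E p ρ (chartAt E p q) = ρ q := by
      rw [inChart, Function.comp_apply, (chartAt E p).left_inv hqs]
    rw [e] at hq
    rw [complexHessian_neg_rpow hρ.smooth hqs hq0 v]
    have h3 := hq hq0 (chartDeriv p q v) fun h' => hv ((chartDeriv_eq_zero_iff hqs).1 h')
    have h4 : 0 < (-ρ q) ^ (γ - 2) := Real.rpow_pos_of_pos (neg_pos.2 hq0) _
    exact div_pos (mul_pos (mul_pos h0 h4) h3) (by norm_num)
  · have := interior_subset hq.2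
    rw [hΩ] at hq
    exact this hq.1

lemma IsEquation.isWeak_of_isPSHOn (hΩ : Ω = {q | ρ q < 0}) (h0 : 0 < γ) (h1 : γ < 1)
    {W : Set X} (hW : IsOpen W) (hMW : M ⊆ W)
    (h : IsPSHOn E (fun q => -(-ρ q) ^ γ) (Ω ∩ W)) : IsWeak E M γ ρ := by
  intro p hp c hc
  refine (hρ.isFlatPoint hdim hflat hp hc).weakAt_of_eventually_nonneg h1 ?_
  filter_upwards [eventually_chart hc (hW.mem_nhds (hMW hp))] with y hy hy0 v
  obtain ⟨q, hq⟩ : ∃ q, q = (chartAt E c).symm y := ⟨_, rfl⟩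
  have hqs : q ∈ (chartAt E c).source := hq ▸ (chartAt E c).map_target hy.1
  have hqW : q ∈ W := hq ▸ hy.2
  obtain rfl : y = chartAt E c q := by rw [hq, (chartAt E c).right_inv hy.1]
  have e : inChart E c ρ (chartAt E c q) = ρ q := by
    rw [inChart, Function.comp_apply, (chartAt E c).left_inv hqs]
  rw [e] at hy0 ⊢
  obtain ⟨w, rfl⟩ := chartDeriv_surjective hqs v
  have h3 := h q ⟨by rw [hΩ]; exact hy0, hqW⟩ w
  rw [complexHessian_neg_rpow hρ.smooth hqs hy0 w] at h3
  have h4 : 0 < (-ρ q) ^ (γ - 2) := Real.rpow_pos_of_pos (neg_pos.2 hy0) _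
  have h5 := mul_nonneg h3 (by norm_num : (0 : ℝ) ≤ 4)
  rw [div_mul_cancel₀ _ (four_ne_zero' ℝ)] at h5
  exact (mul_nonneg_iff_of_pos_left (mul_pos h0 h4)).1 h5

/-- Interpolation between two equations. -/
lemma IsEquation.exists_isStrict_of_isWeak {g : X → ℝ} (hg : ContMDiff 𝓘(ℝ, E) 𝓘(ℝ, ℝ) ∞ g)
    {γ' γ₁ : ℝ} (hγ' : 0 < γ') (hγγ : γ' < γ) (hγ : γ < 1) (hγ₁ : 0 < γ₁) (hγ₁' : γ₁ < 1)
    (h0 : IsWeak E M γ ρ) (h1 : IsStrict E M γ₁ (fun q => Real.exp (g q) * ρ q)) :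
    ∃ ε : ℝ, IsStrict E M γ' (fun q => Real.exp (ε * g q) * ρ q) := by
  have hc' : 0 < γ' / (1 - γ') := div_pos hγ' (by linarith)
  have hc : 0 < γ / (1 - γ) := div_pos (by linarith) (by linarith)
  have hc₁ : 0 < γ₁ / (1 - γ₁) := div_pos hγ₁ (by linarith)
  have hcc : γ' / (1 - γ') < γ / (1 - γ) := by
    rw [div_lt_div_iff₀ (by linarith) (by linarith)]
    nlinarith
  set K := γ₁ / (1 - γ₁) * (γ / (1 - γ) - γ' / (1 - γ')) with hK
  set P := γ' / (1 - γ') * (γ / (1 - γ)) with hP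
  have hKp : 0 < K := mul_pos hc₁ (by linarith)
  have hPp : 0 < P := mul_pos hc' hc
  -- With `c = γ / (1 - γ)`, and similarly `c'` and `c₁`, this is the largest `ε ≤ 1` with `ε c' c ≤
  -- c₁ (c - c')`. It does not depend on the point, so no compactness is needed.
  refine ⟨min 1 (K / P), fun p hp c hcs => ?_⟩
  refine (hρ.isFlatPoint hdim hflat hp hcs).strictAt_interpolation (g := inChart E c g)
    ((contDiffAt_inChart hcs (hg p)).of_le (by norm_cast)) hγ' hγγ hγ
    (lt_min one_pos (div_pos hKp hPp)) (min_le_left _ _) ?_ (h0 p hp c hcs) (h1 p hp c hcs)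
  rw [← hP, ← hK, ← le_div_iff₀ hPp]
  exact min_le_right _ _

end Indices

/-- The indices of a relatively compact domain with Levi-flat smooth boundary whose normal bundle
admits a metric of positive leafwise curvature. -/
theorem indices_eq {E : Type*} [NormedAddCommGroup E] [NormedSpace ℂ E]
    (hdim : Module.finrank ℂ E = 2) {X : Type*} [TopologicalSpace X] [T2Space X]
    [SecondCountableTopology X] [ChartedSpace E X] [IsManifold 𝓘(ℂ, E) ω X] {Ω : Set X}
    (hopen : IsOpen Ω) (hcomp : IsCompact (closure Ω)) (hsmooth : HasSmoothBoundary E Ω)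
    (hflat : IsLeviFlat E (frontier Ω)) {h : BilinField E X} (hh : IsNormalMetric (frontier Ω) h)
    (hpos : HasPositiveLeafwiseCurvature (frontier Ω) h) :
    0 < DFsBoundary E (frontier Ω) ∧ DFsBoundary E (frontier Ω) = DFsDomain E Ω ∧
      DFsDomain E Ω = DFwDomain E Ω ∧ DFwDomain E Ω = DFwBoundary E (frontier Ω) := by
  have : FiniteDimensional ℂ E := Module.finite_of_finrank_pos (by omega)
  have : FiniteDimensional ℝ E := FiniteDimensional.complexToReal E
  have : CompleteSpace E := FiniteDimensional.complete ℂ E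
  have : ProperSpace E := FiniteDimensional.proper ℂ E
  have : LocallyCompactSpace X := ChartedSpace.locallyCompactSpace E X
  have hMc : IsCompact (frontier Ω) := hcomp.of_isClosed_subset isClosed_frontier
    frontier_subset_closure
  obtain ⟨ρ, hρd⟩ := hsmooth.exists_isDefiningFunction hopen
  have hρ := hρd.isEquation
  obtain ⟨g, hg, hgn⟩ := hρ.exists_of_metric hdim isClosed_frontier hh
  have hρg := hρ.exp_mul hg
  obtain ⟨γ₁, hγ₁, hγ₁', hs⟩ := hρg.exists_isStrict hdim hflat hMc fun p hp c hc =>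
    hρg.strictAt_zero hh hpos hgn hp hc (hρg.isFlatPoint hdim hflat hp hc)
  have hpt : ∀ {r : X → ℝ}, IsEquation E (frontier Ω) r →
      IsPositiveTrivialization (frontier Ω) (defForm E r) := fun hr =>
    IsLeviFlat.isPositiveTrivialization hflat (hr.isTrivialization hdim)
  set SM : Set ℝ := {γ : ℝ | 0 < γ ∧ γ < 1 ∧ ∃ η : CForm E X,
    IsPositiveTrivialization (frontier Ω) η ∧ StrongDF (frontier Ω) γ η} with hSM
  set WM : Set ℝ := {γ : ℝ | 0 < γ ∧ γ < 1 ∧ ∃ η : CForm E X,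
    IsPositiveTrivialization (frontier Ω) η ∧ WeakDF (frontier Ω) γ η} with hWM
  set SD : Set ℝ := {γ : ℝ | 0 < γ ∧ γ < 1 ∧ ∃ (ρ : X → ℝ) (W : Set X), IsDefiningFunction E Ω ρ ∧
    IsOpen W ∧ frontier Ω ⊆ W ∧ IsStrictlyPSHOn E (fun q => -(-ρ q) ^ γ) (Ω ∩ W)} with hSD
  set WD : Set ℝ := {γ : ℝ | 0 < γ ∧ γ < 1 ∧ ∃ (ρ : X → ℝ) (W : Set X), IsDefiningFunction E Ω ρ ∧
    IsOpen W ∧ frontier Ω ⊆ W ∧ IsPSHOn E (fun q => -(-ρ q) ^ γ) (Ω ∩ W)} with hWD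
  have h1 : γ₁ ∈ SM := ⟨hγ₁, hγ₁', _, hpt hρg, hρg.strongDF_of_isStrict hdim hflat hs⟩
  have h2 : SM ⊆ SD := by
    rintro γ ⟨h0, h1, η, hη, hd⟩
    obtain ⟨f, hf, hA⟩ := hρ.exists_of_trivialization hdim isClosed_frontier hη.toIsTrivialization
    have hρf := hρ.exp_mul hf
    have hst := hρf.isStrict_of_strongDF hdim hflat hη.toIsTrivialization hA hd
    obtain ⟨W, hW, hMW, hpsh⟩ := hρf.exists_isStrictlyPSHOn hdim hflat (hρd.exp_mul hf).eq_sublevel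
      h0 h1 hst
    exact ⟨h0, h1, _, W, hρd.exp_mul hf, hW, hMW, hpsh⟩
  have h3 : SD ⊆ WD := by
    rintro γ ⟨h0, h1, r, W, hr, hW, hMW, hpsh⟩
    refine ⟨h0, h1, r, W, hr, hW, hMW, fun q hq v => ?_⟩
    by_cases hv : v = 0
    · rw [complexHessian_eq_leviK, hv]
      simp [leviK]
    · exact (hpsh q hq v hv).le
  have h4 : WD ⊆ WM := by
    rintro γ ⟨h0, h1, r, W, hr, hW, hMW, hpsh⟩
    have hre := hr.isEquation
    exact ⟨h0, h1, _, hpt hre, hre.weakDF_of_isWeak hdim hflat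
      (hre.isWeak_of_isPSHOn hdim hflat hr.eq_sublevel h0 h1 hW hMW hpsh)⟩
  have hbdd : BddAbove WM := ⟨1, fun γ hγ => hγ.2.1.le⟩
  have hbSM : BddAbove SM := ⟨1, fun γ hγ => hγ.2.1.le⟩
  -- The inclusions go the other way, so the equality of all four suprema rests on interpolation:
  -- every positive exponent below a weak one is a strict one.
  have h5 : sSup WM ≤ sSup SM := by
    refine csSup_le ⟨γ₁, h4 (h3 (h2 h1))⟩ ?_
    rintro γ ⟨h0, hγ1, η, hη, hd⟩
    refine le_of_forall_lt fun γ' hγγ => ?_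
    -- The maximum with `0` keeps the new exponent positive, since `γ'` is an arbitrary real below
    -- `γ`.
    obtain ⟨γ'', ha, hb⟩ := exists_between (max_lt hγγ h0)
    refine lt_of_lt_of_le ((le_max_left _ _).trans_lt ha) (le_csSup hbSM ?_)
    have hγ'' : 0 < γ'' := (le_max_right _ _).trans_lt ha
    obtain ⟨f, hf, hA⟩ := hρ.exists_of_trivialization hdim isClosed_frontier hη.toIsTrivialization
    have hρf := hρ.exp_mul hf
    have hw := hρf.isWeak_of_weakDF hdim hflat hη.toIsTrivialization hA hd
    -- The equation normalized by the metric is written as an exponential multiple of the one given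
    -- by the weak trivialization, the form that interpolation requires.
    have e : (fun q => Real.exp (g q) * ρ q)
        = fun q => Real.exp (g q - f q) * (Real.exp (f q) * ρ q) := by
      ext q
      rw [← mul_assoc, ← Real.exp_add, sub_add_cancel]
    have hs' : IsStrict E (frontier Ω) γ₁
        (fun q => Real.exp (g q - f q) * (Real.exp (f q) * ρ q)) := e ▸ hs
    obtain ⟨ε, hε⟩ := hρf.exists_isStrict_of_isWeak hdim hflat (g := fun q => g q - f q)
      (hg.sub hf) hγ'' hb hγ1 hγ₁ hγ₁' hw hs'
    have hρε := hρf.exp_mul (f := fun q => ε * (g q - f q))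
      ((contDiff_const.mul contDiff_id : ContDiff ℝ ∞ fun t : ℝ => ε * t).contMDiff.comp
        (hg.sub hf))
    exact ⟨hγ'', hb.trans hγ1, _, hpt hρε, hρε.strongDF_of_isStrict hdim hflat hε⟩
  have i1 : sSup SM ≤ sSup SD := csSup_le_csSup ⟨1, fun γ hγ => hγ.2.1.le⟩ ⟨γ₁, h1⟩ h2
  have i2 : sSup SD ≤ sSup WD := csSup_le_csSup ⟨1, fun γ hγ => hγ.2.1.le⟩ ⟨γ₁, h2 h1⟩ h3
  have i3 : sSup WD ≤ sSup WM := csSup_le_csSup hbdd ⟨γ₁, h3 (h2 h1)⟩ h4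
  have i0 : 0 < sSup SM := hγ₁.trans_le (le_csSup hbSM h1)
  exact ⟨i0, le_antisymm i1 (i2.trans (i3.trans h5)),
    le_antisymm i2 (i3.trans (h5.trans i1)), le_antisymm i3 (h5.trans (i1.trans i2))⟩

end CRGeometry

end

theorem mainTheorem6
    {X : Type*} [TopologicalSpace X] [T2Space X] [SecondCountableTopology X]
    [ChartedSpace (EuclideanSpace ℂ (Fin 2)) X]
    [IsManifold 𝓘(ℂ, EuclideanSpace ℂ (Fin 2)) ω X]
    (Ω : Set X) (hopen : IsOpen Ω) (hconn : IsConnected Ω) (hcomp : IsCompact (closure Ω))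
    (hsmooth : CRGeometry.HasSmoothBoundary (EuclideanSpace ℂ (Fin 2)) Ω)
    (hflat : CRGeometry.IsLeviFlat (EuclideanSpace ℂ (Fin 2)) (frontier Ω))
    (hpos : ∃ h : CRGeometry.BilinField (EuclideanSpace ℂ (Fin 2)) X,
      CRGeometry.IsNormalMetric (frontier Ω) h ∧
      CRGeometry.HasPositiveLeafwiseCurvature (frontier Ω) h) :
    0 < CRGeometry.DFsBoundary (EuclideanSpace ℂ (Fin 2)) (frontier Ω) ∧
    CRGeometry.DFsBoundary (EuclideanSpace ℂ (Fin 2)) (frontier Ω)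
      = CRGeometry.DFsDomain (EuclideanSpace ℂ (Fin 2)) Ω ∧
    CRGeometry.DFsDomain (EuclideanSpace ℂ (Fin 2)) Ω
      = CRGeometry.DFwDomain (EuclideanSpace ℂ (Fin 2)) Ω ∧
    CRGeometry.DFwDomain (EuclideanSpace ℂ (Fin 2)) Ω
      = CRGeometry.DFwBoundary (EuclideanSpace ℂ (Fin 2)) (frontier Ω) := by
  obtain ⟨h, hh, hpos⟩ := hpos
  exact CRGeometry.indices_eq (by simp) hopen hcomp hsmooth hflat hh hpos
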